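/- Let $L$ be an integral lattice (a free $\mathbb Z$-module of finite rank with an integral symmetric bilinear form $(\cdot,\cdot)$) of signature $(2,n)$, and let $\mathcal D_L^\bullet$ be one of the two connected components of $\{Z\in L\otimes\mathbb C : (Z,Z)=0,\ (Z,\bar Z)>0\}$. Let $\widetilde{\mathrm{SO}}^+(L)$ be the group of isometries of $L$ of determinant $1$ which act trivially on $L^\vee/L$ and preserve $\mathcal D_L^\bullet$. A modular form of weight $k\in\mathbb Z$ for this group is a holomorphic function $F:\mathcal D_L^\bullet\to\mathbb C$ with $F(tZ)=t^{-k}F(Z)$ for all $t\in\mathbb C^*$ and $F(gZ)=F(Z)$ for all $g\in\widetilde{\mathrm{SO}}^+(L)$, which moreover, if $n<3$, is holomorphic at the boundary: at every $0$-dimensional cusp (primitive isotropic $c\in L$) the Fourier coefficients of $F$ with index outside the closure of the positive cone of $(c^\perp/c)\otimes\mathbb R$ vanish. It is a cusp form if it vanishes at every cusp, that is, if its zeroth Fourier coefficient at every $0$-dimensional cusp is zero and its image under the Siegel operator at every $1$-dimensional cusp (rational isotropic plane) is zero. The spaces of modular forms and of cusp forms are denoted by $M_k$ and $S_k$. Let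 $F\in M_k(\widetilde{\mathrm{SO}}^+(L))$, let $r\in L$ be primitive with $(r,r)<0$, and suppose that $F$ vanishes to order (at least) $m>0$ on the rational quadratic divisor $\mathcal D_r(L)=\{Z\in\mathcal D_L^\bullet : (Z,r)=0\}$. Let $r^\perp$ be the orthogonal complement of $r$ in $L$, a lattice of signature $(2,n-1)$, and let $\mathcal D_{r^\perp}^\bullet$ be the component for $r^\perp$ that is contained in $\mathcal D_L^\bullet$. Then $F(Z)/(Z,r)^m$ extends continuously to $\mathcal D_{r^\perp}^\bullet$, and its restriction, the quasi pull-back $$F|_{r^\perp}=\left.\frac{F(Z)}{(Z,r)^m}\right|_{\mathcal D_{r^\perp}^\bullet},$$ is a cusp form of weight $k+m$: $$F|_{r^\perp}\in S_{k+m}(\widetilde{\mathrm{SO}}^+(r^\perp)).$$ No lower bound on $n$ is assumed. -/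

import Mathlib

open Filter Topology

noncomputable section

namespace OrthModular

variable {ι κ : Type*} [Fintype ι] [DecidableEq ι] [Fintype κ] [DecidableEq κ]

/-! An integral lattice `L` of rank `N` is given by its Gram matrix `S` in a fixed `ℤ`-basis indexed
by `ι`, so that `L = ι → ℤ`, `L ⊗ ℚ = ι → ℚ`, `L ⊗ ℝ = ι → ℝ` and `L ⊗ ℂ = ι → ℂ`. -/

/-- The bilinear form `(x, y)` of the lattice with Gram matrix `S`, extended to `L ⊗ R`. -/
def form {R : Type*} [CommRing R] (S : Matrix ι ι ℤ) (x y : ι → R) : R :=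
  x ⬝ᵥ ((S.map (Int.cast : ℤ → R)).mulVec y)

/-- A lattice vector (or rational or real vector) regarded as an element of a bigger space. -/
def vecCast (R : Type*) {A : Type*} [CommRing R] [CommRing A] [Algebra A R] (x : ι → A) : ι → R :=
  fun i => algebraMap A R (x i)

/-- `S` is symmetric and the real quadratic space `L ⊗ ℝ` has signature `(p, q)`:
it has an orthogonal basis of `p` vectors of square `1` and `q` vectors of square `-1`. -/
def HasSignature (S : Matrix ι ι ℤ) (p q : ℕ) : Prop :=
  S.IsSymm ∧ ∃ v : Module.Basis (Fin p ⊕ Fin q) ℝ (ι → ℝ), ∀ i j,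
    form S (v i) (v j) = if i = j then Sum.elim (fun _ => (1 : ℝ)) (fun _ => -1) i else 0

/-- A primitive vector of a lattice (in particular it is not zero). -/
def IsPrimitive (v : ι → ℤ) : Prop := ∀ (d : ℤ) (w : ι → ℤ), v = d • w → IsUnit d

/-- The dual lattice `L^∨`, as a subset of `L ⊗ ℚ`. -/
def dualLattice (S : Matrix ι ι ℤ) : Set (ι → ℚ) :=
  {x | ∀ v : ι → ℤ, ∃ j : ℤ, form S x (vecCast ℚ v) = j}

/-! ### The homogeneous domain and the modular group -/

/-- The cone `{Z ∈ L ⊗ ℂ | (Z, Z) = 0, (Z, conj Z) > 0}`; it has two connected components. -/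
def periodCone (S : Matrix ι ι ℤ) : Set (ι → ℂ) :=
  {Z | form S Z Z = 0 ∧ 0 < (form S Z (star Z)).re}

/-- `D` is the affine cone over the homogeneous domain of `L`, that is, one of the connected
components of the period cone. -/
def IsAffineCone (S : Matrix ι ι ℤ) (D : Set (ι → ℂ)) : Prop :=
  ∃ Z ∈ periodCone S, D = connectedComponentIn (periodCone S) Z

/-- The action of an integral matrix on `L ⊗ R`. -/
def act {R : Type*} [CommRing R] (g : Matrix.SpecialLinearGroup ι ℤ) (x : ι → R) : ι → R :=
  ((g : Matrix ι ι ℤ).map (Int.cast : ℤ → R)).mulVec x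

/-- The group of isometries of `L` of determinant `1` that act trivially on the discriminant
group `L^∨ / L` and preserve the chosen component `D` (real spinor norm `1`). -/
def stableSOPlus (S : Matrix ι ι ℤ) (D : Set (ι → ℂ)) : Set (Matrix.SpecialLinearGroup ι ℤ) :=
  {g | (∀ x y : ι → ℤ, form S (act g x) (act g y) = form S x y) ∧
    (∀ x ∈ dualLattice S, ∃ v : ι → ℤ, act g x - x = vecCast ℚ v) ∧
    act g '' D = D}

/-- `F` is holomorphic on the complex submanifold `D` of `L ⊗ ℂ`: locally on `D` it is the
restriction of a holomorphic function on an open subset of `L ⊗ ℂ`. -/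
def HolomorphicOnCone (D : Set (ι → ℂ)) (F : (ι → ℂ) → ℂ) : Prop :=
  ∀ Z ∈ D, ∃ U : Set (ι → ℂ), IsOpen U ∧ Z ∈ U ∧ ∃ G : (ι → ℂ) → ℂ,
    DifferentiableOn ℂ G U ∧ ∀ W ∈ U ∩ D, F W = G W

/-! ### Cusps, tube domains and Fourier expansions -/

/-- `c` is a primitive isotropic vector of `L` (it defines a `0`-dimensional cusp) and
`b ∈ L^∨` is a vector with `(c, b) = 1`. -/
def IsCuspDatum (S : Matrix ι ι ℤ) (c : ι → ℤ) (b : ι → ℚ) : Prop :=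
  IsPrimitive c ∧ form S c c = 0 ∧ b ∈ dualLattice S ∧ form S (vecCast ℚ c) b = 1

/-- `x` lies in `L_{c,b} ⊗ ℚ`, where `L_{c,b} = L ∩ c^⊥ ∩ b^⊥`. -/
def InOrthRat (S : Matrix ι ι ℤ) (c : ι → ℤ) (b x : ι → ℚ) : Prop :=
  form S x (vecCast ℚ c) = 0 ∧ form S x b = 0

/-- The point `[z] = z + b - ((z, z) + (b, b)) / 2 • c` with affine coordinate `z`. -/
def tubePoint (S : Matrix ι ι ℤ) (c : ι → ℤ) (b : ι → ℚ) (z : ι → ℂ) : ι → ℂ :=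
  z + vecCast ℂ b - ((form S z z + form S (vecCast ℂ b) (vecCast ℂ b)) / 2) • vecCast ℂ c

/-- The tube domain `H_c ⊆ L_{c,b} ⊗ ℂ`, on which `z ↦ [z]` is an isomorphism to
`{Z ∈ D | (Z, c) = 1}`. -/
def tubeDomain (S : Matrix ι ι ℤ) (D : Set (ι → ℂ)) (c : ι → ℤ) (b : ι → ℚ) : Set (ι → ℂ) :=
  {z | form S z (vecCast ℂ c) = 0 ∧ form S z (vecCast ℂ b) = 0 ∧ tubePoint S c b z ∈ D}

/-- The positive cone `C⁺ ⊆ L_{c,b} ⊗ ℝ`, for which `H_c = L_{c,b} ⊗ ℝ + i C⁺`. Since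
`([z], conj [z]) = 2 (Im z, Im z)`, it is a component of `{y | (y, y) > 0}`. -/
def positiveCone (S : Matrix ι ι ℤ) (D : Set (ι → ℂ)) (c : ι → ℤ) (b : ι → ℚ) : Set (ι → ℝ) :=
  {y | Complex.I • vecCast ℂ y ∈ tubeDomain S D c b}

/-- The rational vectors in the closure of the positive cone `C⁺`. -/
def closedConeRat (S : Matrix ι ι ℤ) (D : Set (ι → ℂ)) (c : ι → ℤ) (b : ι → ℚ) : Set (ι → ℚ) :=
  {l | InOrthRat S c b l ∧ 0 ≤ form S l l ∧
    ∀ y ∈ positiveCone S D c b, 0 ≤ form S (vecCast ℝ l) y}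

/-- `F_c(z) = F([z])` has the Fourier expansion `∑_l f(l) exp (2 π i (l, z))` on the tube domain.
The index `l` runs over the dual of a finite index sublattice of `L_{c,b}`; such a dual lattice
is contained in `(1 / N) L_{c,b}^∨` for some `N`, outside which `f` is extended by `0`. -/
def HasFourierExpansion (S : Matrix ι ι ℤ) (D : Set (ι → ℂ)) (c : ι → ℤ) (b : ι → ℚ)
    (F : (ι → ℂ) → ℂ) (f : (ι → ℚ) → ℂ) : Prop :=
  (∃ N : ℕ, 0 < N ∧ ∀ l, f l ≠ 0 → InOrthRat S c b l ∧
    ∀ v : ι → ℤ, InOrthRat S c b (vecCast ℚ v) → ∃ j : ℤ, N * form S l (vecCast ℚ v) = j) ∧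
  ∀ z ∈ tubeDomain S D c b,
    HasSum (fun l : ι → ℚ => f l * Complex.exp (2 * Real.pi * Complex.I * form S (vecCast ℂ l) z))
      (F (tubePoint S c b z))

/-- `F` is holomorphic at the boundary: at every `0`-dimensional cusp the Fourier coefficients
vanish outside the closure of the positive cone. -/
def HolomorphicAtBoundary (S : Matrix ι ι ℤ) (D : Set (ι → ℂ)) (F : (ι → ℂ) → ℂ) : Prop :=
  ∀ c b, IsCuspDatum S c b → ∃ f, HasFourierExpansion S D c b F f ∧
    ∀ l, f l ≠ 0 → l ∈ closedConeRat S D c b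

/-- The value of `F` at every `0`-dimensional cusp, which is its zeroth Fourier coefficient,
is zero. -/
def VanishesAtZeroDimCusps (S : Matrix ι ι ℤ) (D : Set (ι → ℂ)) (F : (ι → ℂ) → ℂ) : Prop :=
  ∀ c b, IsCuspDatum S c b → ∃ f, HasFourierExpansion S D c b F f ∧ f 0 = 0

/-- The restriction of `F` to every `1`-dimensional cusp is zero. Such a cusp is an isotropic plane
`E` of `L ⊗ ℚ`; it has a basis `c, e` with `c` a primitive isotropic vector and `e ∈ L_{c,b}` an
isotropic vector in the closure of the positive cone at `c`. The restriction is given by the Siegel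
operator `Φ_E(F)(z) = lim_{t → ∞} F_c(z + i t e)`, which depends on `(z, e)` only. -/
def VanishesAtOneDimCusps (S : Matrix ι ι ℤ) (D : Set (ι → ℂ)) (F : (ι → ℂ) → ℂ) : Prop :=
  ∀ c b, IsCuspDatum S c b → ∀ e : ι → ℤ, e ≠ 0 → form S e e = 0 →
    vecCast ℚ e ∈ closedConeRat S D c b → ∀ z ∈ tubeDomain S D c b,
      Tendsto (fun t : ℝ => F (tubePoint S c b (z + ((t : ℂ) * Complex.I) • vecCast ℂ e)))
        atTop (𝓝 0)

/-! ### Modular forms and cusp forms -/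

/-- Modular forms of weight `k` with trivial character for the group `stableSOPlus S D`, where `S`
has signature `(2, n)`, so that the rank is `n + 2`. Holomorphy at the boundary is required
if `n < 3`. -/
structure IsModularForm (S : Matrix ι ι ℤ) (D : Set (ι → ℂ)) (k : ℤ) (F : (ι → ℂ) → ℂ) :
    Prop where
  holomorphic : HolomorphicOnCone D F
  homogeneous : ∀ t : ℂ, t ≠ 0 → ∀ Z ∈ D, F (t • Z) = t ^ (-k) * F Z
  invariant : ∀ g ∈ stableSOPlus S D, ∀ Z ∈ D, F (act g Z) = F Z
  boundary : Fintype.card ι < 3 + 2 → HolomorphicAtBoundary S D F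

/-- Cusp forms of weight `k` for the group `stableSOPlus S D`. -/
structure IsCuspForm (S : Matrix ι ι ℤ) (D : Set (ι → ℂ)) (k : ℤ) (F : (ι → ℂ) → ℂ) :
    Prop extends IsModularForm S D k F where
  zero_dim : VanishesAtZeroDimCusps S D F
  one_dim : VanishesAtOneDimCusps S D F

/-! ### The quasi pull-back -/

/-- `F` vanishes to order (at least) `m` on the rational quadratic divisor
`{Z ∈ D | (Z, r) = 0}`: locally on `D`, near each point of the divisor, `F` is divisible by the
`m`-th power of the equation `(Z, r)` of the divisor. -/
def VanishesToOrder (S : Matrix ι ι ℤ) (D : Set (ι → ℂ)) (F : (ι → ℂ) → ℂ) (r : ι → ℤ)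
    (m : ℕ) : Prop :=
  ∀ Z ∈ D, form S Z (vecCast ℂ r) = 0 → ∃ U : Set (ι → ℂ), IsOpen U ∧ Z ∈ U ∧
    ∃ G : (ι → ℂ) → ℂ, DifferentiableOn ℂ G U ∧
      ∀ W ∈ U ∩ D, F W = form S W (vecCast ℂ r) ^ m * G W

/-- The sublattice `r^⊥` of `L`. -/
def orthLattice (S : Matrix ι ι ℤ) (r : ι → ℤ) : Submodule ℤ (ι → ℤ) where
  carrier := {v | form S v r = 0}
  add_mem' := by
    intro a b ha hb
    simp only [Set.mem_ofPred_eq, form, add_dotProduct] at *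
    rw [ha, hb, add_zero]
  zero_mem' := by simp [form]
  smul_mem' := by
    intro t a ha
    simp only [Set.mem_ofPred_eq, form, smul_dotProduct] at *
    rw [ha, smul_zero]

/-- The Gram matrix of the lattice `r^⊥` in a `ℤ`-basis `e`. -/
def orthGram (S : Matrix ι ι ℤ) (r : ι → ℤ) (e : Module.Basis κ ℤ (orthLattice S r)) :
    Matrix κ κ ℤ :=
  Matrix.of fun i j => form S (e i : ι → ℤ) (e j : ι → ℤ)

/-- The inclusion `r^⊥ ⊗ ℂ → L ⊗ ℂ`, in terms of a `ℤ`-basis `e` of `r^⊥`. -/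
def orthEmbed (S : Matrix ι ι ℤ) (r : ι → ℤ) (e : Module.Basis κ ℤ (orthLattice S r))
    (W : κ → ℂ) : ι → ℂ :=
  ∑ j, W j • vecCast ℂ (e j : ι → ℤ)

/-- The filter of points of `D` outside the divisor `(W, r) = 0` which tend to `Z`. -/
def offDivisor (S : Matrix ι ι ℤ) (D : Set (ι → ℂ)) (r : ι → ℤ) (Z : ι → ℂ) : Filter (ι → ℂ) :=
  𝓝[{W | W ∈ D ∧ form S W (vecCast ℂ r) ≠ 0}] Z

/-- The quasi pull-back: the function `F(W) / (W, r)^m`, extended by continuity to the points `Z` of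
`D` with `(Z, r) = 0`. -/
def quasiPullback (S : Matrix ι ι ℤ) (D : Set (ι → ℂ)) (F : (ι → ℂ) → ℂ) (r : ι → ℤ) (m : ℕ)
    (Z : ι → ℂ) : ℂ :=
  limUnder (offDivisor S D r Z) fun W => F W / form S W (vecCast ℂ r) ^ m

end OrthModular

end

/-!
The quasi pull-back is a modular form for formal reasons. Near a point of the divisor `(Z, r) = 0`
one has `F(Z) = (Z, r)^m G(Z)` with `G` holomorphic, so the limit of `F(Z) / (Z, r)^m` exists and
equals `G` (`tendsto_quasiPullback`, `quasiPullback_eq`); the points off the divisor accumulate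
at `Z` because of an explicit isotropic curve (`normalCurve`). The weight goes up by `m` because
`(Z, r)^m` is homogeneous of degree `m`, and a stable isometry of `r^⊥`, extended by the identity
on `r`, is a stable isometry of `L` (`exists_extension`).

Cuspidality is read off from Fourier expansions. A `0`-dimensional cusp `c` of `r^⊥` is also a
`0`-dimensional cusp of `L`. Along the curve `ζ ↦ Z + ζ r - ζ² (r, r) / 2 c` one has
`F = ∑_l f(l) exp (2 π i (l, Z)) exp (2 π i ζ (l, r))` and `(·, r) = ζ (r, r)`, so the quasi
pull-back is, up to the factor `(r, r)^m`, the coefficient of `ζ^m`, which is obtained by expanding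
term by term (`hasSum_taylor_coeff`):
`∑_l f(l) (2 π i (l, r))^m / m! exp (2 π i (l, Z))`.
On `r^⊥` the index `l` may be replaced by its orthogonal projection to `r^⊥`, of norm
`(l, l) - (l, r)² / (r, r)`. Since `F` is holomorphic at the boundary, `(l, l) ≥ 0`; since `m > 0`,
only the `l` with `(l, r) ≠ 0` contribute; and `(r, r) < 0`. So all the indices of the expansion
of the quasi pull-back lie in the closure of the positive cone and have positive norm
(`exists_pullback_expansion`). In particular its zeroth coefficient vanishes, and so do its images
under the Siegel operators, because `(l, e) > 0` for every such index `l` and every isotropic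
`e ≠ 0` in the closure of the positive cone (`tendsto_siegel_zero`).

Holomorphy of `F` at the boundary is part of the definition for `n < 3` only. For `n ≥ 3` it is the
Koecher principle (`holomorphicAtBoundary_of_five_le_card`). Invariance under Eichler transvections
makes `F` periodic on the tube domain at a cusp, which gives a Fourier expansion and Cauchy's
estimates for its coefficients (`exists_fourier_expansion`, `exists_cusp_expansion`). For an index
`l` outside the closure of the positive cone there is an integral `u` in the positive cone with
`(l, u) < 0`. As `L_{c,b}` has rank `n ≥ 3`, the vector `u` lies in an integral plane of
signature `(1, 1)` without isotropic vectors, on which Pell's equation provides infinitely many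
units. They are stable isometries (`pellMove`) and move `u` to vectors whose product with `l` tends
to `-∞`, so that Cauchy's estimate forces the coefficient to vanish.
-/

noncomputable section

set_option linter.unusedSectionVars false

namespace OrthModular

variable {ι κ : Type*} [Fintype ι] [Fintype κ]

/-! ### Algebra of the bilinear form -/

section Form

variable {R : Type*} [CommRing R] (S : Matrix ι ι ℤ)

lemma form_eq_sum (x y : ι → R) : form S x y = ∑ i, ∑ j, x i * S i j * y j := by
  simp only [form, dotProduct, Matrix.mulVec, Matrix.map_apply, Finset.mul_sum, mul_assoc]

lemma form_add_left (x y z : ι → R) : form S (x + y) z = form S x z + form S y z := by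
  simp [form, add_dotProduct]

lemma form_add_right (x y z : ι → R) : form S x (y + z) = form S x y + form S x z := by
  simp [form, Matrix.mulVec_add, dotProduct_add]

lemma form_smul_left (t : R) (x y : ι → R) : form S (t • x) y = t * form S x y := by
  simp [form, smul_dotProduct]

lemma form_smul_right (t : R) (x y : ι → R) : form S x (t • y) = t * form S x y := by
  simp [form, Matrix.mulVec_smul, dotProduct_smul]

lemma form_neg_left (x y : ι → R) : form S (-x) y = -form S x y := by
  simp [form, neg_dotProduct]

lemma form_neg_right (x y : ι → R) : form S x (-y) = -form S x y := by
  simp [form, Matrix.mulVec_neg, dotProduct_neg]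

lemma form_sub_left (x y z : ι → R) : form S (x - y) z = form S x z - form S y z := by
  rw [sub_eq_add_neg, form_add_left, form_neg_left, sub_eq_add_neg]

lemma form_sub_right (x y z : ι → R) : form S x (y - z) = form S x y - form S x z := by
  rw [sub_eq_add_neg, form_add_right, form_neg_right, sub_eq_add_neg]

lemma form_zero_left (x : ι → R) : form S 0 x = 0 := by simp [form]

lemma form_sum_left {α : Type*} (s : Finset α) (f : α → ι → R) (y : ι → R) :
    form S (∑ a ∈ s, f a) y = ∑ a ∈ s, form S (f a) y := by
  classical
  induction s using Finset.induction_on with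
  | empty => simp [form_zero_left]
  | insert a s ha ih => rw [Finset.sum_insert ha, form_add_left, ih, Finset.sum_insert ha]

variable {S}

lemma form_comm (hS : S.IsSymm) (x y : ι → R) : form S x y = form S y x := by
  rw [form_eq_sum, form_eq_sum, Finset.sum_comm]
  refine Finset.sum_congr rfl fun i _ => Finset.sum_congr rfl fun j _ => ?_
  rw [hS.apply i j]
  ring

lemma form_sum_right (hS : S.IsSymm) {α : Type*} (s : Finset α) (f : α → ι → R) (y : ι → R) :
    form S y (∑ a ∈ s, f a) = ∑ a ∈ s, form S y (f a) := by
  rw [form_comm hS, form_sum_left]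
  exact Finset.sum_congr rfl fun a _ => form_comm hS _ _

variable (S)

lemma form_vecCast {A : Type*} [CommRing A] [Algebra A R] (x y : ι → A) :
    form S (vecCast R x) (vecCast R y) = algebraMap A R (form S x y) := by
  simp [form_eq_sum, vecCast]

end Form

section VecCast

variable {A B R : Type*} [CommRing A] [CommRing B] [CommRing R] [Algebra A B] [Algebra B R]
  [Algebra A R]

lemma vecCast_vecCast [IsScalarTower A B R] (x : ι → A) :
    vecCast R (vecCast B x) = vecCast R x := by
  funext i
  exact (IsScalarTower.algebraMap_apply A B R (x i)).symm

lemma vecCast_add (x y : ι → A) : vecCast R (x + y) = vecCast R x + vecCast R y := by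
  funext i; simp [vecCast]

lemma vecCast_sub (x y : ι → A) : vecCast R (x - y) = vecCast R x - vecCast R y := by
  funext i; simp [vecCast]

lemma vecCast_neg (x : ι → A) : vecCast R (-x) = -vecCast R x := by
  funext i; simp [vecCast]

lemma vecCast_smul (t : A) (x : ι → A) : vecCast R (t • x) = algebraMap A R t • vecCast R x := by
  funext i; simp [vecCast]

lemma vecCast_zero : vecCast R (0 : ι → A) = 0 := by
  funext i; simp [vecCast]

lemma vecCast_injective (h : Function.Injective (algebraMap A R)) :
    Function.Injective (vecCast R : (ι → A) → ι → R) := fun _ _ hxy =>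
  funext fun i => h (congrFun hxy i)

end VecCast

/-- The forms of an integral and a rational vector, computed in a bigger ring. -/
lemma form_vecCast_int_rat (S : Matrix ι ι ℤ) (R : Type*) [CommRing R] [Algebra ℚ R]
    (c : ι → ℤ) (b : ι → ℚ) :
    form S (vecCast R c) (vecCast R b) = algebraMap ℚ R (form S (vecCast ℚ c) b) := by
  rw [← form_vecCast, vecCast_vecCast]

/-! ### Real and imaginary parts -/

/-- The real part of a vector of `L ⊗ ℂ`. -/
def reVec (z : ι → ℂ) : ι → ℝ := fun i => (z i).re

/-- The imaginary part of a vector of `L ⊗ ℂ`. -/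
def imVec (z : ι → ℂ) : ι → ℝ := fun i => (z i).im

lemma vec_eq_re_add_im (z : ι → ℂ) :
    z = vecCast ℂ (reVec z) + Complex.I • vecCast ℂ (imVec z) := by
  funext i
  simp [vecCast, reVec, imVec, mul_comm Complex.I, Complex.re_add_im]

lemma star_eq_re_sub_im (z : ι → ℂ) :
    star z = vecCast ℂ (reVec z) - Complex.I • vecCast ℂ (imVec z) := by
  funext i
  apply Complex.ext <;> simp [vecCast, reVec, imVec]

lemma imVec_add (z w : ι → ℂ) : imVec (z + w) = imVec z + imVec w := by
  funext i; simp [imVec]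

lemma imVec_sub (z w : ι → ℂ) : imVec (z - w) = imVec z - imVec w := by
  funext i; simp [imVec]

lemma imVec_vecCast (x : ι → ℝ) : imVec (vecCast ℂ x) = 0 := by
  funext i; simp [imVec, vecCast]

lemma imVec_vecCast_rat (x : ι → ℚ) : imVec (vecCast ℂ x) = 0 := by
  funext i; simp [imVec, vecCast]

lemma imVec_I_smul (x : ι → ℝ) : imVec (Complex.I • vecCast ℂ x) = x := by
  funext i; simp [imVec, vecCast]

lemma imVec_real_smul (t : ℝ) (z : ι → ℂ) : imVec ((t : ℂ) • z) = t • imVec z := by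
  funext i; simp [imVec]

lemma continuous_imVec : Continuous (imVec : (ι → ℂ) → ι → ℝ) := by
  unfold imVec; fun_prop

lemma form_real_right (S : Matrix ι ι ℤ) (z : ι → ℂ) (a : ι → ℝ) :
    form S z (vecCast ℂ a) =
      ((form S (reVec z) a : ℝ) : ℂ) + Complex.I * ((form S (imVec z) a : ℝ) : ℂ) := by
  conv_lhs => rw [vec_eq_re_add_im z]
  rw [form_add_left, form_smul_left, form_vecCast, form_vecCast]
  rfl

lemma form_real_right_re (S : Matrix ι ι ℤ) (z : ι → ℂ) (a : ι → ℝ) :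
    (form S z (vecCast ℂ a)).re = form S (reVec z) a := by
  simp [form_real_right]

lemma form_real_right_im (S : Matrix ι ι ℤ) (z : ι → ℂ) (a : ι → ℝ) :
    (form S z (vecCast ℂ a)).im = form S (imVec z) a := by
  simp [form_real_right]

lemma form_self_eq {S : Matrix ι ι ℤ} (hS : S.IsSymm) (z : ι → ℂ) :
    form S z z = ((form S (reVec z) (reVec z) - form S (imVec z) (imVec z) : ℝ) : ℂ)
      + Complex.I * ((2 * form S (reVec z) (imVec z) : ℝ) : ℂ) := by
  conv_lhs => rw [vec_eq_re_add_im z]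
  simp only [form_add_left, form_add_right, form_smul_left, form_smul_right, form_vecCast,
    form_comm hS (imVec z) (reVec z), Complex.coe_algebraMap]
  push_cast
  linear_combination ((form S (imVec z) (imVec z) : ℝ) : ℂ) * Complex.I_sq

lemma form_star_eq {S : Matrix ι ι ℤ} (hS : S.IsSymm) (z : ι → ℂ) :
    form S z (star z) = ((form S (reVec z) (reVec z) + form S (imVec z) (imVec z) : ℝ) : ℂ) := by
  rw [star_eq_re_sub_im]
  conv_lhs => enter [2]; rw [vec_eq_re_add_im z]
  simp only [form_add_left, form_sub_right, form_smul_left, form_smul_right, form_vecCast,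
    form_comm hS (imVec z) (reVec z), Complex.coe_algebraMap]
  push_cast
  linear_combination -((form S (imVec z) (imVec z) : ℝ) : ℂ) * Complex.I_sq

lemma continuous_form {R X : Type*} [CommRing R] [TopologicalSpace R] [IsTopologicalRing R]
    [TopologicalSpace X] (S : Matrix ι ι ℤ) {f g : X → ι → R} (hf : Continuous f)
    (hg : Continuous g) : Continuous fun x => form S (f x) (g x) := by
  simp only [form_eq_sum]
  fun_prop

lemma differentiable_form {E : Type*} [NormedAddCommGroup E] [NormedSpace ℂ E]
    (S : Matrix ι ι ℤ) {f g : E → ι → ℂ} (hf : Differentiable ℂ f) (hg : Differentiable ℂ g) :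
    Differentiable ℂ fun x => form S (f x) (g x) := by
  simp only [form_eq_sum]
  fun_prop

/-! ### Signature -/

/-- A real quadratic space with at most two positive squares, in the form in which this is used:
two orthogonal vectors of positive square have no nonzero vector of nonnegative square in the
orthogonal complement of their span. -/
def AtMostTwoPositive (S : Matrix ι ι ℤ) : Prop :=
  ∀ x₁ x₂ x₃ : ι → ℝ, form S x₁ x₂ = 0 → form S x₁ x₃ = 0 → form S x₂ x₃ = 0 →
    0 < form S x₁ x₁ → 0 < form S x₂ x₂ → 0 ≤ form S x₃ x₃ → x₃ = 0

lemma form_eq_sum_sq {S : Matrix ι ι ℤ} (hS : S.IsSymm) {p q : ℕ}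
    (v : Module.Basis (Fin p ⊕ Fin q) ℝ (ι → ℝ))
    (hv : ∀ i j, form S (v i) (v j) =
      if i = j then Sum.elim (fun _ => (1 : ℝ)) (fun _ => -1) i else 0) (x : ι → ℝ) :
    form S x x = ∑ i, v.repr x (.inl i) ^ 2 - ∑ i, v.repr x (.inr i) ^ 2 := by
  have h : form S (∑ i, v.repr x i • v i) (∑ i, v.repr x i • v i) =
      ∑ i, v.repr x (.inl i) ^ 2 - ∑ i, v.repr x (.inr i) ^ 2 := by
    simp only [form_sum_left, form_sum_right hS, form_smul_left, form_smul_right, hv, mul_ite,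
      mul_zero, Finset.sum_ite_eq', Finset.mem_univ, if_true]
    rw [Fintype.sum_sum_type]
    simp only [Sum.elim_inl, Sum.elim_inr, mul_one, mul_neg, Finset.sum_neg_distrib, sq,
      sub_eq_add_neg]
  rwa [v.sum_repr] at h

lemma HasSignature.atMostTwoPositive {S : Matrix ι ι ℤ} {n : ℕ} (hS : HasSignature S 2 n) :
    AtMostTwoPositive S := by
  obtain ⟨hsym, v, hv⟩ := hS
  intro x₁ x₂ x₃ h12 h13 h23 h1 h2 h3
  -- some combination of the three vectors has no coordinates on the two positive basis vectors
  let T : (Fin 3 → ℝ) →ₗ[ℝ] (Fin 2 → ℝ) :=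
    { toFun := fun a i => v.repr (a 0 • x₁ + a 1 • x₂ + a 2 • x₃) (.inl i)
      map_add' := by intro a b; ext i; simp [add_mul]; ring
      map_smul' := by intro t a; ext i; simp; ring }
  obtain ⟨a, ha, ha0⟩ := Submodule.exists_mem_ne_zero_of_ne_bot
    (LinearMap.ker_ne_bot_of_finrank_lt (f := T) (by simp))
  set w := a 0 • x₁ + a 1 • x₂ + a 2 • x₃ with hw
  have hwl : ∀ i, v.repr w (.inl i) = 0 := fun i => congrFun ha i
  have e1 : form S w w = a 0 ^ 2 * form S x₁ x₁ + a 1 ^ 2 * form S x₂ x₂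
      + a 2 ^ 2 * form S x₃ x₃ := by
    simp only [hw, form_add_left, form_add_right, form_smul_left, form_smul_right, h12, h13, h23,
      form_comm hsym x₂ x₁, form_comm hsym x₃ x₁, form_comm hsym x₃ x₂]
    ring
  have e2 := form_eq_sum_sq hsym v hv w
  simp only [hwl, ne_eq, OfNat.ofNat_ne_zero, not_false_eq_true, zero_pow, Finset.sum_const_zero,
    zero_sub] at e2
  have hge : 0 ≤ ∑ i, v.repr w (.inr i) ^ 2 := Finset.sum_nonneg fun i _ => sq_nonneg _
  have t1 : 0 ≤ a 0 ^ 2 * form S x₁ x₁ := by positivity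
  have t2 : 0 ≤ a 1 ^ 2 * form S x₂ x₂ := by positivity
  have t3 : 0 ≤ a 2 ^ 2 * form S x₃ x₃ := by positivity
  have hz : ∑ i, v.repr w (.inr i) ^ 2 = 0 := by linarith
  have hw0 : w = 0 := by
    apply v.ext_elem
    rintro (i | i)
    · simp [hwl]
    · have := (Finset.sum_eq_zero_iff_of_nonneg fun i _ => sq_nonneg _).1 hz i (Finset.mem_univ i)
      simpa using this
  have ha1 : a 0 = 0 := by
    have : a 0 ^ 2 * form S x₁ x₁ = 0 := by linarith
    simpa [h1.ne'] using this
  have ha2 : a 1 = 0 := by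
    have : a 1 ^ 2 * form S x₂ x₂ = 0 := by linarith
    simpa [h2.ne'] using this
  have h : a 2 • x₃ = 0 := by simpa [hw, ha1, ha2] using hw0
  rcases smul_eq_zero.1 h with h | h
  · exact absurd (by ext i; fin_cases i <;> simp [ha1, ha2, h]) ha0
  · exact h

lemma HasSignature.det_ne_zero [DecidableEq ι] {S : Matrix ι ι ℤ} {p q : ℕ}
    (hS : HasSignature S p q) : S.det ≠ 0 := by
  obtain ⟨hsym, v, hv⟩ := hS
  intro h
  have h' : (S.map (Int.cast : ℤ → ℝ)).det = 0 := by
    have := (Int.castRingHom ℝ).map_det S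
    rw [h] at this
    simpa using this.symm
  obtain ⟨x, hx0, hx⟩ := Matrix.exists_mulVec_eq_zero_iff.2 h'
  refine hx0 (v.ext_elem fun i => ?_)
  have h1 : form S (v i) x = 0 := by simp [form, hx]
  rw [← v.sum_repr x, form_sum_right hsym] at h1
  simp only [form_smul_right, hv, mul_ite, mul_zero, Finset.sum_ite_eq, Finset.mem_univ,
    if_true] at h1
  rcases i with i | i <;> simpa using h1

/-! ### Components of the period cone -/

lemma isOpen_pos (S : Matrix ι ι ℤ) : IsOpen {Z : ι → ℂ | 0 < (form S Z (star Z)).re} :=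
  isOpen_lt continuous_const
    (Complex.continuous_re.comp (continuous_form S continuous_id continuous_star))

namespace IsAffineCone

variable {S : Matrix ι ι ℤ} {D : Set (ι → ℂ)}

lemma subset_periodCone (hD : IsAffineCone S D) : D ⊆ periodCone S := by
  obtain ⟨Z, -, rfl⟩ := hD
  exact connectedComponentIn_subset _ _

lemma nonempty (hD : IsAffineCone S D) : D.Nonempty := by
  obtain ⟨Z, hZ, rfl⟩ := hD
  exact ⟨Z, mem_connectedComponentIn hZ⟩

lemma isPreconnected (hD : IsAffineCone S D) : IsPreconnected D := by
  obtain ⟨Z, -, rfl⟩ := hD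
  exact isPreconnected_connectedComponentIn

lemma eq_component (hD : IsAffineCone S D) {Z : ι → ℂ} (hZ : Z ∈ D) :
    D = connectedComponentIn (periodCone S) Z := by
  obtain ⟨Z', -, rfl⟩ := hD
  exact connectedComponentIn_eq hZ

/-- A connected subset of the period cone that meets `D` is contained in `D`. -/
lemma subset_of_isPreconnected (hD : IsAffineCone S D) {A : Set (ι → ℂ)} (hA : IsPreconnected A)
    (hAP : A ⊆ periodCone S) {Z : ι → ℂ} (hZA : Z ∈ A) (hZ : Z ∈ D) : A ⊆ D := by
  rw [hD.eq_component hZ]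
  exact hA.subset_connectedComponentIn hZA hAP

lemma smul_mem (hD : IsAffineCone S D) {t : ℂ} (ht : t ≠ 0) {Z : ι → ℂ} (hZ : Z ∈ D) :
    t • Z ∈ D := by
  have hP := hD.subset_periodCone hZ
  refine hD.subset_of_isPreconnected (A := (fun s : ℂ => s • Z) '' {0}ᶜ) (Z := Z)
    ((isConnected_compl_singleton_of_one_lt_rank (by simp) (0 : ℂ)).isPreconnected.image _
      (by fun_prop)) ?_ ⟨1, by simp, by simp⟩ hZ ⟨t, ht, rfl⟩
  rintro _ ⟨s, hs, rfl⟩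
  refine ⟨by rw [form_smul_left, form_smul_right, hP.1]; simp, ?_⟩
  have : star (s • Z) = star s • star Z := star_smul s Z
  rw [this, form_smul_left, form_smul_right, ← mul_assoc, Complex.star_def, Complex.mul_conj,
    Complex.re_ofReal_mul]
  exact mul_pos (Complex.normSq_pos.2 hs) hP.2

/-- A continuous curve of isotropic vectors through a point of `D` stays in `D` for a while. -/
lemma eventually_mem_of_curve (hD : IsAffineCone S D) {γ : ℂ → ι → ℂ} (hγ : Continuous γ)
    (h0 : γ 0 ∈ D) (hiso : ∀ t, form S (γ t) (γ t) = 0) : ∀ᶠ t in 𝓝 0, γ t ∈ D := by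
  have hopen : γ ⁻¹' {Z | 0 < (form S Z (star Z)).re} ∈ 𝓝 (0 : ℂ) :=
    ((isOpen_pos S).preimage hγ).mem_nhds (hD.subset_periodCone h0).2
  obtain ⟨ε, hε, hsub⟩ := Metric.mem_nhds_iff.1 hopen
  filter_upwards [Metric.ball_mem_nhds (0 : ℂ) hε] with t ht
  refine hD.subset_of_isPreconnected (A := γ '' Metric.ball 0 ε)
    ((convex_ball (0 : ℂ) ε).isPreconnected.image _ hγ.continuousOn) ?_
    ⟨0, Metric.mem_ball_self hε, rfl⟩ h0 ⟨t, ht, rfl⟩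
  rintro _ ⟨s, hs, rfl⟩
  exact ⟨hiso s, hsub hs⟩

end IsAffineCone

lemma act_eq_mulVec [DecidableEq ι] {R : Type*} [CommRing R] (g : Matrix.SpecialLinearGroup ι ℤ)
    (x : ι → R) : act g x = ((g : Matrix ι ι ℤ).map (Int.cast : ℤ → R)).mulVec x := rfl

lemma map_cast_mul {α β γ : Type*} [Fintype β] (R : Type*) [CommRing R] (M : Matrix α β ℤ)
    (N : Matrix β γ ℤ) : (M * N).map (Int.cast : ℤ → R) =
      (M.map (Int.cast : ℤ → R) * N.map (Int.cast : ℤ → R) : Matrix α γ R) :=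
  Matrix.map_mul (f := Int.castRingHom R)

/-- A linear map that carries one integral form to another does so over every ring. -/
lemma form_mulVec (S : Matrix ι ι ℤ) (S' : Matrix κ κ ℤ) (M : Matrix ι κ ℤ)
    (hM : M.transpose * S * M = S') {R : Type*} [CommRing R] (x y : κ → R) :
    form S ((M.map (Int.cast : ℤ → R)).mulVec x) ((M.map (Int.cast : ℤ → R)).mulVec y) =
      form S' x y := by
  rw [← hM]
  simp only [form, map_cast_mul]
  rw [← Matrix.mulVec_mulVec, ← Matrix.mulVec_mulVec, Matrix.transpose_map,
    Matrix.dotProduct_mulVec x, Matrix.vecMul_transpose]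

lemma matrix_eq_of_form_eq [DecidableEq ι] {S T : Matrix ι ι ℤ}
    (h : ∀ x y : ι → ℤ, form S x y = form T x y) : S = T := by
  ext i j
  simpa [form_eq_sum, Pi.single_apply] using h (Pi.single i 1) (Pi.single j 1)

/-- An isometry over `ℤ` is an isometry over every ring. -/
lemma form_act [DecidableEq ι] {R : Type*} [CommRing R] {S : Matrix ι ι ℤ}
    {g : Matrix.SpecialLinearGroup ι ℤ}
    (hg : ∀ x y : ι → ℤ, form S (act g x) (act g y) = form S x y) (x y : ι → R) :
    form S (act g x) (act g y) = form S x y := by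
  have key : (g : Matrix ι ι ℤ).transpose * S * (g : Matrix ι ι ℤ) = S := by
    refine matrix_eq_of_form_eq fun x y => ?_
    rw [← form_mulVec S _ (g : Matrix ι ι ℤ) rfl]
    exact hg x y
  exact form_mulVec S S _ key x y

lemma act_star [DecidableEq ι] (g : Matrix.SpecialLinearGroup ι ℤ) (Z : ι → ℂ) :
    act g (star Z) = star (act g Z) := by
  funext i
  simp [act, Matrix.mulVec, dotProduct]

lemma act_mul [DecidableEq ι] {R : Type*} [CommRing R] (g h : Matrix.SpecialLinearGroup ι ℤ)
    (x : ι → R) : act (g * h) x = act g (act h x) := by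
  simp only [act, Matrix.SpecialLinearGroup.coe_mul, map_cast_mul]
  exact (Matrix.mulVec_mulVec _ _ _).symm

lemma act_one [DecidableEq ι] {R : Type*} [CommRing R] (x : ι → R) :
    act (1 : Matrix.SpecialLinearGroup ι ℤ) x = x := by
  simp [act]

lemma continuous_act [DecidableEq ι] (g : Matrix.SpecialLinearGroup ι ℤ) :
    Continuous (act g : (ι → ℂ) → ι → ℂ) := by
  unfold act; fun_prop

/-- An integral isometry that maps one point of `D` into `D` preserves `D`. -/
lemma act_image_eq [DecidableEq ι] {S : Matrix ι ι ℤ} {D : Set (ι → ℂ)} (hD : IsAffineCone S D)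
    {g : Matrix.SpecialLinearGroup ι ℤ}
    (hg : ∀ x y : ι → ℤ, form S (act g x) (act g y) = form S x y)
    {Z : ι → ℂ} (hZ : Z ∈ D) (hgZ : act g Z ∈ D) : act g '' D = D := by
  let H : (ι → ℂ) ≃ₜ (ι → ℂ) :=
    { toFun := act g
      invFun := act g⁻¹
      left_inv := fun x => by rw [← act_mul, inv_mul_cancel, act_one]
      right_inv := fun x => by rw [← act_mul, mul_inv_cancel, act_one]
      continuous_toFun := continuous_act g
      continuous_invFun := continuous_act _ }
  have hmem : ∀ W, act g W ∈ periodCone S ↔ W ∈ periodCone S := fun W => by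
    simp only [periodCone, Set.mem_ofPred_eq, ← act_star, form_act hg]
  have himg : H '' periodCone S = periodCone S := by
    ext W
    constructor
    · rintro ⟨V, hV, rfl⟩
      exact (hmem V).2 hV
    · intro hW
      refine ⟨H.symm W, (hmem _).1 ?_, H.apply_symm_apply W⟩
      have : act g (H.symm W) = W := H.apply_symm_apply W
      rwa [this]
  have h := H.image_connectedComponentIn (hD.subset_periodCone hZ)
  rw [himg, ← hD.eq_component hZ, ← hD.eq_component (show H Z ∈ D from hgZ)] at h
  exact h

/-! ### Tube domains -/

/-- The projection of `L ⊗ R` onto `L_{c,b} ⊗ R = c^⊥ ∩ b^⊥` along the plane spanned by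
`c` and `b`, for `c` isotropic and `(c, b) = 1`. -/
def cuspProj {R : Type*} [CommRing R] [Algebra ℚ R] (S : Matrix ι ι ℤ) (c : ι → ℤ) (b : ι → ℚ)
    (z : ι → R) : ι → R :=
  z - form S z (vecCast R b) • vecCast R c - form S z (vecCast R c) • vecCast R b
    + (form S (vecCast R b) (vecCast R b) * form S z (vecCast R c)) • vecCast R c

section Proj

variable {R : Type*} [CommRing R] [Algebra ℚ R] {S : Matrix ι ι ℤ} (hS : S.IsSymm)
  {c : ι → ℤ} {b : ι → ℚ} (hcc : form S c c = 0) (hcb : form S (vecCast ℚ c) b = 1)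

include hcc in
lemma form_cusp_self (R : Type*) [CommRing R] : form S (vecCast R c) (vecCast R c) = 0 := by
  rw [form_vecCast, hcc, map_zero]

include hcb in
lemma form_cusp_right (R : Type*) [CommRing R] [Algebra ℚ R] :
    form S (vecCast R c) (vecCast R b) = 1 := by
  rw [form_vecCast_int_rat, hcb, map_one]

include hS hcb in
lemma form_cusp_left (R : Type*) [CommRing R] [Algebra ℚ R] :
    form S (vecCast R b) (vecCast R c) = 1 := by
  rw [form_comm hS, form_cusp_right hcb]

include hS hcc hcb in
lemma form_cuspProj_left (z : ι → R) : form S (cuspProj S c b z) (vecCast R c) = 0 := by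
  simp only [cuspProj, form_add_left, form_sub_left, form_smul_left, form_cusp_self hcc R,
    form_cusp_left hS hcb R]
  ring

include hS hcc hcb in
lemma form_cuspProj_right (z : ι → R) : form S (cuspProj S c b z) (vecCast R b) = 0 := by
  simp only [cuspProj, form_add_left, form_sub_left, form_smul_left, form_cusp_right hcb R]
  ring

lemma form_left_cuspProj {l : ι → R} (hc : form S l (vecCast R c) = 0)
    (hb : form S l (vecCast R b) = 0) (z : ι → R) : form S l (cuspProj S c b z) = form S l z := by
  simp only [cuspProj, form_add_right, form_sub_right, form_smul_right, hc, hb]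
  ring

lemma cuspProj_eq_self {z : ι → R} (hc : form S z (vecCast R c) = 0)
    (hb : form S z (vecCast R b) = 0) : cuspProj S c b z = z := by
  simp [cuspProj, hc, hb]

lemma cuspProj_add (z w : ι → R) :
    cuspProj S c b (z + w) = cuspProj S c b z + cuspProj S c b w := by
  simp only [cuspProj, form_add_left, add_smul, mul_add]
  abel

lemma cuspProj_smul (t : R) (z : ι → R) : cuspProj S c b (t • z) = t • cuspProj S c b z := by
  simp only [cuspProj, form_smul_left, smul_add, smul_sub, smul_smul]
  ring_nf

include hcc hcb in
lemma cuspProj_left : cuspProj S c b (vecCast R c) = 0 := by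
  simp [cuspProj, form_cusp_self hcc R, form_cusp_right hcb R]

include hS hcb in
lemma cuspProj_right : cuspProj S c b (vecCast R b) = 0 := by
  simp [cuspProj, form_cusp_left hS hcb R]

lemma cuspProj_vecCast {A : Type*} [CommRing A] [Algebra ℚ A] [Algebra A R]
    [IsScalarTower ℚ A R] (w : ι → A) :
    cuspProj S c b (vecCast R w) = vecCast R (cuspProj S c b w) := by
  have hb : (vecCast R b : ι → R) = vecCast R (vecCast A b) := (vecCast_vecCast b).symm
  have hc : (vecCast R c : ι → R) = vecCast R (vecCast A c) := by
    funext i; simp [vecCast]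
  rw [cuspProj, cuspProj, hb, hc]
  simp only [vecCast_add, vecCast_sub, vecCast_smul, form_vecCast, map_mul]

end Proj

section Tube

variable {S : Matrix ι ι ℤ} (hS : S.IsSymm) {c : ι → ℤ} {b : ι → ℚ} (hcc : form S c c = 0)
  (hcb : form S (vecCast ℚ c) b = 1)

include hS hcb in
lemma tubePoint_cuspProj {Z : ι → ℂ} (hZ : form S Z Z = 0) (hZc : form S Z (vecCast ℂ c) = 1)
    (hcc : form S c c = 0) : tubePoint S c b (cuspProj S c b Z) = Z := by
  have h : form S (cuspProj S c b Z) (cuspProj S c b Z) =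
      form S (vecCast ℂ b) (vecCast ℂ b) - 2 * form S Z (vecCast ℂ b) := by
    simp only [cuspProj, form_add_left, form_sub_left, form_smul_left, form_add_right,
      form_sub_right, form_smul_right, form_cusp_self hcc ℂ, form_cusp_left hS hcb ℂ,
      form_cusp_right hcb ℂ, hZ, hZc, form_comm hS _ Z]
    ring
  rw [tubePoint, h, cuspProj, hZc]
  funext i
  simp only [Pi.add_apply, Pi.sub_apply, Pi.smul_apply, smul_eq_mul]
  ring

include hS hcc hcb in
lemma form_tubePoint_cusp {z : ι → ℂ} (hz : form S z (vecCast ℂ c) = 0) :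
    form S (tubePoint S c b z) (vecCast ℂ c) = 1 := by
  simp [tubePoint, form_add_left, form_sub_left, form_smul_left, form_cusp_self hcc ℂ,
    form_cusp_left hS hcb ℂ, hz]

include hS hcc hcb in
lemma form_tubePoint_self {z : ι → ℂ} (hz : form S z (vecCast ℂ c) = 0)
    (hzb : form S z (vecCast ℂ b) = 0) :
    form S (tubePoint S c b z) (tubePoint S c b z) = 0 := by
  simp only [tubePoint, form_add_left, form_sub_left, form_smul_left, form_add_right,
      form_sub_right, form_smul_right, form_cusp_self hcc ℂ, form_cusp_left hS hcb ℂ,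
      form_cusp_right hcb ℂ, hz, hzb, form_comm hS _ z]
  ring

lemma form_left_tubePoint {l : ι → ℂ} (hl : form S l (vecCast ℂ c) = 0) (z : ι → ℂ) :
    form S l (tubePoint S c b z) = form S l z + form S l (vecCast ℂ b) := by
  simp only [tubePoint, form_add_right, form_sub_right, form_smul_right, hl]
  ring

include hS in
lemma form_star_of_isotropic {Z : ι → ℂ} (hZ : form S Z Z = 0) :
    (form S Z (star Z)).re = 2 * form S (imVec Z) (imVec Z) := by
  have h := form_self_eq hS Z
  rw [hZ] at h
  have h2 := congrArg Complex.re h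
  simp at h2
  rw [form_star_eq hS, Complex.ofReal_re]
  linarith

lemma form_im_of_form_int {z : ι → ℂ} (h : form S z (vecCast ℂ c) = 0) :
    form S (imVec z) (vecCast ℝ c) = 0 := by
  rw [← form_real_right_im, vecCast_vecCast, h, Complex.zero_im]

lemma form_im_of_form_rat {z : ι → ℂ} (h : form S z (vecCast ℂ b) = 0) :
    form S (imVec z) (vecCast ℝ b) = 0 := by
  rw [← form_real_right_im, vecCast_vecCast, h, Complex.zero_im]

lemma imVec_smul_int (s : ℂ) (c : ι → ℤ) : imVec (s • vecCast ℂ c) = s.im • vecCast ℝ c := by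
  funext i
  simp [imVec, vecCast]

lemma imVec_smul_rat (s : ℂ) (b : ι → ℚ) : imVec (s • vecCast ℂ b) = s.im • vecCast ℝ b := by
  funext i
  simp [imVec, vecCast]

lemma imVec_cuspProj (z : ι → ℂ) : imVec (cuspProj S c b z) = cuspProj S c b (imVec z) := by
  have h1 : (form S z (vecCast ℂ c)).im = form S (imVec z) (vecCast ℝ c) := by
    rw [← form_real_right_im, vecCast_vecCast]
  have h2 : (form S z (vecCast ℂ b)).im = form S (imVec z) (vecCast ℝ b) := by
    rw [← form_real_right_im, vecCast_vecCast]
  have h3 : form S (vecCast ℂ b) (vecCast ℂ b) =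
      ((form S (vecCast ℝ b) (vecCast ℝ b) : ℝ) : ℂ) := by
    rw [← vecCast_vecCast (B := ℝ) b, form_vecCast]; rfl
  simp only [cuspProj, imVec_add, imVec_sub, imVec_smul_int, imVec_smul_rat, h1, h2, h3,
    Complex.im_ofReal_mul]

include hS hcc in
lemma form_im_tubePoint {z : ι → ℂ} (hz : form S z (vecCast ℂ c) = 0) :
    form S (imVec (tubePoint S c b z)) (imVec (tubePoint S c b z)) =
      form S (imVec z) (imVec z) := by
  have h := form_im_of_form_int hz
  simp only [tubePoint, imVec_sub, imVec_add, imVec_vecCast_rat, imVec_smul_int, add_zero,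
    form_sub_left, form_sub_right, form_smul_left, form_smul_right, form_comm hS (vecCast ℝ c),
    form_cusp_self hcc ℝ, h]
  ring

include hS hcc hcb in
lemma tubePoint_mem_periodCone_iff {z : ι → ℂ} (hz : form S z (vecCast ℂ c) = 0)
    (hzb : form S z (vecCast ℂ b) = 0) :
    tubePoint S c b z ∈ periodCone S ↔ 0 < form S (imVec z) (imVec z) := by
  have h := form_tubePoint_self hS hcc hcb hz hzb
  simp only [periodCone, Set.mem_ofPred_eq, h, true_and, form_star_of_isotropic hS h,
    form_im_tubePoint hS hcc hz]
  exact ⟨fun h => by linarith, fun h => by linarith⟩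

lemma continuous_tubePoint : Continuous (tubePoint S c b) := by
  have h1 := continuous_form S (continuous_id (X := ι → ℂ)) continuous_id
  simp only [id] at h1
  unfold tubePoint
  fun_prop

/-! ### The positive cone -/

include hS hcc hcb in
/-- `L_{c,b} ⊗ ℝ` is hyperbolic: the orthogonal complement of a vector of positive square is
negative definite. The second positive square of `L ⊗ ℝ` is found in the plane of `c`, `b`. -/
lemma eq_zero_of_orthogonal (hT : AtMostTwoPositive S) {x y : ι → ℝ}
    (hxc : form S x (vecCast ℝ c) = 0) (hxb : form S x (vecCast ℝ b) = 0)
    (hyc : form S y (vecCast ℝ c) = 0) (hyb : form S y (vecCast ℝ b) = 0)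
    (hx : 0 < form S x x) (hxy : form S x y = 0) (hy : 0 ≤ form S y y) : y = 0 := by
  refine hT x (vecCast ℝ b + ((1 - form S (vecCast ℝ b) (vecCast ℝ b)) / 2) • vecCast ℝ c) y
    ?_ hxy ?_ hx ?_ hy
  · simp [form_add_right, form_smul_right, hxc, hxb]
  · simp [form_comm hS _ y, form_add_right, form_smul_right, hyc, hyb]
  · simp only [form_add_left, form_add_right, form_smul_left, form_smul_right,
      form_cusp_self hcc ℝ, form_cusp_left hS hcb ℝ, form_cusp_right hcb ℝ]
    ring_nf
    norm_num

include hS hcc hcb in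
/-- Two vectors in the same half of the light cone have positive product. -/
lemma form_pos_of_same_half (hT : AtMostTwoPositive S) {y₀ x y : ι → ℝ}
    (h0c : form S y₀ (vecCast ℝ c) = 0) (h0b : form S y₀ (vecCast ℝ b) = 0)
    (hxc : form S x (vecCast ℝ c) = 0) (hxb : form S x (vecCast ℝ b) = 0)
    (hyc : form S y (vecCast ℝ c) = 0) (hyb : form S y (vecCast ℝ b) = 0)
    (h0 : 0 < form S y₀ y₀) (hx : 0 < form S x x) (hy : 0 ≤ form S y y)
    (hx0 : 0 < form S x y₀) (hy0 : 0 < form S y y₀) : 0 < form S x y := by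
  by_contra hcon
  push Not at hcon
  set s := form S y y₀ / form S x y₀ with hs
  have hspos : 0 < s := div_pos hy0 hx0
  have key : y - s • x = 0 := by
    refine eq_zero_of_orthogonal hS hcc hcb hT h0c h0b ?_ ?_ h0 ?_ ?_
    · simp [form_sub_left, form_smul_left, hxc, hyc]
    · simp [form_sub_left, form_smul_left, hxb, hyb]
    · rw [form_comm hS, form_sub_left, form_smul_left, hs, div_mul_cancel₀ _ hx0.ne', sub_self]
    · simp only [form_sub_left, form_sub_right, form_smul_left, form_smul_right, form_comm hS y x]
      nlinarith [mul_nonneg hspos.le (neg_nonneg.2 hcon), mul_pos hspos (mul_pos hspos hx)]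
  rw [sub_eq_zero.1 key, form_smul_right] at hcon
  nlinarith [mul_pos hspos hx]

include hcb in
lemma cusp_ne_zero : (vecCast ℝ c : ι → ℝ) ≠ 0 := by
  intro h
  have := form_cusp_right hcb ℝ
  rw [h, form_zero_left] at this
  exact zero_ne_one this

include hS hcc hcb in
/-- A vector of the period cone spans a positive definite real plane, to which an isotropic
vector is not orthogonal. -/
lemma form_cusp_ne_zero (hT : AtMostTwoPositive S) {Z : ι → ℂ} (hZ : Z ∈ periodCone S) :
    form S Z (vecCast ℂ c) ≠ 0 := by
  intro h
  have h1 : form S (imVec Z) (vecCast ℝ c) = 0 := form_im_of_form_int h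
  have h2 : form S (reVec Z) (vecCast ℝ c) = 0 := by
    rw [← form_real_right_re, vecCast_vecCast, h, Complex.zero_re]
  have h3 := form_self_eq hS Z
  rw [hZ.1] at h3
  have h4 := congrArg Complex.re h3
  have h5 := congrArg Complex.im h3
  simp at h4 h5
  have h6 := hZ.2
  rw [form_star_eq hS, Complex.ofReal_re] at h6
  exact cusp_ne_zero hcb (hT (reVec Z) (imVec Z) _ (by linarith) h2 h1 (by linarith) (by linarith)
    (by rw [form_cusp_self hcc ℝ]))

include hS hcc hcb in
/-- The tube domain at a cusp is `L_{c,b} ⊗ ℝ + i C⁺`, where `C⁺` is the half of the light cone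
that contains some vector `y₀`. -/
lemma exists_mem_tubeDomain_iff (hT : AtMostTwoPositive S) {D : Set (ι → ℂ)}
    (hD : IsAffineCone S D) : ∃ y₀ : ι → ℝ, form S y₀ (vecCast ℝ c) = 0 ∧
      form S y₀ (vecCast ℝ b) = 0 ∧ 0 < form S y₀ y₀ ∧
      ∀ z : ι → ℂ, z ∈ tubeDomain S D c b ↔ form S z (vecCast ℂ c) = 0 ∧
        form S z (vecCast ℂ b) = 0 ∧ 0 < form S (imVec z) (imVec z) ∧
        0 < form S (imVec z) y₀ := by
  obtain ⟨Z₁, hZ₁⟩ := hD.nonempty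
  have hne₁ := form_cusp_ne_zero hS hcc hcb hT (hD.subset_periodCone hZ₁)
  set Z₀ := (form S Z₁ (vecCast ℂ c))⁻¹ • Z₁ with hZ₀
  have hmem₀ : Z₀ ∈ D := hD.smul_mem (inv_ne_zero hne₁) hZ₁
  have hc₀ : form S Z₀ (vecCast ℂ c) = 1 := by
    rw [hZ₀, form_smul_left, inv_mul_cancel₀ hne₁]
  set z₀ := cuspProj S c b Z₀ with hz₀
  have ht₀ : tubePoint S c b z₀ = Z₀ :=
    tubePoint_cuspProj hS hcb (hD.subset_periodCone hmem₀).1 hc₀ hcc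
  have hzc : form S z₀ (vecCast ℂ c) = 0 := form_cuspProj_left hS hcc hcb Z₀
  have hzb : form S z₀ (vecCast ℂ b) = 0 := form_cuspProj_right hS hcc hcb Z₀
  have hyc := form_im_of_form_int hzc
  have hyb := form_im_of_form_rat hzb
  have hypos : 0 < form S (imVec z₀) (imVec z₀) :=
    (tubePoint_mem_periodCone_iff hS hcc hcb hzc hzb).1 (ht₀ ▸ hD.subset_periodCone hmem₀)
  refine ⟨imVec z₀, hyc, hyb, hypos, fun z => ⟨?_, ?_⟩⟩
  · rintro ⟨hc, hb, hz⟩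
    have hz' := (tubePoint_mem_periodCone_iff hS hcc hcb hc hb).1 (hD.subset_periodCone hz)
    refine ⟨hc, hb, hz', ?_⟩
    -- the product with `y₀` does not vanish on the connected set `D`
    set h : (ι → ℂ) → ℝ := fun Z =>
      form S (imVec ((form S Z (vecCast ℂ c))⁻¹ • Z)) (imVec z₀) with hh
    have hcont : ContinuousOn h D := by
      have h1 : ContinuousOn (fun Z : ι → ℂ => (form S Z (vecCast ℂ c))⁻¹ • Z) D :=
        ((continuous_form S continuous_id continuous_const).continuousOn.inv₀ fun Z hZ =>
          form_cusp_ne_zero hS hcc hcb hT (hD.subset_periodCone hZ)).smul continuousOn_id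
      have h2 : Continuous fun y : ι → ℝ => form S y (imVec z₀) :=
        continuous_form S continuous_id continuous_const
      exact (h2.comp continuous_imVec).comp_continuousOn h1
    have hpoint : ∀ w : ι → ℂ, form S w (vecCast ℂ c) = 0 →
        h (tubePoint S c b w) = form S (imVec w) (imVec z₀) := by
      intro w hw
      simp only [hh, form_tubePoint_cusp hS hcc hcb hw, inv_one, one_smul]
      simp only [tubePoint, imVec_sub, imVec_add, imVec_vecCast_rat, imVec_smul_int, add_zero,
        form_sub_left, form_smul_left, form_comm hS (vecCast ℝ c), hyc]
      ring
    have hnz : ∀ Z ∈ D, h Z ≠ 0 := by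
      intro Z hZ h0
      have hne := form_cusp_ne_zero hS hcc hcb hT (hD.subset_periodCone hZ)
      have hmem := hD.subset_periodCone (hD.smul_mem (inv_ne_zero hne) hZ)
      set W := (form S Z (vecCast ℂ c))⁻¹ • Z with hW
      have hWc : form S W (vecCast ℂ c) = 1 := by rw [hW, form_smul_left, inv_mul_cancel₀ hne]
      have hWt := tubePoint_cuspProj hS hcb hmem.1 hWc hcc
      have hwc := form_cuspProj_left hS hcc hcb W
      have hwb := form_cuspProj_right hS hcc hcb W
      have hw0 : h W = 0 := by
        rw [← h0]
        simp only [hh]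
        rw [hWc, inv_one, one_smul]
      have hwpos := (tubePoint_mem_periodCone_iff hS hcc hcb hwc hwb).1 (by rwa [hWt])
      rw [← hWt, hpoint _ hwc] at hw0
      have := eq_zero_of_orthogonal hS hcc hcb hT hyc hyb (form_im_of_form_int hwc)
        (form_im_of_form_rat hwb) hypos (by rw [form_comm hS, hw0]) hwpos.le
      rw [this, form_zero_left] at hwpos
      exact lt_irrefl _ hwpos
    rw [← hpoint z hc]
    by_contra hneg
    push Not at hneg
    have hpos0 : 0 ≤ h Z₀ := by rw [← ht₀, hpoint _ hzc]; exact hypos.le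
    obtain ⟨Z, hZ, hZ0⟩ := hD.isPreconnected.intermediate_value hz hmem₀ hcont ⟨hneg, hpos0⟩
    exact hnz Z hZ hZ0
  · rintro ⟨hc, hb, hz, hz0⟩
    refine ⟨hc, hb, ?_⟩
    -- the segment from `z₀` to `z` stays in the tube
    let γ : ℝ → ι → ℂ := fun t => tubePoint S c b (((1 - t : ℝ) : ℂ) • z₀ + (t : ℂ) • z)
    have hγ : Continuous γ := continuous_tubePoint.comp (by fun_prop)
    refine hD.subset_of_isPreconnected (A := γ '' Set.Icc 0 1)
      (isPreconnected_Icc.image _ hγ.continuousOn) ?_ ⟨0, by simp, by simp [γ, ht₀]⟩ hmem₀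
      ⟨1, by simp, by simp [γ]⟩
    rintro _ ⟨t, ⟨ht0, ht1⟩, rfl⟩
    refine (tubePoint_mem_periodCone_iff hS hcc hcb ?_ ?_).2 ?_
    · rw [form_add_left, form_smul_left, form_smul_left, hzc, hc, mul_zero, mul_zero, add_zero]
    · rw [form_add_left, form_smul_left, form_smul_left, hzb, hb, mul_zero, mul_zero, add_zero]
    · rw [imVec_add, imVec_real_smul, imVec_real_smul]
      simp only [form_add_left, form_add_right, form_smul_left, form_smul_right,
        form_comm hS (imVec z₀) (imVec z)]
      rcases ht0.eq_or_lt with rfl | ht0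
      · simpa using hypos
      · have e1 : 0 ≤ (1 - t) * ((1 - t) * form S (imVec z₀) (imVec z₀)) :=
          mul_nonneg (by linarith) (mul_nonneg (by linarith) hypos.le)
        have e2 : 0 ≤ (1 - t) * (t * form S (imVec z) (imVec z₀)) :=
          mul_nonneg (by linarith) (mul_nonneg ht0.le hz0.le)
        have e3 : 0 < t * (t * form S (imVec z) (imVec z)) := mul_pos ht0 (mul_pos ht0 hz)
        nlinarith

end Tube

/-! ### Fourier expansion of periodic holomorphic functions on a tube -/

section Fourier

open MeasureTheory

/-- The class of a real vector in the torus `ℝ^ι / ℤ^ι`. -/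
def toTorus (x : ι → ℝ) : UnitAddTorus ι := fun i => (x i : UnitAddCircle)

/-- The representative in `[0, 1)^ι` of a point of the torus. -/
def torusRep (t : UnitAddTorus ι) : ι → ℝ := fun i => (AddCircle.equivIco 1 0 (t i) : ℝ)

/-- The Haar probability measure of the torus. -/
def torusMeasure (ι : Type*) [Fintype ι] : Measure (UnitAddTorus ι) :=
  Measure.pi fun _ => AddCircle.haarAddCircle

instance : IsProbabilityMeasure (torusMeasure ι) := by
  unfold torusMeasure; infer_instance

instance : Measure.IsAddLeftInvariant (torusMeasure ι) := by
  unfold torusMeasure; infer_instance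

lemma toTorus_torusRep (t : UnitAddTorus ι) : toTorus (torusRep t) = t :=
  funext fun _ => AddCircle.coe_equivIco

lemma toTorus_add (x y : ι → ℝ) : toTorus (x + y) = toTorus x + toTorus y := rfl

lemma torusRep_mem (t : UnitAddTorus ι) : torusRep t ∈ Set.Icc (0 : ι → ℝ) 1 := by
  refine ⟨fun i => (AddCircle.equivIco 1 0 (t i)).2.1, fun i => ?_⟩
  have := (AddCircle.equivIco (1 : ℝ) 0 (t i)).2.2
  simp only [zero_add] at this
  exact this.le

lemma exists_torusRep_eq (x : ι → ℝ) : ∃ v : ι → ℤ, torusRep (toTorus x) = x + vecCast ℝ v := by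
  have h : ∀ i, ∃ k : ℤ, torusRep (toTorus x) i = x i + k := by
    intro i
    have h1 : ((torusRep (toTorus x) i : ℝ) : UnitAddCircle) = (x i : UnitAddCircle) :=
      congrFun (toTorus_torusRep (toTorus x)) i
    rw [← sub_eq_zero, ← AddCircle.coe_sub, AddCircle.coe_eq_zero_iff] at h1
    obtain ⟨k, hk⟩ := h1
    exact ⟨k, by simp at hk; linarith⟩
  choose v hv using h
  exact ⟨v, funext hv⟩

/-- A function on `ℝ^ι` invariant under `ℤ^ι`, evaluated at representatives, is the function on
the torus that it induces. -/
lemma apply_torusRep_toTorus {H : (ι → ℝ) → ℂ} (hH : ∀ x (v : ι → ℤ), H (x + vecCast ℝ v) = H x)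
    (x : ι → ℝ) : H (torusRep (toTorus x)) = H x := by
  obtain ⟨v, hv⟩ := exists_torusRep_eq x
  rw [hv, hH]

lemma continuous_apply_torusRep {H : (ι → ℝ) → ℂ}
    (hH : ∀ x (v : ι → ℤ), H (x + vecCast ℝ v) = H x) (hc : Continuous H) :
    Continuous fun t => H (torusRep t) := by
  have hq : IsOpenQuotientMap (toTorus : (ι → ℝ) → UnitAddTorus ι) :=
    IsOpenQuotientMap.piMap fun _ => QuotientAddGroup.isOpenQuotientMap_mk
  refine hq.isQuotientMap.continuous_iff.2 ?_
  have : (fun t => H (torusRep t)) ∘ toTorus = H := funext fun x => apply_torusRep_toTorus hH x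
  rwa [this]

lemma integral_torus_translate {H : (ι → ℝ) → ℂ}
    (hH : ∀ x (v : ι → ℤ), H (x + vecCast ℝ v) = H x) (s : ι → ℝ) :
    ∫ t, H (torusRep t + s) ∂torusMeasure ι = ∫ t, H (torusRep t) ∂torusMeasure ι := by
  rw [← integral_add_left_eq_self (fun t => H (torusRep t)) (toTorus s)]
  refine integral_congr_ae (ae_of_all _ fun t => ?_)
  dsimp only
  rw [add_comm (toTorus s) t]
  conv_rhs => rw [← toTorus_torusRep t, ← toTorus_add, apply_torusRep_toTorus hH]

/-- The tube over a subset of `ℝ^ι`. -/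
def tube (C : Set (ι → ℝ)) : Set (ι → ℂ) := {z | imVec z ∈ C}

lemma imVec_re_add_im (x y : ι → ℝ) :
    imVec (vecCast ℂ x + Complex.I • vecCast ℂ y) = y := by
  rw [imVec_add, imVec_vecCast, imVec_I_smul, zero_add]

lemma isOpen_tube {C : Set (ι → ℝ)} (hC : IsOpen C) : IsOpen (tube C) :=
  hC.preimage continuous_imVec

lemma vecCast_int_real (v : ι → ℤ) : vecCast ℂ (vecCast ℝ v) = vecCast ℂ v := vecCast_vecCast v

lemma continuous_vecCast_real : Continuous (vecCast ℂ : (ι → ℝ) → ι → ℂ) := by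
  unfold vecCast
  simp only [Complex.coe_algebraMap]
  fun_prop

variable {C : Set (ι → ℝ)} {Φ : (ι → ℂ) → ℂ}

lemma periodic_slice (hper : ∀ z ∈ tube C, ∀ v : ι → ℤ, Φ (z + vecCast ℂ v) = Φ z)
    {w : ι → ℂ} (hw : w ∈ tube C) (x : ι → ℝ) (v : ι → ℤ) :
    Φ (vecCast ℂ (x + vecCast ℝ v) + w) = Φ (vecCast ℂ x + w) := by
  rw [vecCast_add, vecCast_int_real, add_right_comm]
  refine hper _ ?_ v
  change imVec _ ∈ C
  rwa [imVec_add, imVec_vecCast, zero_add]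

lemma continuous_slice (hΦ : ContinuousOn Φ (tube C)) {w : ι → ℂ} (hw : w ∈ tube C) :
    Continuous fun x : ι → ℝ => Φ (vecCast ℂ x + w) := by
  refine hΦ.comp_continuous (continuous_vecCast_real.add continuous_const) fun x => ?_
  change imVec _ ∈ C
  rwa [imVec_add, imVec_vecCast, zero_add]

/-- A periodic continuous function on a tube is bounded over compact sets of imaginary parts. -/
lemma exists_bound_of_periodic (hΦ : ContinuousOn Φ (tube C))
    (hper : ∀ z ∈ tube C, ∀ v : ι → ℤ, Φ (z + vecCast ℂ v) = Φ z) {K : Set (ι → ℝ)}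
    (hK : IsCompact K) (hKC : K ⊆ C) :
    ∃ M : ℝ, ∀ x : ι → ℝ, ∀ y ∈ K, ‖Φ (vecCast ℂ x + Complex.I • vecCast ℂ y)‖ ≤ M := by
  let j : (ι → ℝ) × (ι → ℝ) → ι → ℂ := fun p => vecCast ℂ p.1 + Complex.I • vecCast ℂ p.2
  have hj : Continuous j := by
    have hv := continuous_vecCast_real (ι := ι)
    fun_prop
  have hcomp : IsCompact (j '' (Set.Icc (0 : ι → ℝ) 1 ×ˢ K)) := (isCompact_Icc.prod hK).image hj
  have hsub : j '' (Set.Icc (0 : ι → ℝ) 1 ×ˢ K) ⊆ tube C := by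
    rintro _ ⟨p, hp, rfl⟩
    change imVec _ ∈ C
    rw [imVec_re_add_im]
    exact hKC hp.2
  obtain ⟨M, hM⟩ := hcomp.exists_bound_of_continuousOn (hΦ.mono hsub)
  refine ⟨M, fun x y hy => ?_⟩
  have hw : Complex.I • vecCast ℂ y ∈ tube C := by
    change imVec _ ∈ C
    rw [imVec_I_smul]
    exact hKC hy
  rw [← apply_torusRep_toTorus
    (H := fun x => Φ (vecCast ℂ x + Complex.I • vecCast ℂ y)) (periodic_slice hper hw) x]
  exact hM _ ⟨(torusRep (toTorus x), y), ⟨torusRep_mem (toTorus x), hy⟩, rfl⟩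

/-- The mean of a periodic holomorphic function over the real torus does not depend on the
imaginary part: along a segment of imaginary parts it extends to a holomorphic function of one
variable which is invariant under real translations. -/
lemma integral_torus_eq (hC : IsOpen C) (hconv : Convex ℝ C) (hΦ : DifferentiableOn ℂ Φ (tube C))
    (hper : ∀ z ∈ tube C, ∀ v : ι → ℤ, Φ (z + vecCast ℂ v) = Φ z) {y₁ y₂ : ι → ℝ}
    (h₁ : y₁ ∈ C) (h₂ : y₂ ∈ C) :
    ∫ t, Φ (vecCast ℂ (torusRep t) + Complex.I • vecCast ℂ y₁) ∂torusMeasure ι =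
      ∫ t, Φ (vecCast ℂ (torusRep t) + Complex.I • vecCast ℂ y₂) ∂torusMeasure ι := by
  set u := y₂ - y₁ with hu
  let L : ℂ → ι → ℂ := fun τ => Complex.I • (vecCast ℂ y₁ + τ • vecCast ℂ u)
  have hL : Differentiable ℂ L := by fun_prop
  have hLdecomp : ∀ τ, L τ = vecCast ℂ (-τ.im • u) + Complex.I • vecCast ℂ (y₁ + τ.re • u) := by
    intro τ
    funext i
    simp only [L, vecCast, Pi.smul_apply, Pi.add_apply, smul_eq_mul, Complex.coe_algebraMap]
    apply Complex.ext <;> simp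
  have hLim : ∀ τ, imVec (L τ) = y₁ + τ.re • u := fun τ => by rw [hLdecomp, imVec_re_add_im]
  let T : Set ℂ := {τ | y₁ + τ.re • u ∈ C}
  have hTo : IsOpen T := hC.preimage (by fun_prop)
  have hTmem : ∀ {τ}, τ ∈ T → L τ ∈ tube C := fun {τ} hτ => by
    change imVec _ ∈ C
    rw [hLim]
    exact hτ
  have hTc : Convex ℝ T := by
    intro a ha b hb p q hp hq hpq
    have := hconv ha hb hp hq hpq
    change y₁ + (p • a + q • b).re • u ∈ C
    convert this using 1
    funext i
    simp only [Complex.add_re, Complex.real_smul, Complex.re_ofReal_mul, Pi.add_apply,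
      Pi.smul_apply, smul_eq_mul]
    linear_combination (-y₁ i) * hpq
  let φ : ℂ → ℂ := fun τ => ∫ t, Φ (vecCast ℂ (torusRep t) + L τ) ∂torusMeasure ι
  have hshift : ∀ τ ∈ T, ∀ s : ℝ, φ (τ + s * Complex.I) = φ τ := by
    intro τ hτ s
    simp only [φ]
    rw [← integral_torus_translate (H := fun x => Φ (vecCast ℂ x + L τ))
      (periodic_slice hper (hTmem hτ)) (-s • u)]
    refine integral_congr_ae (ae_of_all _ fun t => ?_)
    dsimp only
    congr 1
    rw [vecCast_add, add_assoc]
    congr 1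
    funext i
    simp only [L, vecCast, Pi.smul_apply, Pi.add_apply, smul_eq_mul, Complex.coe_algebraMap]
    push_cast
    linear_combination (s : ℂ) * (u i : ℂ) * Complex.I_sq
  have hcurve : ∀ t : UnitAddTorus ι, ∀ τ ∈ T, DifferentiableAt ℂ
      (fun τ => Φ (vecCast ℂ (torusRep t) + L τ)) τ := by
    intro t τ hτ
    have hmem : vecCast ℂ (torusRep t) + L τ ∈ tube C := by
      change imVec _ ∈ C
      rw [imVec_add, imVec_vecCast, zero_add, hLim]
      exact hτ
    exact (hΦ.differentiableAt ((isOpen_tube hC).mem_nhds hmem)).comp τ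
      ((hL τ).const_add _)
  have hcont : ∀ τ ∈ T, Continuous fun t => Φ (vecCast ℂ (torusRep t) + L τ) := fun τ hτ =>
    continuous_apply_torusRep (H := fun x => Φ (vecCast ℂ x + L τ)) (periodic_slice hper (hTmem hτ))
      (continuous_slice hΦ.continuousOn (hTmem hτ))
  have hderiv : ∀ τ₀ ∈ T, ∃ d, HasDerivAt φ d τ₀ := by
    intro τ₀ hτ₀
    obtain ⟨ε, hε, hball⟩ := Metric.nhds_basis_closedBall.mem_iff.1 (hTo.mem_nhds hτ₀)
    obtain ⟨M, hM⟩ := exists_bound_of_periodic hΦ.continuousOn hper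
      (K := (fun τ : ℂ => y₁ + τ.re • u) '' Metric.closedBall τ₀ ε)
      ((isCompact_closedBall τ₀ ε).image (by fun_prop))
      (by rintro _ ⟨τ, hτ, rfl⟩; exact hball hτ)
    have hbound : ∀ t : UnitAddTorus ι, ∀ τ ∈ Metric.closedBall τ₀ ε,
        ‖Φ (vecCast ℂ (torusRep t) + L τ)‖ ≤ M := by
      intro t τ hτ
      rw [hLdecomp, ← add_assoc, ← vecCast_add]
      exact hM _ _ ⟨τ, hτ, rfl⟩
    have hsub : ∀ τ ∈ Metric.ball τ₀ (ε / 2),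
        Metric.closedBall τ (ε / 2) ⊆ Metric.closedBall τ₀ ε := fun τ hτ =>
      Metric.closedBall_subset_closedBall' (by
        have := Metric.mem_ball.1 hτ
        linarith)
    have hτball : ∀ τ ∈ Metric.ball τ₀ (ε / 2), τ ∈ T := fun τ hτ =>
      hball (hsub τ hτ (Metric.mem_closedBall_self (by positivity)))
    refine ⟨_, (hasDerivAt_integral_of_dominated_loc_of_deriv_le (μ := torusMeasure ι)
      (F := fun τ t => Φ (vecCast ℂ (torusRep t) + L τ))
      (F' := fun τ t => deriv (fun τ => Φ (vecCast ℂ (torusRep t) + L τ)) τ)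
      (bound := fun _ => M / (ε / 2))
      (Metric.ball_mem_nhds τ₀ (half_pos hε)) ?_ ?_ ?_ ?_ (integrable_const _) ?_).2⟩
    · filter_upwards [hTo.mem_nhds hτ₀] with τ hτ
      exact (hcont τ hτ).aestronglyMeasurable
    · exact .of_bound (hcont τ₀ hτ₀).aestronglyMeasurable M
        (ae_of_all _ fun t => hbound t τ₀ (Metric.mem_closedBall_self hε.le))
    · -- the derivative is a limit of difference quotients
      have hseq : Tendsto (fun k : ℕ => ((ε / 2 / (k + 1) : ℝ) : ℂ)) atTop (𝓝[≠] 0) := by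
        refine tendsto_nhdsWithin_iff.2 ⟨?_, .of_forall fun k => ?_⟩
        · have h : Tendsto (fun k : ℕ => ε / 2 / ((k : ℝ) + 1)) atTop (𝓝 0) := by
            simpa [div_eq_mul_inv] using
              (tendsto_one_div_add_atTop_nhds_zero_nat (𝕜 := ℝ)).const_mul (ε / 2)
          have h2 := (Complex.continuous_ofReal.tendsto 0).comp h
          rwa [Complex.ofReal_zero] at h2
        · have : (0 : ℝ) < ε / 2 / (k + 1) := by positivity
          exact Complex.ofReal_ne_zero.2 this.ne'
      refine aestronglyMeasurable_of_tendsto_ae atTop (f := fun (k : ℕ) t =>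
        ((ε / 2 / (k + 1) : ℝ) : ℂ)⁻¹ • (Φ (vecCast ℂ (torusRep t)
          + L (τ₀ + ((ε / 2 / (k + 1) : ℝ) : ℂ))) - Φ (vecCast ℂ (torusRep t) + L τ₀)))
        (fun k => ?_) (ae_of_all _ fun t => ?_)
      · have hmem : τ₀ + ((ε / 2 / (k + 1) : ℝ) : ℂ) ∈ T := by
          apply hball
          rw [Metric.mem_closedBall, dist_self_add_left, Complex.norm_real, Real.norm_eq_abs,
            abs_of_pos (by positivity)]
          calc ε / 2 / (k + 1) ≤ ε / 2 := div_le_self (by positivity) (by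
                have : (0 : ℝ) ≤ k := k.cast_nonneg
                linarith)
            _ ≤ ε := by linarith
        have h1 := hcont _ hmem
        have h2 := hcont _ hτ₀
        have h3 := (h1.sub h2).const_smul ((ε / 2 / (k + 1) : ℝ) : ℂ)⁻¹
        exact h3.aestronglyMeasurable
      · exact (hcurve t τ₀ hτ₀).hasDerivAt.tendsto_slope_zero.comp hseq
    · refine ae_of_all _ fun t τ hτ => ?_
      refine Complex.norm_deriv_le_of_forall_mem_sphere_norm_le (half_pos hε) ?_ ?_
      · have hd : DifferentiableOn ℂ (fun τ => Φ (vecCast ℂ (torusRep t) + L τ))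
            (Metric.closedBall τ (ε / 2)) := fun σ hσ =>
          (hcurve t σ (hball (hsub τ hτ hσ))).differentiableWithinAt
        exact hd.diffContOnCl_ball subset_rfl
      · exact fun σ hσ => hbound t σ (hsub τ hτ (Metric.sphere_subset_closedBall hσ))
    · exact ae_of_all _ fun t τ hτ => (hcurve t τ (hτball τ hτ)).hasDerivAt
  have hderiv0 : ∀ τ ∈ T, HasDerivAt φ 0 τ := by
    intro τ hτ
    obtain ⟨d, hd⟩ := hderiv τ hτ
    have h1 : HasDerivAt (fun s : ℝ => φ (τ + s * Complex.I)) (d * Complex.I) 0 := by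
      have h2 : HasDerivAt (fun s : ℝ => τ + (s : ℂ) * Complex.I) Complex.I 0 := by
        simpa using ((hasDerivAt_id (0 : ℝ)).ofReal_comp.mul_const Complex.I).const_add τ
      have hd' : HasDerivAt φ d (τ + ((0 : ℝ) : ℂ) * Complex.I) := by simpa using hd
      exact hd'.comp (0 : ℝ) h2
    have h3 : HasDerivAt (fun s : ℝ => φ (τ + s * Complex.I)) 0 0 := by
      simp only [hshift τ hτ]
      exact hasDerivAt_const _ _
    have h4 : d = 0 := by simpa using h1.unique h3
    rwa [h4] at hd
  have hconst := hTo.is_const_of_deriv_eq_zero (f := φ) hTc.isPreconnected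
    (fun τ hτ => (hderiv0 τ hτ).differentiableAt.differentiableWithinAt)
    (fun τ hτ => (hderiv0 τ hτ).deriv)
    (show (0 : ℂ) ∈ T by simpa [T] using h₁) (show (1 : ℂ) ∈ T by simpa [T, hu] using h₂)
  have e0 : L 0 = Complex.I • vecCast ℂ y₁ := by simp [L]
  have e1 : L 1 = Complex.I • vecCast ℂ y₂ := by
    rw [hLdecomp]; simp [hu, vecCast_zero]
  simpa only [φ, e0, e1] using hconst

end Fourier

section Fourier

open MeasureTheory

/-- The character `z ↦ exp (2 π i n · z)`. -/
def expChar (n : ι → ℤ) (z : ι → ℂ) : ℂ :=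
  Complex.exp (2 * Real.pi * Complex.I * (vecCast ℂ n ⬝ᵥ z))

lemma expChar_add (n : ι → ℤ) (z w : ι → ℂ) :
    expChar n (z + w) = expChar n z * expChar n w := by
  rw [expChar, expChar, expChar, dotProduct_add, mul_add, Complex.exp_add]

lemma expChar_int (n v : ι → ℤ) : expChar n (vecCast ℂ v) = 1 := by
  have : (vecCast ℂ n ⬝ᵥ vecCast ℂ v : ℂ) = ((n ⬝ᵥ v : ℤ) : ℂ) := by
    simp [dotProduct, vecCast]
  rw [expChar, this, Complex.exp_eq_one_iff]
  exact ⟨n ⬝ᵥ v, by ring⟩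

lemma norm_expChar (n : ι → ℤ) (z : ι → ℂ) :
    ‖expChar n z‖ = Real.exp (-(2 * Real.pi * (vecCast ℝ n ⬝ᵥ imVec z))) := by
  rw [expChar, Complex.norm_exp]
  congr 1
  have h : (vecCast ℂ n ⬝ᵥ z : ℂ).im = vecCast ℝ n ⬝ᵥ imVec z := by
    simp [dotProduct, vecCast, imVec]
  rw [← h]
  simp

lemma differentiable_expChar (n : ι → ℤ) : Differentiable ℂ (expChar n) := by
  unfold expChar dotProduct
  fun_prop

lemma mFourier_toTorus (n : ι → ℤ) (x : ι → ℝ) :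
    UnitAddTorus.mFourier n (toTorus x) = expChar n (vecCast ℂ x) := by
  simp only [UnitAddTorus.mFourier, ContinuousMap.coe_mk, toTorus, expChar, dotProduct,
    Finset.mul_sum, Complex.exp_sum]
  refine Finset.prod_congr rfl fun i _ => ?_
  rw [fourier_coe_apply]
  congr 1
  simp [vecCast]
  ring

lemma summable_exp_neg_abs {δ : ℝ} (hδ : 0 < δ) :
    Summable fun k : ℤ => Real.exp (-(δ * |(k : ℝ)|)) := by
  have h : Summable fun k : ℕ => Real.exp (k * (-δ)) :=
    Real.summable_exp_nat_mul_iff.2 (by linarith)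
  refine Summable.of_nat_of_neg (h.congr fun k => ?_) (h.congr fun k => ?_)
  · congr 1
    simp [mul_comm]
  · congr 1
    simp [mul_comm]

/-- A product of summable functions of single variables is summable. -/
lemma summable_pi_prod {f : ℤ → ℝ} (hf0 : ∀ k, 0 ≤ f k) (hf : Summable f) :
    Summable fun n : ι → ℤ => ∏ i, f (n i) := by
  classical
  refine summable_of_sum_le (c := ∏ _i : ι, ∑' k, f k)
    (fun n => Finset.prod_nonneg fun i _ => hf0 _) fun s => ?_
  calc ∑ n ∈ s, ∏ i, f (n i)
      ≤ ∑ n ∈ Fintype.piFinset fun i => s.image fun n => n i, ∏ i, f (n i) := by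
        refine Finset.sum_le_sum_of_subset_of_nonneg (fun n hn => ?_)
          fun n _ _ => Finset.prod_nonneg fun i _ => hf0 _
        exact Fintype.mem_piFinset.2 fun i => Finset.mem_image_of_mem _ hn
    _ = ∏ i, ∑ k ∈ s.image fun n => n i, f k := (Finset.prod_univ_sum _ _).symm
    _ ≤ ∏ _i : ι, ∑' k, f k := Finset.prod_le_prod
        (fun i _ => Finset.sum_nonneg fun k _ => hf0 k)
        fun i _ => hf.sum_le_tsum _ fun k _ => hf0 k

variable {C : Set (ι → ℝ)} {Φ : (ι → ℂ) → ℂ}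

/-- Fourier expansion on a tube: a holomorphic function on the tube over an open convex set which
is invariant under integral translations has an absolutely convergent expansion, and its
coefficients satisfy Cauchy's estimates. -/
theorem exists_fourier_expansion (hC : IsOpen C) (hconv : Convex ℝ C) (hne : C.Nonempty)
    (hΦ : DifferentiableOn ℂ Φ (tube C))
    (hper : ∀ z ∈ tube C, ∀ v : ι → ℤ, Φ (z + vecCast ℂ v) = Φ z) :
    ∃ a : (ι → ℤ) → ℂ, (∀ z ∈ tube C, HasSum (fun n => a n * expChar n z) (Φ z)) ∧
      ∀ n, ∀ y ∈ C, ∀ M : ℝ, (∀ x : ι → ℝ, ‖Φ (vecCast ℂ x + Complex.I • vecCast ℂ y)‖ ≤ M) →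
        ‖a n‖ ≤ M * Real.exp (2 * Real.pi * (vecCast ℝ n ⬝ᵥ y)) := by
  obtain ⟨y₀, hy₀⟩ := hne
  let I : (ι → ℤ) → (ι → ℝ) → ℂ := fun n y =>
    ∫ t, Φ (vecCast ℂ (torusRep t) + Complex.I • vecCast ℂ y) *
      expChar (-n) (vecCast ℂ (torusRep t) + Complex.I • vecCast ℂ y) ∂torusMeasure ι
  have hI : ∀ n, ∀ y ∈ C, I n y₀ = I n y := by
    intro n y hy
    refine integral_torus_eq (Φ := fun z => Φ z * expChar (-n) z) hC hconv
      (hΦ.mul (differentiable_expChar _).differentiableOn) (fun z hz v => ?_) hy₀ hy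
    simp only [hper z hz v, expChar_add, expChar_int, mul_one]
  have hest : ∀ n, ∀ y ∈ C, ∀ M : ℝ,
      (∀ x : ι → ℝ, ‖Φ (vecCast ℂ x + Complex.I • vecCast ℂ y)‖ ≤ M) →
        ‖I n y₀‖ ≤ M * Real.exp (2 * Real.pi * (vecCast ℝ n ⬝ᵥ y)) := by
    intro n y hy M hM
    rw [hI n y hy]
    refine (norm_integral_le_of_norm_le_const (C := M * Real.exp (2 * Real.pi *
      (vecCast ℝ n ⬝ᵥ y))) (ae_of_all _ fun t => ?_)).trans_eq (by simp)
    rw [norm_mul, norm_expChar, imVec_re_add_im, vecCast_neg, neg_dotProduct, mul_neg, neg_neg]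
    exact mul_le_mul_of_nonneg_right (hM _) (Real.exp_pos _).le
  refine ⟨fun n => I n y₀, fun z hz => ?_, hest⟩
  -- the Fourier series of the slice of imaginary part `Im z`
  set y := imVec z with hydef
  have hy : y ∈ C := hz
  have hw : Complex.I • vecCast ℂ y ∈ tube C := by
    change imVec _ ∈ C
    rwa [imVec_I_smul]
  let f : C(UnitAddTorus ι, ℂ) :=
    ⟨fun t => Φ (vecCast ℂ (torusRep t) + Complex.I • vecCast ℂ y),
      continuous_apply_torusRep (H := fun x => Φ (vecCast ℂ x + Complex.I • vecCast ℂ y))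
        (periodic_slice hper hw) (continuous_slice hΦ.continuousOn hw)⟩
  have hcoeff : ∀ n, UnitAddTorus.mFourierCoeff f n =
      I n y₀ * expChar n (Complex.I • vecCast ℂ y) := by
    intro n
    rw [hI n y hy, mul_comm, ← integral_const_mul]
    refine integral_congr_ae (ae_of_all _ fun t => ?_)
    have h1 : UnitAddTorus.mFourier (-n) t = expChar (-n) (vecCast ℂ (torusRep t)) := by
      conv_lhs => rw [← toTorus_torusRep t]
      exact mFourier_toTorus _ _
    have h2 : expChar n (Complex.I • vecCast ℂ y) * expChar (-n) (Complex.I • vecCast ℂ y) = 1 := by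
      rw [expChar, expChar, ← Complex.exp_add, vecCast_neg, neg_dotProduct, mul_neg,
        add_neg_cancel, Complex.exp_zero]
    change UnitAddTorus.mFourier (-n) t • Φ (vecCast ℂ (torusRep t) + Complex.I • vecCast ℂ y) = _
    dsimp only
    rw [h1, smul_eq_mul, expChar_add (-n)]
    linear_combination (-(Φ (vecCast ℂ (torusRep t) + Complex.I • vecCast ℂ y) *
      expChar (-n) (vecCast ℂ (torusRep t)))) * h2
  have hsummable : Summable (UnitAddTorus.mFourierCoeff f) := by
    obtain ⟨δ, hδ, hball⟩ := Metric.nhds_basis_closedBall.mem_iff.1 (hC.mem_nhds hy)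
    obtain ⟨M, hM⟩ := exists_bound_of_periodic hΦ.continuousOn hper
      (isCompact_closedBall y δ) hball
    refine Summable.of_norm_bounded (g := fun n : ι → ℤ =>
      M * ∏ i, Real.exp (-((2 * Real.pi * δ) * |(n i : ℝ)|)))
      ((summable_pi_prod (fun _ => (Real.exp_pos _).le)
        (summable_exp_neg_abs (by positivity))).mul_left M) fun n => ?_
    -- move the imaginary part by `δ` against the signs of `n`
    let s : ι → ℝ := fun i => δ * SignType.sign (n i : ℝ)
    have hs : y - s ∈ Metric.closedBall y δ := by
      rw [Metric.mem_closedBall, dist_self_sub_left, pi_norm_le_iff_of_nonneg hδ.le]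
      intro i
      simp only [s, norm_mul, Real.norm_eq_abs, abs_of_pos hδ]
      refine mul_le_of_le_one_right hδ.le ?_
      rcases SignType.sign (n i : ℝ) with _ | _ | _ <;> simp
    have h1 := hest n (y - s) (hball hs) M fun x => hM x _ hs
    rw [hcoeff, norm_mul, norm_expChar, imVec_I_smul]
    refine (mul_le_mul_of_nonneg_right h1 (Real.exp_pos _).le).trans_eq ?_
    rw [mul_assoc, ← Real.exp_add, ← Real.exp_sum]
    congr 2
    rw [dotProduct_sub]
    have h2 : vecCast ℝ n ⬝ᵥ s = ∑ i, δ * |(n i : ℝ)| := by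
      refine Finset.sum_congr rfl fun i _ => ?_
      simp only [s, vecCast, algebraMap_int_eq, eq_intCast]
      rw [mul_left_comm, self_mul_sign]
    rw [h2, Finset.sum_neg_distrib, ← Finset.mul_sum, ← Finset.mul_sum]
    ring
  have hsum := UnitAddTorus.hasSum_mFourier_series_apply_of_summable hsummable
    (toTorus (reVec z))
  have hval : f (toTorus (reVec z)) = Φ z := by
    change Φ (vecCast ℂ (torusRep (toTorus (reVec z))) + Complex.I • vecCast ℂ y) = Φ z
    rw [apply_torusRep_toTorus (H := fun x => Φ (vecCast ℂ x + Complex.I • vecCast ℂ y))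
      (periodic_slice hper hw), ← vec_eq_re_add_im]
  rw [hval] at hsum
  refine hsum.congr_fun fun n => ?_
  rw [hcoeff, smul_eq_mul, mFourier_toTorus, mul_assoc, ← expChar_add, add_comm,
    ← vec_eq_re_add_im]

end Fourier

/-! ### Isometries of the lattice that fix a cusp -/

section Isometries

variable [DecidableEq ι] {S : Matrix ι ι ℤ} {D : Set (ι → ℂ)}

/-- The map `x ↦ x + (p, x) s + (q, x) t` has determinant `1` if the `2 × 2` determinant in the
hypothesis does, by `det (1 + A B) = det (1 + B A)`. -/
lemma exists_rank_two (S : Matrix ι ι ℤ) (p s q t : ι → ℤ)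
    (hdet : (1 + form S p s) * (1 + form S q t) - form S p t * form S q s = 1) :
    ∃ g : Matrix.SpecialLinearGroup ι ℤ, ∀ (R : Type) [CommRing R] (x : ι → R),
      act g x = x + form S (vecCast R p) x • vecCast R s + form S (vecCast R q) x • vecCast R t := by
  let U : Matrix ι (Fin 2) ℤ := Matrix.of fun i => ![s i, t i]
  let V : Matrix (Fin 2) ι ℤ := Matrix.of ![Matrix.vecMul p S, Matrix.vecMul q S]
  have hV : ∀ (R : Type) [CommRing R] (x : ι → R), (V.map (Int.cast : ℤ → R)).mulVec x =
      ![form S (vecCast R p) x, form S (vecCast R q) x] := by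
    intro R _ x
    have h : ∀ a : ι → ℤ, (fun i => ((Matrix.vecMul a S i : ℤ) : R)) ⬝ᵥ x =
        form S (vecCast R a) x := by
      intro a
      rw [form_eq_sum, Finset.sum_comm]
      simp [dotProduct, Matrix.vecMul, vecCast, Finset.sum_mul]
    funext j
    fin_cases j
    · exact h p
    · exact h q
  have hU : ∀ (R : Type) [CommRing R] (a : Fin 2 → R), (U.map (Int.cast : ℤ → R)).mulVec a =
      a 0 • vecCast R s + a 1 • vecCast R t := by
    intro R _ a
    funext i
    simp [U, Matrix.mulVec, dotProduct, Fin.sum_univ_two, vecCast, mul_comm]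
  have h : ∀ a w : ι → ℤ, ∑ j, Matrix.vecMul a S j * w j = form S a w := by
    intro a w
    rw [form_eq_sum, Finset.sum_comm]
    simp [dotProduct, Matrix.vecMul, Finset.sum_mul]
  have hVU : V * U = !![form S p s, form S p t; form S q s, form S q t] := by
    ext i j
    fin_cases i <;> fin_cases j <;> simp [V, U, Matrix.mul_apply, h]
  have hd : (1 + U * V).det = 1 := by
    rw [Matrix.det_one_add_mul_comm, hVU, Matrix.det_fin_two]
    simpa using hdet
  refine ⟨⟨1 + U * V, hd⟩, fun R _ x => ?_⟩
  change ((1 + U * V).map (Int.cast : ℤ → R)).mulVec x = _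
  have h1 : (1 + U * V).map (Int.cast : ℤ → R) =
      1 + (U.map (Int.cast : ℤ → R) * V.map (Int.cast : ℤ → R) : Matrix ι ι R) := by
    rw [← map_cast_mul]
    ext i j
    simp [Matrix.one_apply]
  rw [h1, Matrix.add_mulVec, Matrix.one_mulVec, ← Matrix.mulVec_mulVec, hV, hU, add_assoc]
  rfl

/-- An isometry `x ↦ x + (p, x) s + (q, x) t` with `p, q, s, t ∈ L` acts trivially on `L^∨ / L`. -/
lemma exists_mem_stableSOPlus (hS : S.IsSymm) (hD : IsAffineCone S D) (p s q t : ι → ℤ)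
    (hdet : (1 + form S p s) * (1 + form S q t) - form S p t * form S q s = 1)
    (hiso : ∀ x y : ι → ℤ, form S (x + form S p x • s + form S q x • t)
      (y + form S p y • s + form S q y • t) = form S x y) {Z : ι → ℂ} (hZ : Z ∈ D)
    (hgZ : Z + form S (vecCast ℂ p) Z • vecCast ℂ s + form S (vecCast ℂ q) Z • vecCast ℂ t ∈ D) :
    ∃ g ∈ stableSOPlus S D, ∀ x : ι → ℂ, act g x =
      x + form S (vecCast ℂ p) x • vecCast ℂ s + form S (vecCast ℂ q) x • vecCast ℂ t := by
  obtain ⟨g, hg⟩ := exists_rank_two S p s q t hdet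
  have hgi : ∀ x y : ι → ℤ, form S (act g x) (act g y) = form S x y := by
    intro x y
    have := hiso x y
    rw [hg ℤ x, hg ℤ y]
    exact this
  refine ⟨g, ⟨hgi, ?_, act_image_eq hD hgi hZ (by rwa [hg ℂ])⟩, hg ℂ⟩
  intro x hx
  obtain ⟨j₁, h₁⟩ := hx p
  obtain ⟨j₂, h₂⟩ := hx q
  refine ⟨j₁ • s + j₂ • t, ?_⟩
  rw [hg ℚ, form_comm hS _ x, form_comm hS _ x, h₁, h₂, vecCast_add, vecCast_smul, vecCast_smul]
  simp only [algebraMap_int_eq, eq_intCast]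
  abel

variable (hS : S.IsSymm) {c : ι → ℤ} {b : ι → ℚ} (hcc : form S c c = 0)
  (hcb : form S (vecCast ℚ c) b = 1)

lemma form_int_left_cast {R : Type*} [CommRing R] {x y : ι → ℤ} {k : ℤ} (h : form S x y = k) :
    form S (vecCast R x) (vecCast R y) = (k : R) := by
  rw [form_vecCast, h]; simp

lemma form_rat_cast (R : Type*) [CommRing R] [Algebra ℚ R] {x : ι → ℤ} {y : ι → ℚ} {k : ℚ}
    (h : form S (vecCast ℚ x) y = k) :
    form S (vecCast R x) (vecCast R y) = algebraMap ℚ R k := by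
  rw [form_vecCast_int_rat, h]

include hS hcc hcb in
/-- Invariance under the Eichler transvection that translates the tube domain by `2 u`. -/
lemma apply_tubePoint_translate (hT : AtMostTwoPositive S) (hD : IsAffineCone S D)
    {F : (ι → ℂ) → ℂ} (hF : ∀ g ∈ stableSOPlus S D, ∀ Z ∈ D, F (act g Z) = F Z) {u : ι → ℤ}
    (huc : form S u c = 0) (hub : form S (vecCast ℚ u) b = 0) {z : ι → ℂ}
    (hz : z ∈ tubeDomain S D c b) :
    F (tubePoint S c b (z + (2 : ℂ) • vecCast ℂ u)) = F (tubePoint S c b z) := by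
  obtain ⟨y₀, -, -, -, hy₀⟩ := exists_mem_tubeDomain_iff hS hcc hcb hT hD
  have hzc := hz.1
  have hzb := hz.2.1
  have ucC : form S (vecCast ℂ u) (vecCast ℂ c) = 0 := by
    rw [form_int_left_cast huc, Int.cast_zero]
  have ubC : form S (vecCast ℂ u) (vecCast ℂ b) = 0 := by rw [form_rat_cast ℂ hub, map_zero]
  have hmem : z + (2 : ℂ) • vecCast ℂ u ∈ tubeDomain S D c b := by
    have h := (hy₀ z).1 hz
    have him : imVec (z + (2 : ℂ) • vecCast ℂ u) = imVec z := by
      rw [imVec_add, imVec_smul_int]; simp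
    refine (hy₀ _).2 ⟨?_, ?_, by rw [him]; exact h.2.2.1, by rw [him]; exact h.2.2.2⟩
    · rw [form_add_left, form_smul_left, hzc, ucC, mul_zero, add_zero]
    · rw [form_add_left, form_smul_left, hzb, ubC, mul_zero, add_zero]
  have haction : tubePoint S c b z
      + form S (vecCast ℂ (-(2 * u))) (tubePoint S c b z) • vecCast ℂ c
      + form S (vecCast ℂ c) (tubePoint S c b z) •
        vecCast ℂ (2 * u - (2 * form S u u) • c) =
      tubePoint S c b (z + (2 : ℂ) • vecCast ℂ u) := by
    have h2u : (vecCast ℂ (2 * u) : ι → ℂ) = (2 : ℂ) • vecCast ℂ u := by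
      funext i; simp [vecCast]
    rw [form_comm hS (vecCast ℂ c), form_tubePoint_cusp hS hcc hcb hzc, vecCast_neg, vecCast_sub,
      vecCast_smul, h2u, form_neg_left, form_smul_left, form_left_tubePoint ucC, ubC]
    simp only [tubePoint, form_add_left, form_add_right, form_smul_left, form_smul_right,
      form_comm hS z (vecCast ℂ u), form_vecCast]
    funext i
    simp only [Pi.add_apply, Pi.sub_apply, Pi.smul_apply, smul_eq_mul, algebraMap_int_eq,
      eq_intCast]
    push_cast
    ring
  obtain ⟨g, hg, hact⟩ := exists_mem_stableSOPlus hS hD (-(2 * u)) c c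
    (2 * u - (2 * form S u u) • c) (Z := tubePoint S c b z) (by
      have h2u : 2 * u = (2 : ℤ) • u := by funext i; simp
      simp only [h2u, form_neg_left, form_sub_right, form_smul_left, form_smul_right, huc, hcc,
        form_comm hS c u]
      ring) (fun x y => by
      have h2u : 2 * u = (2 : ℤ) • u := by funext i; simp
      simp only [h2u, form_neg_left, form_sub_right, form_sub_left, form_smul_left,
        form_smul_right, form_add_left, form_add_right, huc, hcc, form_comm hS c u,
        form_comm hS x u, form_comm hS x c]
      ring) hz.2.2 (by rw [haction]; exact hmem.2.2)
  rw [← haction, ← hact]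
  exact hF g hg _ hz.2.2

/-- The isometry of `L_{c,b}` attached to a solution `(x, y)` of a Pell equation: it acts on the
plane of two orthogonal vectors `u`, `v` with `(u, u) = A`, `(v, v) = -B` by the unit
`(x + y √(A B))²`, and trivially on its orthogonal complement. -/
def pellMove (S : Matrix ι ι ℤ) (u v : ι → ℤ) (x y : ℤ) {R : Type*} [CommRing R] (z : ι → R) :
    ι → R :=
  z + form S (vecCast R ((-2 * form S v v * y ^ 2) • u - (2 * x * y) • v)) z • vecCast R u
    + form S (vecCast R ((2 * x * y) • u - (2 * form S u u * y ^ 2) • v)) z • vecCast R v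

lemma pellMove_eq {u v : ι → ℤ} (x y : ℤ) {R : Type*} [CommRing R] (z : ι → R) :
    pellMove S u v x y z =
      z + (-2 * ((form S v v : ℤ) : R) * (y : R) ^ 2 * form S (vecCast R u) z
        - 2 * (x : R) * (y : R) * form S (vecCast R v) z) • vecCast R u
      + (2 * (x : R) * (y : R) * form S (vecCast R u) z
        - 2 * ((form S u u : ℤ) : R) * (y : R) ^ 2 * form S (vecCast R v) z) • vecCast R v := by
  simp only [pellMove, vecCast_sub, vecCast_smul, form_sub_left, form_smul_left]
  simp

include hS in
lemma form_pellMove {u v : ι → ℤ} (huv : form S u v = 0) {x y : ℤ}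
    (hxy : x ^ 2 - -(form S u u * form S v v) * y ^ 2 = 1) {R : Type*} [CommRing R]
    (z w : ι → R) : form S (pellMove S u v x y z) (pellMove S u v x y w) = form S z w := by
  have hxy' : (x : R) ^ 2 - -((form S u u : ℤ) * (form S v v : ℤ) : R) * (y : R) ^ 2 = 1 := by
    exact_mod_cast congrArg (Int.cast : ℤ → R) hxy
  have h1 : form S (vecCast R u) (vecCast R v) = 0 := by
    rw [form_int_left_cast huv, Int.cast_zero]
  simp only [pellMove_eq, form_add_left, form_add_right, form_smul_left, form_smul_right,
    form_comm hS (vecCast R v) (vecCast R u), h1, form_comm hS z (vecCast R u),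
    form_comm hS z (vecCast R v), form_int_left_cast (R := R) (S := S) (x := u) (y := u) rfl,
    form_int_left_cast (R := R) (S := S) (x := v) (y := v) rfl]
  generalize form S (vecCast R u) z = a
  generalize form S (vecCast R v) z = b
  generalize form S (vecCast R u) w = a'
  generalize form S (vecCast R v) w = b'
  generalize ((form S u u : ℤ) : R) = A at *
  generalize ((form S v v : ℤ) : R) = B at *
  linear_combination (4 * y ^ 2 * A * b * b' + 4 * y ^ 2 * B * a * a') * hxy'

include hS in
/-- The Pell unit moves `u` to `(x² + A B y²) u + 2 A x y v`. -/
lemma pellMove_self {u v : ι → ℤ} (huv : form S u v = 0) {x y : ℤ} {R : Type*} [CommRing R] :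
    pellMove S u v x y (vecCast R u) =
      (1 - 2 * ((form S v v : ℤ) : R) * ((form S u u : ℤ) : R) * (y : R) ^ 2) • vecCast R u
      + (2 * (x : R) * (y : R) * ((form S u u : ℤ) : R)) • vecCast R v := by
  have h1 : form S (vecCast R v) (vecCast R u) = 0 := by
    rw [form_comm hS, form_int_left_cast huv, Int.cast_zero]
  rw [pellMove_eq, h1, form_int_left_cast (R := R) (S := S) (x := u) (y := u) rfl]
  funext i
  simp only [Pi.add_apply, Pi.smul_apply, smul_eq_mul]
  ring

include hS in
/-- The solution `(x, -y)` gives the inverse isometry. -/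
lemma pellMove_neg_pellMove {u v : ι → ℤ} (huv : form S u v = 0) {x y : ℤ}
    (hxy : x ^ 2 - -(form S u u * form S v v) * y ^ 2 = 1) {R : Type*} [CommRing R]
    (z : ι → R) : pellMove S u v x (-y) (pellMove S u v x y z) = z := by
  have hxy' : (x : R) ^ 2 - -((form S u u : ℤ) * (form S v v : ℤ) : R) * (y : R) ^ 2 = 1 := by
    exact_mod_cast congrArg (Int.cast : ℤ → R) hxy
  have h1 : form S (vecCast R u) (vecCast R v) = 0 := by
    rw [form_int_left_cast huv, Int.cast_zero]
  simp only [pellMove_eq, form_add_right, form_smul_right,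
    form_comm hS (vecCast R v) (vecCast R u), h1,
    form_int_left_cast (R := R) (S := S) (x := u) (y := u) rfl,
    form_int_left_cast (R := R) (S := S) (x := v) (y := v) rfl]
  funext i
  simp only [Pi.add_apply, Pi.smul_apply, smul_eq_mul]
  generalize form S (vecCast R u) z = a
  generalize form S (vecCast R v) z = b
  generalize ((form S u u : ℤ) : R) = A at *
  generalize ((form S v v : ℤ) : R) = B at *
  push_cast
  linear_combination
    (4 * y ^ 2 * A * b * vecCast R v i + 4 * y ^ 2 * B * a * vecCast R u i) * hxy'

include hS hcc hcb in
lemma apply_tubePoint_pellMove (hT : AtMostTwoPositive S) (hD : IsAffineCone S D)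
    {F : (ι → ℂ) → ℂ} (hF : ∀ g ∈ stableSOPlus S D, ∀ Z ∈ D, F (act g Z) = F Z) {u v : ι → ℤ}
    (huc : form S u c = 0) (hub : form S (vecCast ℚ u) b = 0)
    (hvc : form S v c = 0) (hvb : form S (vecCast ℚ v) b = 0) (huv : form S u v = 0)
    (hupos : vecCast ℝ u ∈ positiveCone S D c b) (hvneg : form S v v < 0) {x y : ℤ}
    (hxy : x ^ 2 - -(form S u u * form S v v) * y ^ 2 = 1) :
    pellMove S u v x y (vecCast ℝ u) ∈ positiveCone S D c b ∧
    ∀ z ∈ tubeDomain S D c b,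
      F (tubePoint S c b (pellMove S u v x y z)) = F (tubePoint S c b z) := by
  obtain ⟨y₀, h0c, h0b, h0pos, hy₀⟩ := exists_mem_tubeDomain_iff hS hcc hcb hT hD
  have ucR : form S (vecCast ℝ u) (vecCast ℝ c) = 0 := by
    rw [form_int_left_cast huc, Int.cast_zero]
  have ubR : form S (vecCast ℝ u) (vecCast ℝ b) = 0 := by rw [form_rat_cast ℝ hub, map_zero]
  have ucC : form S (vecCast ℂ u) (vecCast ℂ c) = 0 := by
    rw [form_int_left_cast huc, Int.cast_zero]
  have ubC : form S (vecCast ℂ u) (vecCast ℂ b) = 0 := by rw [form_rat_cast ℂ hub, map_zero]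
  have vcR : form S (vecCast ℝ v) (vecCast ℝ c) = 0 := by
    rw [form_int_left_cast hvc, Int.cast_zero]
  have vbR : form S (vecCast ℝ v) (vecCast ℝ b) = 0 := by rw [form_rat_cast ℝ hvb, map_zero]
  have vcC : form S (vecCast ℂ v) (vecCast ℂ c) = 0 := by
    rw [form_int_left_cast hvc, Int.cast_zero]
  have vbC : form S (vecCast ℂ v) (vecCast ℂ b) = 0 := by rw [form_rat_cast ℂ hvb, map_zero]
  have huu := (hy₀ _).1 hupos
  rw [imVec_I_smul] at huu
  have huuR : (0 : ℝ) < (form S u u : ℤ) := by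
    have h := huu.2.2.1
    rwa [form_int_left_cast (k := form S u u) rfl] at h
  have huuZ : 0 < form S u u := by exact_mod_cast huuR
  have hmove : pellMove S u v x y (vecCast ℝ u) ∈ positiveCone S D c b := by
    set w := pellMove S u v x y (vecCast ℝ u) with hw
    have hwc : form S w (vecCast ℝ c) = 0 := by
      rw [hw, pellMove_self hS huv, form_add_left, form_smul_left, form_smul_left, ucR, vcR]; simp
    have hwb : form S w (vecCast ℝ b) = 0 := by
      rw [hw, pellMove_self hS huv, form_add_left, form_smul_left, form_smul_left, ubR, vbR]; simp
    have hww : form S w w = form S (vecCast ℝ u) (vecCast ℝ u) := form_pellMove hS huv hxy _ _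
    have hwu : 0 < form S w (vecCast ℝ u) := by
      rw [hw, pellMove_self hS huv, form_add_left, form_smul_left, form_smul_left,
        form_comm hS (vecCast ℝ v), form_int_left_cast huv,
        form_int_left_cast (k := form S u u) rfl]
      have h1 : (0 : ℝ) ≤ -2 * (form S v v : ℤ) * (form S u u : ℤ) * (y : ℝ) ^ 2 := by
        have : (0 : ℝ) ≤ -(form S v v : ℤ) := by exact_mod_cast (neg_pos.2 hvneg).le
        nlinarith [mul_nonneg (mul_nonneg this huuR.le) (sq_nonneg (y : ℝ))]
      have h2 : (0 : ℝ) < 1 - 2 * (form S v v : ℤ) * (form S u u : ℤ) * (y : ℝ) ^ 2 := by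
        linarith
      simpa using mul_pos h2 huuR
    refine (hy₀ _).2 ?_
    rw [imVec_I_smul]
    refine ⟨?_, ?_, by rw [hww]; exact huu.2.2.1, ?_⟩
    · rw [form_smul_left, ← vecCast_vecCast (B := ℝ) c, form_vecCast, hwc]; simp
    · rw [form_smul_left, ← vecCast_vecCast (B := ℝ) b, form_vecCast, hwb]; simp
    · refine form_pos_of_same_half hS hcc hcb hT ucR ubR hwc hwb h0c h0b huu.2.2.1 ?_ h0pos.le
        hwu ?_
      · rw [hww]; exact huu.2.2.1
      · rw [form_comm hS]; exact huu.2.2.2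
  have hpoint : ∀ z : ι → ℂ, pellMove S u v x y (tubePoint S c b z) =
      tubePoint S c b (pellMove S u v x y z) := by
    intro z
    have h := form_pellMove hS huv hxy z z
    rw [tubePoint, tubePoint, h]
    simp only [pellMove_eq, form_add_right, form_sub_right, form_smul_right, ucC, vcC, ubC, vbC]
    funext i
    simp only [Pi.add_apply, Pi.sub_apply, Pi.smul_apply, smul_eq_mul]
    ring
  have hIu : tubePoint S c b (Complex.I • vecCast ℂ u) ∈ D := by
    have h := hupos.2.2
    rwa [vecCast_int_real] at h
  have hlin : pellMove S u v x y (Complex.I • vecCast ℂ u) =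
      Complex.I • vecCast ℂ (pellMove S u v x y (vecCast ℝ u)) := by
    rw [pellMove_self hS huv, vecCast_add, vecCast_smul, vecCast_smul, vecCast_int_real,
      vecCast_int_real, pellMove_eq, form_smul_right, form_smul_right,
      form_comm hS (vecCast ℂ v), form_int_left_cast huv,
      form_int_left_cast (k := form S u u) rfl]
    funext i
    simp only [Pi.add_apply, Pi.smul_apply, smul_eq_mul, Complex.coe_algebraMap]
    push_cast
    ring
  obtain ⟨g, hg, hact⟩ := exists_mem_stableSOPlus hS hD
    ((-2 * form S v v * y ^ 2) • u - (2 * x * y) • v) u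
    ((2 * x * y) • u - (2 * form S u u * y ^ 2) • v) v (by
      simp only [form_sub_left, form_smul_left, form_comm hS v u, huv]
      linear_combination (4 * form S u u * form S v v * y ^ 2) * hxy) (fun z w => by
      have h := form_pellMove hS huv hxy z w
      exact h) hIu (by
      change pellMove S u v x y (tubePoint S c b (Complex.I • vecCast ℂ u)) ∈ D
      rw [hpoint, hlin]
      exact hmove.2.2)
  refine ⟨hmove, fun z hz => ?_⟩
  rw [← hpoint, ← hF g hg _ hz.2.2, hact]
  rfl

end Isometries

/-! ### Integral vectors and Pell's equation -/

lemma exists_int_multiple (x : ι → ℚ) :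
    ∃ K : ℕ, 0 < K ∧ ∃ v : ι → ℤ, vecCast ℚ v = (K : ℚ) • x := by
  classical
  refine ⟨∏ i, (x i).den, Finset.prod_pos fun i _ => (x i).den_pos,
    fun i => (x i).num * ∏ j ∈ Finset.univ.erase i, ((x j).den : ℤ), ?_⟩
  funext i
  have h : ((∏ j, (x j).den : ℕ) : ℚ) = (x i).den * ∏ j ∈ Finset.univ.erase i, ((x j).den : ℚ) := by
    rw [Finset.mul_prod_erase _ (fun j => ((x j).den : ℚ)) (Finset.mem_univ i)]
    push_cast
    rfl
  have h2 : ((x i).den : ℚ) * x i = (x i).num := by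
    rw [mul_comm]; exact Rat.mul_den_eq_num _
  simp only [vecCast, algebraMap_int_eq, eq_intCast, Pi.smul_apply, smul_eq_mul]
  rw [h]
  push_cast
  linear_combination (-∏ j ∈ Finset.univ.erase i, ((x j).den : ℚ)) * h2

/-- Fewer than `rank L` linear conditions have a common nonzero solution in `L`. -/
lemma exists_int_orthogonal (S : Matrix ι ι ℤ) {k : ℕ} (hk : k < Fintype.card ι)
    (w : Fin k → ι → ℚ) : ∃ v : ι → ℤ, v ≠ 0 ∧ ∀ j, form S (vecCast ℚ v) (w j) = 0 := by
  let T : (ι → ℚ) →ₗ[ℚ] (Fin k → ℚ) :=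
    { toFun := fun x j => form S x (w j)
      map_add' := fun x y => funext fun j => form_add_left S x y (w j)
      map_smul' := fun t x => funext fun j => form_smul_left S t x (w j) }
  obtain ⟨x, hx, hx0⟩ := Submodule.exists_mem_ne_zero_of_ne_bot
    (LinearMap.ker_ne_bot_of_finrank_lt (f := T) (by simpa using hk))
  obtain ⟨K, hK, v, hv⟩ := exists_int_multiple x
  have hK' : (K : ℚ) ≠ 0 := by exact_mod_cast hK.ne'
  refine ⟨v, fun h0 => ?_, fun j => ?_⟩
  · rw [h0, vecCast_zero] at hv
    exact (smul_ne_zero hK' hx0) hv.symm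
  · rw [hv, form_smul_left, show form S x (w j) = 0 from congrFun hx j, mul_zero]

lemma exists_pell_solution {d : ℤ} (hd : 0 < d) (hsq : ¬IsSquare d) (N : ℕ) :
    ∃ x y : ℤ, x ^ 2 - d * y ^ 2 = 1 ∧ (N : ℤ) < |y| := by
  induction N with
  | zero =>
    obtain ⟨x, y, h, hy⟩ := Pell.exists_of_not_isSquare hd hsq
    exact ⟨x, y, h, by simpa using hy⟩
  | succ N ih =>
    obtain ⟨x, y, h, hy⟩ := ih
    -- the square of the unit `x + y √d`
    refine ⟨x ^ 2 + d * y ^ 2, 2 * x * y, by linear_combination (x ^ 2 - d * y ^ 2 + 1) * h, ?_⟩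
    have hx : 1 ≤ |x| := by
      refine Int.one_le_abs fun hx0 => ?_
      rw [hx0] at h
      nlinarith [mul_nonneg hd.le (sq_nonneg y)]
    rw [abs_mul, abs_mul, abs_two]
    push_cast
    have h0 : (0 : ℤ) ≤ N := by positivity
    nlinarith [mul_le_mul_of_nonneg_right hx (abs_nonneg y)]

lemma not_isSquare_two_mul {s t : ℤ} (hs : s ≠ 0) (ht : t ≠ 0) :
    ¬IsSquare (2 * (s ^ 2 * t ^ 2)) := by
  rintro ⟨a, ha⟩
  have h2 : IsSquare (2 : ℚ) := by
    refine ⟨a / (s * t), ?_⟩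
    have hs' : (s : ℚ) ≠ 0 := by exact_mod_cast hs
    have ht' : (t : ℚ) ≠ 0 := by exact_mod_cast ht
    have ha' : (2 : ℚ) * (s ^ 2 * t ^ 2) = a * a := by exact_mod_cast ha
    field_simp
    linear_combination ha'
  have h3 : IsSquare ((2 : ℕ) : ℚ) := by exact_mod_cast h2
  rw [Rat.isSquare_natCast_iff] at h3
  exact Nat.prime_two.prime.irreducible.not_isSquare h3

/-- Two orthogonal negative vectors span a negative vector `v` for which `A (v, v)` is not minus a
square, so that a Pell equation is available. -/
lemma exists_not_isSquare {S : Matrix ι ι ℤ} (hS : S.IsSymm) (u : ι → ℤ) {v w : ι → ℤ}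
    (hu : 0 < form S u u) (hv : form S v v < 0) (hw : form S w w < 0) (hvw : form S v w = 0) :
    ∃ i j : ℤ, form S (i • v + j • w) (i • v + j • w) < 0 ∧
      ¬IsSquare (-(form S u u * form S (i • v + j • w) (i • v + j • w))) := by
  have hform : ∀ i j : ℤ, form S (i • v + j • w) (i • v + j • w) =
      i ^ 2 * form S v v + j ^ 2 * form S w w := by
    intro i j
    simp only [form_add_left, form_add_right, form_smul_left, form_smul_right, hvw,
      form_comm hS w v]
    ring
  by_cases h1 : IsSquare (-(form S u u * form S v v))
  · by_cases h2 : IsSquare (-(form S u u * form S w w))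
    · obtain ⟨s, hs⟩ := h1
      obtain ⟨t, ht⟩ := h2
      have hs0 : s ≠ 0 := by rintro rfl; nlinarith [mul_pos hu (neg_pos.2 hv)]
      have ht0 : t ≠ 0 := by rintro rfl; nlinarith [mul_pos hu (neg_pos.2 hw)]
      refine ⟨t, s, ?_, ?_⟩
      · rw [hform]
        nlinarith [mul_pos (sq_pos_of_ne_zero ht0) (neg_pos.2 hv),
          mul_pos (sq_pos_of_ne_zero hs0) (neg_pos.2 hw)]
      · rw [hform]
        convert not_isSquare_two_mul hs0 ht0 using 2
        linear_combination t ^ 2 * hs + s ^ 2 * ht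
    · exact ⟨0, 1, by simpa using hw, by simpa using h2⟩
  · exact ⟨1, 0, by simpa using hv, by simpa using h1⟩

/-- The projection to `L_{c,b}` maps a finite index sublattice of `L` into `L`. -/
lemma exists_int_cuspProj {S : Matrix ι ι ℤ} (c : ι → ℤ) {b : ι → ℚ} {K : ℕ} {β : ι → ℤ}
    (hβ : vecCast ℚ β = (K : ℚ) • b) (v : ι → ℤ) :
    ∃ u : ι → ℤ, vecCast ℚ u = cuspProj S c b (((K : ℚ) ^ 2) • vecCast ℚ v) := by
  refine ⟨(K : ℤ) ^ 2 • v - (K * form S v β) • c - (K * form S v c) • β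
    + (form S β β * form S v c) • c, ?_⟩
  have h1 : ((form S v β : ℤ) : ℚ) = K * form S (vecCast ℚ v) b := by
    have := form_vecCast (R := ℚ) S v β
    rw [hβ, form_smul_right] at this
    simpa using this.symm
  have h2 : ((form S v c : ℤ) : ℚ) = form S (vecCast ℚ v) (vecCast ℚ c) := by
    simpa using (form_vecCast (R := ℚ) S v c).symm
  have h3 : ((form S β β : ℤ) : ℚ) = K ^ 2 * form S b b := by
    have := form_vecCast (R := ℚ) S β β
    rw [hβ, form_smul_right, form_smul_left] at this
    rw [sq, mul_assoc]
    simpa using this.symm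
  have hb : (vecCast ℚ b : ι → ℚ) = b := rfl
  simp only [cuspProj, vecCast_add, vecCast_sub, vecCast_smul, hβ, form_smul_left, hb, smul_smul,
    algebraMap_int_eq, eq_intCast, Int.cast_mul, h1, h2, h3, Int.cast_pow, Int.cast_natCast]
  funext i
  simp only [Pi.add_apply, Pi.sub_apply, Pi.smul_apply, smul_eq_mul]
  ring

lemma exists_rat_mem {U : Set (ι → ℝ)} (hU : IsOpen U) (hne : U.Nonempty) :
    ∃ q : ι → ℚ, vecCast ℝ q ∈ U := by
  have hd : DenseRange (vecCast ℝ : (ι → ℚ) → ι → ℝ) :=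
    DenseRange.piMap (f := fun (_ : ι) (q : ℚ) => (q : ℝ)) fun _ => Rat.denseRange_cast
  obtain ⟨_, hx, q, rfl⟩ := hd.inter_open_nonempty U hU hne
  exact ⟨q, hx⟩

/-! ### Fourier expansion at a cusp -/

section CuspExpansion

variable [DecidableEq ι] {S : Matrix ι ι ℤ} {D : Set (ι → ℂ)}

/-- The vector `l` of `L ⊗ ℚ` with `K (l, x) = n · x`. -/
lemma exists_frequency (hS : S.IsSymm) (hdet : S.det ≠ 0) {K : ℕ} (hK : 0 < K) :
    ∃ ℓ : (ι → ℤ) → ι → ℚ, Function.Injective ℓ ∧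
      ∀ (n : ι → ℤ) (R : Type) [CommRing R] [Algebra ℚ R] (x : ι → R),
        (K : R) * form S (vecCast R (ℓ n)) x = vecCast R n ⬝ᵥ x := by
  have hK' : (K : ℚ) ≠ 0 := by exact_mod_cast hK.ne'
  have hunit : IsUnit (S.map (Int.cast : ℤ → ℚ)).det := by
    have h : (S.map (Int.cast : ℤ → ℚ)).det = ((S.det : ℤ) : ℚ) :=
      ((Int.castRingHom ℚ).map_det S).symm
    rw [h, isUnit_iff_ne_zero]
    exact_mod_cast hdet
  let ℓ : (ι → ℤ) → ι → ℚ := fun n =>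
    (K : ℚ)⁻¹ • (S.map (Int.cast : ℤ → ℚ))⁻¹.mulVec (vecCast ℚ n)
  have hℓ : ∀ n, (K : ℚ) • (S.map (Int.cast : ℤ → ℚ)).mulVec (ℓ n) = vecCast ℚ n := by
    intro n
    rw [Matrix.mulVec_smul, smul_smul, mul_inv_cancel₀ hK', one_smul, Matrix.mulVec_mulVec,
      Matrix.mul_nonsing_inv _ hunit, Matrix.one_mulVec]
  refine ⟨ℓ, fun n m h => ?_, fun n R _ _ x => ?_⟩
  · have h2 := hℓ n
    rw [h, hℓ m] at h2
    exact (vecCast_injective (R := ℚ) (A := ℤ) (fun a b hab => by simpa using hab) h2).symm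
  · rw [form_comm hS, form]
    have h : (K : R) • (S.map (Int.cast : ℤ → R)).mulVec (vecCast R (ℓ n)) = vecCast R n := by
      rw [← vecCast_vecCast (B := ℚ) n, ← hℓ n]
      funext i
      simp [vecCast, Matrix.mulVec, dotProduct]
    rw [← smul_eq_mul, ← dotProduct_smul, h, dotProduct_comm]

variable (hS : S.IsSymm) {c : ι → ℤ} {b : ι → ℚ} (hcc : form S c c = 0)
  (hcb : form S (vecCast ℚ c) b = 1)

include hS hcc hcb in
lemma mem_positiveCone_iff {y₀ : ι → ℝ}
    (hy₀ : ∀ z : ι → ℂ, z ∈ tubeDomain S D c b ↔ form S z (vecCast ℂ c) = 0 ∧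
        form S z (vecCast ℂ b) = 0 ∧ 0 < form S (imVec z) (imVec z) ∧
        0 < form S (imVec z) y₀) (y : ι → ℝ) :
    y ∈ positiveCone S D c b ↔ form S y (vecCast ℝ c) = 0 ∧ form S y (vecCast ℝ b) = 0 ∧
      0 < form S y y ∧ 0 < form S y y₀ := by
  have h1 : form S (Complex.I • vecCast ℂ y) (vecCast ℂ c) = 0 ↔ form S y (vecCast ℝ c) = 0 := by
    rw [form_smul_left, ← vecCast_vecCast (B := ℝ) c, form_vecCast]
    simp
  have h2 : form S (Complex.I • vecCast ℂ y) (vecCast ℂ b) = 0 ↔ form S y (vecCast ℝ b) = 0 := by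
    rw [form_smul_left, ← vecCast_vecCast (B := ℝ) b, form_vecCast]
    simp
  exact (hy₀ _).trans (by rw [h1, h2, imVec_I_smul])

/-- The Fourier coefficient of index `l` vanishes if `exp (2 π (l, y))` is not bounded below on
imaginary parts `y` over which the function is uniformly bounded. -/
lemma eq_zero_of_le_exp {a : ℂ} {M : ℝ} {s : ℕ → ℝ} (hs : Tendsto s atTop atBot)
    (h : ∀ k, ‖a‖ ≤ M * Real.exp (2 * Real.pi * s k)) : a = 0 := by
  have h1 : Tendsto (fun k => M * Real.exp (2 * Real.pi * s k)) atTop (𝓝 (M * 0)) :=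
    (Real.tendsto_exp_atBot.comp (hs.const_mul_atBot (by positivity))).const_mul M
  rw [mul_zero] at h1
  exact norm_le_zero_iff.1 (ge_of_tendsto' h1 h)

include hS hcc hcb in
/-- Fourier expansion at a cusp of a holomorphic function invariant under the Eichler
transvections, together with Cauchy's estimates for its coefficients. -/
lemma exists_cusp_expansion (hT : AtMostTwoPositive S) (hdet : S.det ≠ 0)
    (hD : IsAffineCone S D) {F : (ι → ℂ) → ℂ} (hol : HolomorphicOnCone D F)
    (hF : ∀ g ∈ stableSOPlus S D, ∀ Z ∈ D, F (act g Z) = F Z) :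
    ∃ f, HasFourierExpansion S D c b F f ∧
      (∀ y ∈ positiveCone S D c b, ∃ M : ℝ, ∀ x : ι → ℝ, form S x (vecCast ℝ c) = 0 →
        form S x (vecCast ℝ b) = 0 →
        ‖F (tubePoint S c b (vecCast ℂ x + Complex.I • vecCast ℂ y))‖ ≤ M) ∧
      ∀ l, f l ≠ 0 → ∀ y ∈ positiveCone S D c b, ∀ M : ℝ,
        (∀ x : ι → ℝ, form S x (vecCast ℝ c) = 0 → form S x (vecCast ℝ b) = 0 →
          ‖F (tubePoint S c b (vecCast ℂ x + Complex.I • vecCast ℂ y))‖ ≤ M) →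
        ‖f l‖ ≤ M * Real.exp (2 * Real.pi * form S (vecCast ℝ l) y) := by
  obtain ⟨y₀, h0c, h0b, h0pos, hy₀⟩ := exists_mem_tubeDomain_iff hS hcc hcb hT hD
  have hpc := mem_positiveCone_iff hS hcc hcb hy₀
  obtain ⟨K₀, hK₀, β, hβ⟩ := exists_int_multiple b
  -- the lattice `K ℤ^ι` projects into the lattice of periods
  obtain ⟨K, hKdef⟩ : ∃ K : ℕ, K = 2 * K₀ ^ 2 := ⟨_, rfl⟩
  have hK : 0 < K := by rw [hKdef]; positivity
  have hKR : (0 : ℝ) < K := by exact_mod_cast hK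
  have hKC : (K : ℂ) ≠ 0 := by exact_mod_cast hK.ne'
  let C : Set (ι → ℝ) := {y | 0 < form S (cuspProj S c b y) (cuspProj S c b y) ∧
    0 < form S (cuspProj S c b y) y₀}
  have hprojc : Continuous (cuspProj S c b : (ι → ℝ) → ι → ℝ) := by
    have h1 := continuous_form S (continuous_id (X := ι → ℝ))
      (continuous_const (y := (vecCast ℝ c : ι → ℝ)))
    have h2 := continuous_form S (continuous_id (X := ι → ℝ))
      (continuous_const (y := (vecCast ℝ b : ι → ℝ)))
    simp only [id] at h1 h2
    unfold cuspProj
    fun_prop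
  have hCo : IsOpen C :=
    (isOpen_lt continuous_const (continuous_form S hprojc hprojc)).inter
      (isOpen_lt continuous_const (continuous_form S hprojc continuous_const))
  have hCconv : Convex ℝ C := by
    intro x hx y hy p q hp hq hpq
    change 0 < form S (cuspProj S c b (p • x + q • y)) (cuspProj S c b (p • x + q • y)) ∧
      0 < form S (cuspProj S c b (p • x + q • y)) y₀
    rw [cuspProj_add, cuspProj_smul, cuspProj_smul]
    have hxy := form_pos_of_same_half hS hcc hcb hT h0c h0b (form_cuspProj_left hS hcc hcb x)
      (form_cuspProj_right hS hcc hcb x) (form_cuspProj_left hS hcc hcb y)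
      (form_cuspProj_right hS hcc hcb y) h0pos hx.1 hy.1.le hx.2 hy.2
    simp only [form_add_left, form_add_right, form_smul_left, form_smul_right,
      form_comm hS (cuspProj S c b y) (cuspProj S c b x)]
    rcases hp.eq_or_lt with rfl | hp
    · have hq1 : q = 1 := by linarith
      subst hq1
      exact ⟨by simpa using hy.1, by simpa using hy.2⟩
    · have e1 : 0 < p * (p * form S (cuspProj S c b x) (cuspProj S c b x)) :=
        mul_pos hp (mul_pos hp hx.1)
      have e2 : 0 ≤ p * (q * form S (cuspProj S c b x) (cuspProj S c b y)) :=
        mul_nonneg hp.le (mul_nonneg hq hxy.le)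
      have e3 : 0 ≤ q * (q * form S (cuspProj S c b y) (cuspProj S c b y)) :=
        mul_nonneg hq (mul_nonneg hq hy.1.le)
      have e4 : 0 < p * form S (cuspProj S c b x) y₀ := mul_pos hp hx.2
      have e5 : 0 ≤ q * form S (cuspProj S c b y) y₀ := mul_nonneg hq hy.2.le
      constructor <;> nlinarith
  have hpcC : ∀ y ∈ positiveCone S D c b, (K : ℝ)⁻¹ • y ∈ C := by
    intro y hy
    obtain ⟨h1, h2, h3, h4⟩ := (hpc y).1 hy
    change 0 < form S (cuspProj S c b ((K : ℝ)⁻¹ • y)) (cuspProj S c b ((K : ℝ)⁻¹ • y)) ∧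
      0 < form S (cuspProj S c b ((K : ℝ)⁻¹ • y)) y₀
    rw [cuspProj_smul, cuspProj_eq_self h1 h2]
    simp only [form_smul_left, form_smul_right]
    exact ⟨by positivity, by positivity⟩
  have hCne : C.Nonempty := ⟨_, hpcC y₀ ((hpc y₀).2 ⟨h0c, h0b, h0pos, h0pos⟩)⟩
  let pt : (ι → ℂ) → ι → ℂ := fun z => cuspProj S c b ((K : ℂ) • z)
  have hpt : ∀ z ∈ tube C, pt z ∈ tubeDomain S D c b := by
    intro z hz
    refine (hy₀ _).2 ⟨form_cuspProj_left hS hcc hcb _, form_cuspProj_right hS hcc hcb _, ?_⟩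
    have h : imVec ((K : ℂ) • z) = (K : ℝ) • imVec z := by
      rw [← imVec_real_smul]; simp
    rw [imVec_cuspProj, h, cuspProj_smul]
    simp only [form_smul_left, form_smul_right]
    exact ⟨mul_pos hKR (mul_pos hKR hz.1), mul_pos hKR hz.2⟩
  let Φ : (ι → ℂ) → ℂ := fun z => F (tubePoint S c b (pt z))
  have hptd : Differentiable ℂ fun z => tubePoint S c b (pt z) := by
    have h0 : Differentiable ℂ fun z : ι → ℂ => (K : ℂ) • z := by fun_prop
    have h1 := differentiable_form S h0 (differentiable_const (vecCast ℂ c : ι → ℂ))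
    have h2 := differentiable_form S h0 (differentiable_const (vecCast ℂ b : ι → ℂ))
    have h3 : Differentiable ℂ pt := by
      simp only [pt, cuspProj]
      fun_prop
    have h4 := differentiable_form S h3 h3
    unfold tubePoint
    fun_prop
  have hΦ : DifferentiableOn ℂ Φ (tube C) := by
    intro z hz
    obtain ⟨U, hU, hzU, G, hG, hFG⟩ := hol _ (hpt z hz).2.2
    have hGd : DifferentiableAt ℂ (fun w => G (tubePoint S c b (pt w))) z :=
      (hG.differentiableAt (hU.mem_nhds hzU)).comp z (hptd z)
    refine (hGd.congr_of_eventuallyEq ?_).differentiableWithinAt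
    filter_upwards [(isOpen_tube hCo).mem_nhds hz,
      (hU.preimage hptd.continuous).mem_nhds hzU] with w hw hwU
    exact hFG _ ⟨hwU, (hpt w hw).2.2⟩
  have hper : ∀ z ∈ tube C, ∀ v : ι → ℤ, Φ (z + vecCast ℂ v) = Φ z := by
    intro z hz v
    obtain ⟨u, hu⟩ := exists_int_cuspProj (S := S) c hβ v
    have huc : form S u c = 0 := by
      have h := form_cuspProj_left (R := ℚ) hS hcc hcb (((K₀ : ℚ) ^ 2) • vecCast ℚ v)
      rw [← hu, form_vecCast] at h
      simpa using h
    have hub : form S (vecCast ℚ u) b = 0 := by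
      have h := form_cuspProj_right (R := ℚ) hS hcc hcb (((K₀ : ℚ) ^ 2) • vecCast ℚ v)
      rw [← hu] at h
      exact h
    have huC : cuspProj S c b ((K : ℂ) • vecCast ℂ v) = (2 : ℂ) • vecCast ℂ u := by
      have h : (vecCast ℂ u : ι → ℂ) = vecCast ℂ (vecCast ℚ u) := (vecCast_vecCast u).symm
      rw [h, hu]
      have h5 : (vecCast ℂ (cuspProj S c b (((K₀ : ℚ) ^ 2) • vecCast ℚ v)) : ι → ℂ) =
          cuspProj S c b (((K₀ : ℂ) ^ 2) • vecCast ℂ v) := by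
        rw [← cuspProj_vecCast, vecCast_smul, vecCast_vecCast, map_pow, map_natCast]
      rw [h5, hKdef, ← cuspProj_smul, smul_smul]
      push_cast
      rfl
    have h6 : pt (z + vecCast ℂ v) = pt z + (2 : ℂ) • vecCast ℂ u := by
      simp only [pt, smul_add, cuspProj_add, huC]
    simp only [Φ, h6]
    exact apply_tubePoint_translate hS hcc hcb hT hD hF huc hub (hpt z hz)
  obtain ⟨a, hsum, hest⟩ := exists_fourier_expansion hCo hCconv hCne hΦ hper
  obtain ⟨ℓ, hinj, hℓ⟩ := exists_frequency hS hdet hK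
  have hpair : ∀ n (y : ι → ℝ), vecCast ℝ n ⬝ᵥ ((K : ℝ)⁻¹ • y) = form S (vecCast ℝ (ℓ n)) y := by
    intro n y
    rw [dotProduct_smul, ← hℓ n ℝ y, smul_eq_mul, inv_mul_cancel_left₀ hKR.ne']
  -- `Φ` at `x + i y / K` is `F` at the point of the tube domain with imaginary part `y`
  have hslice : ∀ y ∈ positiveCone S D c b, ∀ x : ι → ℝ,
      Φ (vecCast ℂ x + Complex.I • vecCast ℂ ((K : ℝ)⁻¹ • y)) =
        F (tubePoint S c b (vecCast ℂ (cuspProj S c b ((K : ℝ) • x)) + Complex.I • vecCast ℂ y)) := by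
    intro y hy x
    obtain ⟨h1, h2, -, -⟩ := (hpc y).1 hy
    have e1 : (K : ℂ) • (vecCast ℂ x + Complex.I • vecCast ℂ ((K : ℝ)⁻¹ • y)) =
        vecCast ℂ ((K : ℝ) • x) + Complex.I • vecCast ℂ y := by
      funext i
      simp only [vecCast, Pi.smul_apply, Pi.add_apply, smul_eq_mul, Complex.coe_algebraMap]
      push_cast
      field_simp
    simp only [Φ, pt]
    rw [e1, cuspProj_add, cuspProj_smul, cuspProj_vecCast, cuspProj_vecCast,
      cuspProj_eq_self h1 h2]
  have hest' : ∀ n, ∀ y ∈ positiveCone S D c b, ∀ M : ℝ,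
      (∀ x : ι → ℝ, form S x (vecCast ℝ c) = 0 → form S x (vecCast ℝ b) = 0 →
          ‖F (tubePoint S c b (vecCast ℂ x + Complex.I • vecCast ℂ y))‖ ≤ M) →
        ‖a n‖ ≤ M * Real.exp (2 * Real.pi * form S (vecCast ℝ (ℓ n)) y) := by
    intro n y hy M hM
    rw [← hpair]
    refine hest n _ (hpcC y hy) M fun x => ?_
    rw [hslice y hy]
    exact hM _ (form_cuspProj_left hS hcc hcb _) (form_cuspProj_right hS hcc hcb _)
  -- `Φ` is constant along the plane of `c` and `b`, so only indices orthogonal to it occur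
  have horth : ∀ n, a n ≠ 0 → ∀ w : ι → ℝ, cuspProj S c b w = 0 →
      form S (vecCast ℝ (ℓ n)) w = 0 := by
    intro n hn w hw
    by_contra hne
    set s := vecCast ℝ n ⬝ᵥ w with hs
    have hs0 : s ≠ 0 := by
      rw [hs, ← hℓ n ℝ w]
      exact mul_ne_zero hKR.ne' hne
    obtain ⟨y, hy⟩ := hCne
    obtain ⟨M, hM⟩ := exists_bound_of_periodic hΦ.continuousOn hper (isCompact_singleton (x := y))
      (Set.singleton_subset_iff.2 hy)
    have hproj : ∀ k : ℕ, cuspProj S c b (y - (k * s) • w) = cuspProj S c b y := by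
      intro k
      have : y - (k * s) • w = y + (-(k * s)) • w := by rw [neg_smul, sub_eq_add_neg]
      rw [this, cuspProj_add, cuspProj_smul, hw, smul_zero, add_zero]
    refine hn (eq_zero_of_le_exp (M := M) (s := fun k : ℕ => vecCast ℝ n ⬝ᵥ (y - (k * s) • w)) ?_
      fun k => hest n _ ?_ M fun x => ?_)
    · simp only [dotProduct_sub, dotProduct_smul, ← hs, smul_eq_mul]
      have h1 : Tendsto (fun k : ℕ => (k : ℝ) * (s * s)) atTop atTop :=
        tendsto_natCast_atTop_atTop.atTop_mul_const (mul_self_pos.2 hs0)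
      have h2 := tendsto_atBot_add_const_left atTop (vecCast ℝ n ⬝ᵥ y)
        (tendsto_neg_atTop_atBot.comp h1)
      refine h2.congr fun k => ?_
      simp only [Function.comp_apply]
      ring
    · change 0 < form S (cuspProj S c b _) (cuspProj S c b _) ∧ 0 < form S (cuspProj S c b _) y₀
      rw [hproj]
      exact hy
    · refine le_trans (le_of_eq ?_) (hM x y rfl)
      have e : pt (vecCast ℂ x + Complex.I • vecCast ℂ (y - (k * s) • w)) =
          pt (vecCast ℂ x + Complex.I • vecCast ℂ y) := by
        have hwC : (cuspProj S c b (vecCast ℂ w) : ι → ℂ) = 0 := by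
          rw [cuspProj_vecCast, hw, vecCast_zero]
        have e3 : (K : ℂ) • (vecCast ℂ x + Complex.I • vecCast ℂ (y - (k * s) • w)) =
            (K : ℂ) • (vecCast ℂ x + Complex.I • vecCast ℂ y)
              + (-(K : ℂ) * Complex.I * ((k * s : ℝ) : ℂ)) • vecCast ℂ w := by
          funext i
          simp only [vecCast, Pi.smul_apply, Pi.add_apply, Pi.sub_apply, smul_eq_mul,
            Complex.coe_algebraMap]
          push_cast
          ring
        simp only [pt]
        rw [e3, cuspProj_add, cuspProj_smul _ (vecCast ℂ w), hwC, smul_zero, add_zero]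
      simp only [Φ, e]
  refine ⟨Function.extend ℓ a 0, ⟨⟨K, hK, fun l hl => ?_⟩, fun z hz => ?_⟩, fun y hy => ?_,
    fun l hl y hy M hM => ?_⟩
  · by_cases hex : ∃ n, ℓ n = l
    · obtain ⟨n, rfl⟩ := hex
      rw [hinj.extend_apply] at hl
      refine ⟨⟨?_, ?_⟩, fun v _ => ⟨n ⬝ᵥ v, ?_⟩⟩
      · have h := horth n hl (vecCast ℝ c) (cuspProj_left hcc hcb)
        rw [← vecCast_vecCast (B := ℚ) c, form_vecCast] at h
        simpa using h
      · have h := horth n hl (vecCast ℝ b) (cuspProj_right hS hcb)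
        rw [form_vecCast] at h
        simpa using h
      · have h := hℓ n ℚ (vecCast ℚ v)
        rw [show vecCast ℚ (ℓ n) = ℓ n from rfl] at h
        rw [h]
        simp [dotProduct, vecCast]
    · rw [Function.extend_apply' _ _ _ hex] at hl
      exact absurd rfl hl
  · have hz' : (K : ℂ)⁻¹ • z ∈ tube C := by
      have him : imVec ((K : ℂ)⁻¹ • z) = (K : ℝ)⁻¹ • imVec z := by
        rw [← imVec_real_smul]; simp
      change imVec _ ∈ C
      rw [him]
      refine hpcC _ ((hpc _).2 ?_)
      obtain ⟨h1, h2, h3, h4⟩ := (hy₀ z).1 hz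
      exact ⟨form_im_of_form_int h1, form_im_of_form_rat h2, h3, h4⟩
    have h := hsum _ hz'
    have hval : Φ ((K : ℂ)⁻¹ • z) = F (tubePoint S c b z) := by
      simp only [Φ, pt]
      rw [smul_smul, mul_inv_cancel₀ hKC, one_smul, cuspProj_eq_self hz.1 hz.2.1]
    rw [hval] at h
    rw [← hinj.hasSum_iff] 
    · refine h.congr_fun fun n => ?_
      simp only [Function.comp_apply]
      rw [hinj.extend_apply, expChar, dotProduct_smul, ← hℓ n ℂ z, smul_eq_mul,
        inv_mul_cancel_left₀ hKC]
    · intro l hl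
      rw [Function.extend_apply' _ _ _ (by simpa using hl)]
      simp
  · obtain ⟨M, hM⟩ := exists_bound_of_periodic hΦ.continuousOn hper
      (isCompact_singleton (x := (K : ℝ)⁻¹ • y)) (Set.singleton_subset_iff.2 (hpcC y hy))
    refine ⟨M, fun x hxc hxb => ?_⟩
    have h := hM ((K : ℝ)⁻¹ • x) _ rfl
    rwa [hslice y hy, smul_smul, mul_inv_cancel₀ hKR.ne', one_smul,
      cuspProj_eq_self hxc hxb] at h
  · by_cases hex : ∃ n, ℓ n = l
    · obtain ⟨n, rfl⟩ := hex
      rw [hinj.extend_apply]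
      exact hest' n y hy M hM
    · rw [Function.extend_apply' _ _ _ hex] at hl
      exact absurd rfl hl

end CuspExpansion

/-! ### The Koecher principle -/

section Koecher

variable [DecidableEq ι] {S : Matrix ι ι ℤ} {D : Set (ι → ℂ)}

lemma pellMove_add {u v : ι → ℤ} (x y : ℤ) {R : Type*} [CommRing R] (z w : ι → R) :
    pellMove S u v x y (z + w) = pellMove S u v x y z + pellMove S u v x y w := by
  simp only [pellMove, form_add_right, add_smul]
  abel

lemma pellMove_smul {u v : ι → ℤ} (x y : ℤ) {R : Type*} [CommRing R] (t : R) (z : ι → R) :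
    pellMove S u v x y (t • z) = t • pellMove S u v x y z := by
  simp only [pellMove, form_smul_right, smul_add, smul_smul]

lemma pellMove_vecCast {u v : ι → ℤ} (x y : ℤ) (z : ι → ℝ) :
    pellMove S u v x y (vecCast ℂ z) = vecCast ℂ (pellMove S u v x y z) := by
  have h : ∀ p : ι → ℤ, form S (vecCast ℂ p) (vecCast ℂ z) =
      algebraMap ℝ ℂ (form S (vecCast ℝ p) z) := fun p => by
    rw [← vecCast_int_real, form_vecCast]
  simp only [pellMove, vecCast_add, vecCast_smul, vecCast_int_real, h]

lemma form_pellMove_right {u v : ι → ℤ} (x y : ℤ) {R : Type*} [CommRing R] {l z : ι → R}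
    (hu : form S (vecCast R u) l = 0) (hv : form S (vecCast R v) l = 0) :
    form S (pellMove S u v x y z) l = form S z l := by
  simp only [pellMove, form_add_left, form_smul_left, hu, hv]
  ring

variable (hS : S.IsSymm) {c : ι → ℤ} {b : ι → ℚ} (hcc : form S c c = 0)
  (hcb : form S (vecCast ℚ c) b = 1)

include hS hcc hcb in
lemma add_I_smul_mem_tubeDomain (hT : AtMostTwoPositive S) (hD : IsAffineCone S D) {x y : ι → ℝ}
    (hxc : form S x (vecCast ℝ c) = 0) (hxb : form S x (vecCast ℝ b) = 0)
    (hy : y ∈ positiveCone S D c b) :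
    vecCast ℂ x + Complex.I • vecCast ℂ y ∈ tubeDomain S D c b := by
  obtain ⟨y₀, -, -, -, hy₀⟩ := exists_mem_tubeDomain_iff hS hcc hcb hT hD
  have h := (hy₀ _).1 hy
  rw [imVec_I_smul] at h
  refine (hy₀ _).2 ⟨?_, ?_, ?_⟩
  · rw [form_add_left, h.1, ← vecCast_vecCast (B := ℝ) c, form_vecCast, hxc]; simp
  · rw [form_add_left, h.2.1, ← vecCast_vecCast (B := ℝ) b, form_vecCast, hxb]; simp
  · rw [imVec_re_add_im]
    exact h.2.2

include hS hcc hcb in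
/-- The closure of the positive cone of a hyperbolic space is self-dual: a vector outside it has
negative product with some integral vector of the positive cone. -/
lemma exists_int_form_neg (hT : AtMostTwoPositive S) (hD : IsAffineCone S D) {l : ι → ℚ}
    (hl : InOrthRat S c b l) (hout : l ∉ closedConeRat S D c b) :
    ∃ u : ι → ℤ, form S u c = 0 ∧ form S (vecCast ℚ u) b = 0 ∧
      vecCast ℝ u ∈ positiveCone S D c b ∧ form S (vecCast ℝ l) (vecCast ℝ u) < 0 := by
  obtain ⟨y₀, h0c, h0b, h0pos, hy₀⟩ := exists_mem_tubeDomain_iff hS hcc hcb hT hD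
  have hpc := mem_positiveCone_iff hS hcc hcb hy₀
  have hlc : form S (vecCast ℝ l) (vecCast ℝ c) = 0 := by
    rw [← vecCast_vecCast (B := ℚ) c, form_vecCast, hl.1, map_zero]
  have hlb : form S (vecCast ℝ l) (vecCast ℝ b) = 0 := by rw [form_vecCast, hl.2, map_zero]
  obtain ⟨y, hy, hly⟩ : ∃ y ∈ positiveCone S D c b, form S (vecCast ℝ l) y < 0 := by
    by_contra hcon
    push Not at hcon
    have hll : form S l l < 0 := by
      by_contra h
      exact hout ⟨hl, not_lt.1 h, hcon⟩
    have hllR : form S (vecCast ℝ l) (vecCast ℝ l) < 0 := by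
      rw [form_vecCast, eq_ratCast]
      exact_mod_cast hll
    set L := vecCast ℝ l with hL
    have hy0 : y₀ ∈ positiveCone S D c b := (hpc _).2 ⟨h0c, h0b, h0pos, h0pos⟩
    have hLy0 := hcon y₀ hy0
    -- the projection of `y₀` to the orthogonal complement of `l` has bigger square than `y₀`
    set q := form S L y₀ / form S L L with hq
    have hqL : q * form S L L = form S L y₀ := div_mul_cancel₀ _ hllR.ne
    have hq0 : q ≤ 0 := div_nonpos_of_nonneg_of_nonpos hLy0 hllR.le
    set w := y₀ - q • L with hw
    have hLw : form S L w = 0 := by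
      rw [hw, form_sub_right, form_smul_right, hqL, sub_self]
    have hwy : form S w y₀ = form S y₀ y₀ - q * form S L y₀ := by
      rw [hw, form_sub_left, form_smul_left]
    have hww : form S w w = form S w y₀ := by
      conv_lhs => enter [3]; rw [hw]
      rw [form_sub_right, form_smul_right, form_comm hS w L, hLw, mul_zero, sub_zero]
    have hwpos : 0 < form S w w := by
      rw [hww, hwy]
      nlinarith
    set t := 1 - form S L L / form S w w with ht
    have ht1 : 1 ≤ t := by
      have : form S L L / form S w w ≤ 0 := div_nonpos_of_nonpos_of_nonneg hllR.le hwpos.le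
      linarith
    have htw : t * form S w w = form S w w - form S L L := by
      rw [ht, sub_mul, one_mul, div_mul_cancel₀ _ hwpos.ne']
    have hmem : t • w + L ∈ positiveCone S D c b := by
      refine (hpc _).2 ⟨?_, ?_, ?_, ?_⟩
      · simp only [hw, form_add_left, form_smul_left, form_sub_left, h0c, hlc]; ring
      · simp only [hw, form_add_left, form_smul_left, form_sub_left, h0b, hlb]; ring
      · simp only [form_add_left, form_smul_left, form_add_right, form_smul_right, hLw,
          form_comm hS w L]
        nlinarith
      · rw [form_add_left, form_smul_left, ← hww]
        nlinarith
    have := hcon _ hmem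
    rw [form_add_right, form_smul_right, hLw] at this
    linarith
  obtain ⟨h1, h2, h3, h4⟩ := (hpc y).1 hy
  have hprojc : Continuous (cuspProj S c b : (ι → ℝ) → ι → ℝ) := by
    have h1 := continuous_form S (continuous_id (X := ι → ℝ))
      (continuous_const (y := (vecCast ℝ c : ι → ℝ)))
    have h2 := continuous_form S (continuous_id (X := ι → ℝ))
      (continuous_const (y := (vecCast ℝ b : ι → ℝ)))
    simp only [id] at h1 h2
    unfold cuspProj
    fun_prop
  -- a nearby rational vector
  obtain ⟨q, hq1, hq2, hq3⟩ := exists_rat_mem (U := {x : ι → ℝ |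
      0 < form S (cuspProj S c b x) (cuspProj S c b x) ∧ 0 < form S (cuspProj S c b x) y₀ ∧
      form S (vecCast ℝ l) (cuspProj S c b x) < 0})
    ((isOpen_lt continuous_const (continuous_form S hprojc hprojc)).inter
      ((isOpen_lt continuous_const (continuous_form S hprojc continuous_const)).inter
        (isOpen_lt (continuous_form S continuous_const hprojc) continuous_const)))
    ⟨y, by
      change _ ∧ _ ∧ _
      rw [cuspProj_eq_self h1 h2]
      exact ⟨h3, h4, hly⟩⟩
  obtain ⟨K₁, hK₁, v, hv⟩ := exists_int_multiple q
  obtain ⟨K₀, hK₀, β, hβ⟩ := exists_int_multiple b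
  obtain ⟨u, hu⟩ := exists_int_cuspProj (S := S) c hβ v
  have huQ : vecCast ℚ u = ((K₀ : ℚ) ^ 2 * K₁) • cuspProj S c b q := by
    rw [hu, hv, smul_smul, cuspProj_smul]
  have huR : (vecCast ℝ u : ι → ℝ) = ((K₀ : ℝ) ^ 2 * K₁) • cuspProj S c b (vecCast ℝ q) := by
    rw [← vecCast_vecCast (B := ℚ) u, huQ, vecCast_smul, cuspProj_vecCast]
    simp
  have hpos : (0 : ℝ) < (K₀ : ℝ) ^ 2 * K₁ := by positivity
  refine ⟨u, ?_, ?_, (hpc _).2 ⟨?_, ?_, ?_, ?_⟩, ?_⟩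
  · have h := form_cuspProj_left (R := ℚ) hS hcc hcb (((K₀ : ℚ) ^ 2) • vecCast ℚ v)
    rw [← hu, form_vecCast] at h
    simpa using h
  · have h := form_cuspProj_right (R := ℚ) hS hcc hcb (((K₀ : ℚ) ^ 2) • vecCast ℚ v)
    rw [← hu] at h
    exact h
  · rw [huR, form_smul_left, form_cuspProj_left hS hcc hcb, mul_zero]
  · rw [huR, form_smul_left, form_cuspProj_right hS hcc hcb, mul_zero]
  · rw [huR, form_smul_left, form_smul_right]
    exact mul_pos hpos (mul_pos hpos hq1)
  · rw [huR, form_smul_left]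
    exact mul_pos hpos hq2
  · rw [huR, form_smul_right]
    exact mul_neg_of_pos_of_neg hpos hq3

include hS hcc hcb in
lemma form_int_neg_of_orthogonal (hT : AtMostTwoPositive S) {u v : ι → ℤ}
    (huc : form S u c = 0) (hub : form S (vecCast ℚ u) b = 0) (hupos : 0 < form S u u)
    (hvc : form S v c = 0) (hvb : form S (vecCast ℚ v) b = 0) (huv : form S u v = 0)
    (hv0 : v ≠ 0) : form S v v < 0 := by
  by_contra hcon
  push Not at hcon
  have hz : (vecCast ℝ v : ι → ℝ) = 0 := by
    refine eq_zero_of_orthogonal hS hcc hcb hT (x := vecCast ℝ u) ?_ ?_ ?_ ?_ ?_ ?_ ?_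
    · rw [form_int_left_cast huc, Int.cast_zero]
    · rw [form_rat_cast ℝ hub, map_zero]
    · rw [form_int_left_cast hvc, Int.cast_zero]
    · rw [form_rat_cast ℝ hvb, map_zero]
    · rw [form_int_left_cast rfl]; exact_mod_cast hupos
    · rw [form_int_left_cast huv, Int.cast_zero]
    · rw [form_int_left_cast rfl]; exact_mod_cast hcon
  refine hv0 (vecCast_injective (R := ℝ) (A := ℤ) (fun a b hab => by simpa using hab) ?_)
  rw [hz, vecCast_zero]

include hS hcc hcb in
/-- In rank at least five a positive vector `u` of `L_{c,b}` lies in an integral hyperbolic plane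
without isotropic vectors. -/
lemma exists_anisotropic_plane (hT : AtMostTwoPositive S) (hcard : 5 ≤ Fintype.card ι)
    {u : ι → ℤ} (huc : form S u c = 0) (hub : form S (vecCast ℚ u) b = 0)
    (hupos : 0 < form S u u) :
    ∃ v : ι → ℤ, form S v c = 0 ∧ form S (vecCast ℚ v) b = 0 ∧ form S u v = 0 ∧
      form S v v < 0 ∧ ¬IsSquare (-(form S u u * form S v v)) := by
  have hint : ∀ {x y : ι → ℤ}, form S (vecCast ℚ x) (vecCast ℚ y) = 0 → form S x y = 0 := by
    intro x y h
    rw [form_vecCast] at h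
    simpa using h
  obtain ⟨v, hv0, hv⟩ := exists_int_orthogonal S (k := 3) (by omega)
    ![vecCast ℚ c, b, vecCast ℚ u]
  obtain ⟨w, hw0, hw⟩ := exists_int_orthogonal S (k := 4) (by omega)
    ![vecCast ℚ c, b, vecCast ℚ u, vecCast ℚ v]
  have hvc := hint (hv 0)
  have hvb : form S (vecCast ℚ v) b = 0 := hv 1
  have huv := hint (hv 2)
  rw [form_comm hS] at huv
  have hwc := hint (hw 0)
  have hwb : form S (vecCast ℚ w) b = 0 := hw 1
  have huw := hint (hw 2)
  rw [form_comm hS] at huw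
  have hvw := hint (hw 3)
  rw [form_comm hS] at hvw
  obtain ⟨i, j, hneg, hsq⟩ := exists_not_isSquare hS u hupos
    (form_int_neg_of_orthogonal hS hcc hcb hT huc hub hupos hvc hvb huv hv0)
    (form_int_neg_of_orthogonal hS hcc hcb hT huc hub hupos hwc hwb huw hw0) hvw
  refine ⟨i • v + j • w, ?_, ?_, ?_, hneg, hsq⟩
  · simp only [form_add_left, form_smul_left, hvc, hwc]; ring
  · rw [vecCast_add, vecCast_smul, vecCast_smul, form_add_left, form_smul_left, form_smul_left,
      hvb, hwb, mul_zero, mul_zero, add_zero]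
  · simp only [form_add_right, form_smul_right, huv, huw]; ring

include hS hcc hcb in
/-- A Fourier coefficient whose index is outside the closure of the positive cone vanishes: the
units of a suitable Pell equation move the imaginary part `u` to vectors whose product with the
index tends to `-∞`, while the bound for the function stays the same. -/
lemma eq_zero_of_notMem_closedCone (hT : AtMostTwoPositive S) (hcard : 5 ≤ Fintype.card ι)
    (hD : IsAffineCone S D) {F : (ι → ℂ) → ℂ}
    (hF : ∀ g ∈ stableSOPlus S D, ∀ Z ∈ D, F (act g Z) = F Z)
    (hbd : ∀ y ∈ positiveCone S D c b, ∃ M : ℝ, ∀ x : ι → ℝ, form S x (vecCast ℝ c) = 0 →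
        form S x (vecCast ℝ b) = 0 →
        ‖F (tubePoint S c b (vecCast ℂ x + Complex.I • vecCast ℂ y))‖ ≤ M)
    {l : ι → ℚ} (hl : InOrthRat S c b l) (hout : l ∉ closedConeRat S D c b) {a : ℂ}
    (ha : ∀ y ∈ positiveCone S D c b, ∀ M : ℝ,
        (∀ x : ι → ℝ, form S x (vecCast ℝ c) = 0 → form S x (vecCast ℝ b) = 0 →
          ‖F (tubePoint S c b (vecCast ℂ x + Complex.I • vecCast ℂ y))‖ ≤ M) →
        ‖a‖ ≤ M * Real.exp (2 * Real.pi * form S (vecCast ℝ l) y)) : a = 0 := by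
  obtain ⟨u, huc, hub, hupc, hlu⟩ := exists_int_form_neg hS hcc hcb hT hD hl hout
  have hupos : 0 < form S u u := by
    obtain ⟨y₀, -, -, -, hy₀⟩ := exists_mem_tubeDomain_iff hS hcc hcb hT hD
    have h := ((mem_positiveCone_iff hS hcc hcb hy₀ _).1 hupc).2.2.1
    rw [form_int_left_cast rfl] at h
    exact_mod_cast h
  obtain ⟨v, hvc, hvb, huv, hvneg, hsq⟩ :=
    exists_anisotropic_plane hS hcc hcb hT hcard huc hub hupos
  have hdpos : 0 < -(form S u u * form S v v) := by nlinarith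
  -- solutions of growing size, with the sign chosen according to the product of `l` and `v`
  have hsol : ∀ N : ℕ, ∃ x y : ℤ, x ^ 2 - -(form S u u * form S v v) * y ^ 2 = 1 ∧
      (N : ℤ) < |y| ∧ (2 * x * y : ℝ) * form S (vecCast ℝ l) (vecCast ℝ v) ≤ 0 := by
    intro N
    obtain ⟨x, y, h, hy⟩ := exists_pell_solution hdpos hsq N
    rcases le_total ((2 * x * y : ℝ) * form S (vecCast ℝ l) (vecCast ℝ v)) 0 with h0 | h0
    · exact ⟨x, y, h, hy, h0⟩
    · refine ⟨x, -y, by rwa [neg_sq], by rwa [abs_neg], ?_⟩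
      push_cast
      linarith
  choose x y hxy hy hsign using hsol
  obtain ⟨M, hM⟩ := hbd _ hupc
  refine eq_zero_of_le_exp (M := M)
    (s := fun k => form S (vecCast ℝ l) (pellMove S u v (x k) (y k) (vecCast ℝ u))) ?_ fun k => ?_
  · have hlim : Tendsto (fun k : ℕ => (k : ℝ) * form S (vecCast ℝ l) (vecCast ℝ u)) atTop atBot :=
      tendsto_natCast_atTop_atTop.atTop_mul_const_of_neg hlu
    refine tendsto_atBot_mono (fun k => ?_) hlim
    rw [pellMove_self hS huv, form_add_right, form_smul_right, form_smul_right]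
    have hk : (k : ℤ) ≤ 1 - 2 * form S v v * form S u u * (y k) ^ 2 := by
      have h1 : |y k| ≤ |y k| ^ 2 := by
        have : 1 ≤ |y k| := by have := hy k; omega
        nlinarith
      rw [sq_abs] at h1
      have h2 := hy k
      nlinarith [mul_le_mul_of_nonneg_right (Int.add_one_le_iff.2 hdpos) (sq_nonneg (y k))]
    have hkR : (k : ℝ) ≤ 1 - 2 * (form S v v : ℤ) * (form S u u : ℤ) * (y k : ℝ) ^ 2 := by
      exact_mod_cast hk
    have huuR : (0 : ℝ) < (form S u u : ℤ) := by exact_mod_cast hupos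
    have e1 := mul_le_mul_of_nonpos_right hkR hlu.le
    have e2 := mul_nonpos_of_nonneg_of_nonpos huuR.le (hsign k)
    nlinarith
  · obtain ⟨hmove, -⟩ := apply_tubePoint_pellMove hS hcc hcb hT hD hF huc hub hvc hvb huv hupc
      hvneg (hxy k)
    have hxy' : x k ^ 2 - -(form S u u * form S v v) * (-y k) ^ 2 = 1 := by
      rw [neg_sq]; exact hxy k
    obtain ⟨-, hinv⟩ := apply_tubePoint_pellMove hS hcc hcb hT hD hF huc hub hvc hvb huv hupc
      hvneg hxy'
    refine ha _ hmove M fun w hwc hwb => ?_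
    rw [← hinv _ (add_I_smul_mem_tubeDomain hS hcc hcb hT hD hwc hwb hmove), pellMove_add,
      pellMove_smul, pellMove_vecCast, pellMove_vecCast, pellMove_neg_pellMove hS huv (hxy k)]
    refine hM _ ?_ ?_
    · rw [form_pellMove_right, hwc]
      · rw [form_int_left_cast huc, Int.cast_zero]
      · rw [form_int_left_cast hvc, Int.cast_zero]
    · rw [form_pellMove_right, hwb]
      · rw [form_rat_cast ℝ hub, map_zero]
      · rw [form_rat_cast ℝ hvb, map_zero]

/-- The Koecher principle: in rank at least five holomorphy at the boundary is automatic. -/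
theorem holomorphicAtBoundary_of_five_le_card (hS : S.IsSymm) (hT : AtMostTwoPositive S)
    (hdet : S.det ≠ 0) (hcard : 5 ≤ Fintype.card ι) (hD : IsAffineCone S D) {F : (ι → ℂ) → ℂ}
    (hol : HolomorphicOnCone D F) (hF : ∀ g ∈ stableSOPlus S D, ∀ Z ∈ D, F (act g Z) = F Z) :
    HolomorphicAtBoundary S D F := by
  rintro c b ⟨-, hcc, -, hcb⟩
  obtain ⟨f, hf, hbd, hest⟩ := exists_cusp_expansion hS hcc hcb hT hdet hD hol hF
  refine ⟨f, hf, fun l hl => ?_⟩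
  by_contra hout
  obtain ⟨⟨N, -, hN⟩, -⟩ := hf
  exact hl (eq_zero_of_notMem_closedCone hS hcc hcb hT hcard hD hF hbd (hN l hl).1 hout (hest l hl))

lemma IsModularForm.holomorphicAtBoundary {n : ℕ} (hS : HasSignature S 2 n)
    (hD : IsAffineCone S D) {k : ℤ} {F : (ι → ℂ) → ℂ} (hF : IsModularForm S D k F) :
    HolomorphicAtBoundary S D F := by
  rcases lt_or_ge (Fintype.card ι) (3 + 2) with h | h
  · exact hF.boundary h
  · exact holomorphicAtBoundary_of_five_le_card hS.1 hS.atMostTwoPositive hS.det_ne_zero h hD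
      hF.holomorphic hF.invariant

end Koecher

/-! ### The orthogonal complement of `r` -/

section OrthComplement

variable [DecidableEq ι] [DecidableEq κ] {S : Matrix ι ι ℤ} {r : ι → ℤ}
  (e : Module.Basis κ ℤ (orthLattice S r))

/-- The matrix of the inclusion `r^⊥ → L` in the basis `e`. -/
def orthMatrix : Matrix ι κ ℤ := Matrix.of fun i j => (e j : ι → ℤ) i

/-- The inclusion `r^⊥ ⊗ R → L ⊗ R`. -/
def orthMap {R : Type*} [CommRing R] (w : κ → R) : ι → R :=
  ((orthMatrix e).map (Int.cast : ℤ → R)).mulVec w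

lemma orthEmbed_eq (W : κ → ℂ) : orthEmbed S r e W = orthMap e W := by
  funext i
  simp [orthEmbed, orthMap, orthMatrix, Matrix.mulVec, dotProduct, vecCast, mul_comm]

lemma orthMap_int (w : κ → ℤ) : orthMap e w = ((∑ j, w j • e j : orthLattice S r) : ι → ℤ) := by
  funext i
  simp [orthMap, orthMatrix, Matrix.mulVec, dotProduct, mul_comm]

lemma orthMap_repr (x : orthLattice S r) : orthMap e (fun j => e.repr x j) = x := by
  rw [orthMap_int, e.sum_repr]

lemma orthMap_sub {R : Type*} [CommRing R] (x y : κ → R) :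
    orthMap e (x - y) = orthMap e x - orthMap e y := Matrix.mulVec_sub _ _ _

lemma orthMap_smul {R : Type*} [CommRing R] (t : R) (x : κ → R) :
    orthMap e (t • x) = t • orthMap e x := Matrix.mulVec_smul _ _ _

lemma orthMap_vecCast {A R : Type*} [CommRing A] [CommRing R] [Algebra A R] (w : κ → A) :
    orthMap e (vecCast R w) = vecCast R (orthMap e w) := by
  funext i
  simp [orthMap, Matrix.mulVec, dotProduct, vecCast]

lemma orthGram_eq : orthGram S r e = (orthMatrix e).transpose * S * orthMatrix e := by
  ext i j
  have h : form S (e i : ι → ℤ) (e j : ι → ℤ) =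
      form ((orthMatrix e).transpose * S * orthMatrix e) (Pi.single i 1) (Pi.single j 1) := by
    rw [← form_mulVec S _ (orthMatrix e) rfl]
    change _ = form S (orthMap e (Pi.single i 1)) (orthMap e (Pi.single j 1))
    have hs : ∀ i : κ, orthMap e (Pi.single i (1 : ℤ)) = (e i : ι → ℤ) := by
      intro i
      rw [orthMap_int]
      simp [Pi.single_apply]
    rw [hs, hs]
  rw [orthGram, Matrix.of_apply, h]
  simp [form_eq_sum, Pi.single_apply]

lemma form_orthMap {R : Type*} [CommRing R] (x y : κ → R) :
    form S (orthMap e x) (orthMap e y) = form (orthGram S r e) x y :=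
  form_mulVec S _ (orthMatrix e) (orthGram_eq e).symm x y

lemma form_orthMap_self {R : Type*} [CommRing R] (w : κ → R) :
    form S (orthMap e w) (vecCast R r) = 0 := by
  have h : orthMap e w = ∑ j, w j • vecCast R (e j : ι → ℤ) := by
    funext i
    simp [orthMap, orthMatrix, Matrix.mulVec, dotProduct, vecCast, mul_comm]
  rw [h, form_sum_left]
  refine Finset.sum_eq_zero fun j _ => ?_
  have hj : form S (e j : ι → ℤ) r = 0 := (e j).2
  rw [form_smul_left, form_vecCast, hj, map_zero, mul_zero]

lemma orthGram_isSymm (hS : S.IsSymm) : (orthGram S r e).IsSymm := by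
  ext i j
  exact form_comm hS _ _

/-- The multiple `(r, r) x - (x, r) r` of the orthogonal projection of `x` to `r^⊥`. -/
def orthProjVec (S : Matrix ι ι ℤ) (r x : ι → ℤ) : orthLattice S r :=
  ⟨form S r r • x - form S x r • r, by
    change form S _ _ = 0
    rw [form_sub_left, form_smul_left, form_smul_left, mul_comm, sub_self]⟩

/-- The matrix of `x ↦ (r, r) x - (x, r) r` from `L` to `r^⊥`, in the basis `e` of `r^⊥`. This
multiple of the orthogonal projection is used because it is integral. -/
def orthProj : Matrix κ ι ℤ :=
  Matrix.of fun j i => e.repr (orthProjVec S r (Pi.single i 1)) j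

lemma orthMatrix_mul_orthProj : (orthMatrix e * orthProj e : Matrix ι ι ℤ) =
    form S r r • (1 : Matrix ι ι ℤ) - Matrix.of fun k i => form S (Pi.single i 1) r * r k := by
  ext k i
  have h := congrFun (orthMap_repr e (orthProjVec S r (Pi.single i 1))) k
  have h1 : (orthMatrix e * orthProj e) k i =
      orthMap e (fun j => e.repr (orthProjVec S r (Pi.single i 1)) j) k := by
    simp [orthMap, orthProj, Matrix.mul_apply, Matrix.mulVec, dotProduct]
  rw [h1, h, Matrix.sub_apply, Matrix.smul_apply, Matrix.of_apply, Matrix.one_apply]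
  change form S r r * (Pi.single i 1 : ι → ℤ) k - form S (Pi.single i 1) r * r k = _
  rw [Pi.single_apply, smul_eq_mul]

lemma orthMap_orthProj {R : Type*} [CommRing R] (x : ι → R) :
    orthMap e (((orthProj e).map (Int.cast : ℤ → R)).mulVec x) =
      ((form S r r : ℤ) : R) • x - form S x (vecCast R r) • vecCast R r := by
  have h1 := congrArg (fun M : Matrix ι ι ℤ => (M.map (Int.cast : ℤ → R)).mulVec x)
    (orthMatrix_mul_orthProj e)
  simp only [map_cast_mul] at h1
  rw [orthMap, Matrix.mulVec_mulVec, h1]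
  funext k
  have h2 : form S x (vecCast R r) = ∑ i, x i * ((form S (Pi.single i 1) r : ℤ) : R) := by
    rw [form_eq_sum]
    refine Finset.sum_congr rfl fun i _ => ?_
    simp [form_eq_sum, Pi.single_apply, Finset.mul_sum, vecCast, mul_assoc]
  simp only [Pi.sub_apply, Pi.smul_apply, smul_eq_mul]
  rw [h2]
  simp only [Matrix.mulVec, dotProduct, Matrix.map_apply, Matrix.sub_apply, Matrix.smul_apply,
    Matrix.of_apply, Matrix.one_apply, smul_eq_mul, mul_ite, mul_one, mul_zero, Int.cast_sub,
    Int.cast_mul, sub_mul, Finset.sum_sub_distrib, Int.cast_ite, Int.cast_zero, ite_mul, zero_mul,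
    Finset.sum_ite_eq, Finset.mem_univ, if_true, Finset.sum_mul, vecCast, algebraMap_int_eq,
    eq_intCast]
  congr 1
  exact Finset.sum_congr rfl fun i _ => by ring

lemma orthMap_int_injective : Function.Injective (orthMap e : (κ → ℤ) → ι → ℤ) := by
  intro x y hxy
  rw [orthMap_int, orthMap_int] at hxy
  have h := congrArg (fun z => (e.repr z : κ → ℤ)) (Subtype.ext hxy)
  simpa only [e.repr_sum_self] using h

lemma orthProj_mul_orthMatrix : (orthProj e * orthMatrix e : Matrix κ κ ℤ) =
    form S r r • (1 : Matrix κ κ ℤ) := by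
  refine Matrix.toLin'.injective (LinearMap.ext fun w => orthMap_int_injective e ?_)
  have h := orthMap_orthProj e (orthMap e w)
  rw [form_orthMap_self, zero_smul, sub_zero] at h
  have h1 : ∀ (M : Matrix κ ι ℤ), M.map (Int.cast : ℤ → ℤ) = M := fun M => by ext; simp
  have h2 : orthMap e w = (orthMatrix e).mulVec w := by
    rw [orthMap]; congr 1
  rw [h1, h2, Matrix.mulVec_mulVec] at h
  rw [Matrix.toLin'_apply, Matrix.toLin'_apply, h, ← h2, Matrix.smul_mulVec, Matrix.one_mulVec,
    orthMap_smul]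
  simp

lemma orthProj_orthMap {R : Type*} [CommRing R] (w : κ → R) :
    ((orthProj e).map (Int.cast : ℤ → R)).mulVec (orthMap e w) =
      ((form S r r : ℤ) : R) • w := by
  have h1 := congrArg (fun M : Matrix κ κ ℤ => (M.map (Int.cast : ℤ → R)).mulVec w)
    (orthProj_mul_orthMatrix e)
  simp only [map_cast_mul] at h1
  rw [orthMap, Matrix.mulVec_mulVec, h1]
  have h2 : (form S r r • (1 : Matrix κ κ ℤ)).map (Int.cast : ℤ → R) =
      ((form S r r : ℤ) : R) • (1 : Matrix κ κ R) := by
    ext i j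
    rw [Matrix.map_apply, Matrix.smul_apply, Matrix.smul_apply, Matrix.one_apply,
      Matrix.one_apply]
    split_ifs <;> simp
  rw [h2, Matrix.smul_mulVec, Matrix.one_mulVec]

/-- The projection is adjoint to the inclusion. -/
lemma form_orthProj (hS : S.IsSymm) {R : Type*} [CommRing R] (x : ι → R) (w : κ → R) :
    form (orthGram S r e) (((orthProj e).map (Int.cast : ℤ → R)).mulVec x) w =
      ((form S r r : ℤ) : R) * form S x (orthMap e w) := by
  rw [← form_orthMap, orthMap_orthProj, form_sub_left, form_smul_left, form_smul_left,
    form_comm hS (vecCast R r), form_orthMap_self, mul_zero, sub_zero]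

lemma orthMap_injective (hr : form S r r ≠ 0) {R : Type*} [CommRing R] [IsDomain R]
    [CharZero R] : Function.Injective (orthMap e : (κ → R) → ι → R) := by
  intro x y hxy
  have h := congrArg (((orthProj e).map (Int.cast : ℤ → R)).mulVec) hxy
  rw [orthProj_orthMap, orthProj_orthMap] at h
  exact smul_right_injective (κ → R) (Int.cast_ne_zero.2 hr) h

lemma AtMostTwoPositive.orthGram (hr : form S r r ≠ 0)
    (hT : AtMostTwoPositive S) : AtMostTwoPositive (orthGram S r e) := by
  intro x₁ x₂ x₃ h12 h13 h23 h1 h2 h3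
  simp only [← form_orthMap e] at h12 h13 h23 h1 h2 h3
  have h := hT _ _ _ h12 h13 h23 h1 h2 h3
  refine orthMap_injective e hr ?_
  rw [h, orthMap, Matrix.mulVec_zero]

/-- The orthogonal projection of `L^∨` to `r^⊥ ⊗ ℚ` is contained in `(r^⊥)^∨`. -/
lemma orthProj_mem_dualLattice (hS : S.IsSymm) (hr : form S r r ≠ 0) {x : ι → ℚ}
    (hx : x ∈ dualLattice S) :
    ((form S r r : ℤ) : ℚ)⁻¹ • ((orthProj e).map (Int.cast : ℤ → ℚ)).mulVec x ∈
      dualLattice (orthGram S r e) := by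
  intro w
  obtain ⟨j, hj⟩ := hx (orthMap e w)
  refine ⟨j, ?_⟩
  rw [form_smul_left, form_orthProj e hS, orthMap_vecCast, hj,
    inv_mul_cancel_left₀ (Int.cast_ne_zero.2 hr)]

/-- A stable isometry `g'` of `r^⊥` extends by the identity on `r` to a stable isometry of `L`. The
extension is `x ↦ x + (g' - 1) (P x)` with `P` the orthogonal projection to `r^⊥`; it is integral
because `P` maps `L` into `(r^⊥)^∨`, on which `g' - 1` takes values in `r^⊥`. -/
lemma exists_extension (hS : S.IsSymm) (hr : form S r r ≠ 0) {D : Set (ι → ℂ)}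
    (hD : IsAffineCone S D) {D' : Set (κ → ℂ)} (hD' : IsAffineCone (orthGram S r e) D')
    (hsub : ∀ W ∈ D', orthMap e W ∈ D) {g' : Matrix.SpecialLinearGroup κ ℤ}
    (hg' : g' ∈ stableSOPlus (orthGram S r e) D') :
    ∃ g ∈ stableSOPlus S D, act g (vecCast ℂ r) = vecCast ℂ r ∧
      ∀ W : κ → ℂ, act g (orthMap e W) = orthMap e (act g' W) := by
  obtain ⟨hiso, hdual, himg⟩ := hg'
  set ρ := form S r r with hρ
  have hρQ : (ρ : ℚ) ≠ 0 := Int.cast_ne_zero.2 hr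
  -- `g' - 1` maps the projection of `L^∨` to `r^⊥`, hence it defines a map `T : L → r^⊥`
  have hT : ∀ i : ι, ∃ v : κ → ℤ, ∀ j,
      ρ * v j = (((g' : Matrix κ κ ℤ) - 1) * orthProj e : Matrix κ ι ℤ) j i := by
    intro i
    have hmem : (vecCast ℚ (Pi.single i 1 : ι → ℤ) : ι → ℚ) ∈ dualLattice S := fun w =>
      ⟨form S (Pi.single i 1) w, by rw [form_vecCast]; simp⟩
    obtain ⟨v, hv⟩ := hdual _ (orthProj_mem_dualLattice e hS hr hmem)
    refine ⟨v, fun j => ?_⟩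
    have hj := congrFun hv j
    simp only [Pi.sub_apply, act_eq_mulVec, Matrix.mulVec_smul, Pi.smul_apply, smul_eq_mul] at hj
    have h1 : (ρ : ℚ) * v j =
        ((g' : Matrix κ κ ℤ).map (Int.cast : ℤ → ℚ)).mulVec
          (((orthProj e).map (Int.cast : ℤ → ℚ)).mulVec (vecCast ℚ (Pi.single i 1 : ι → ℤ))) j
        - ((orthProj e).map (Int.cast : ℤ → ℚ)).mulVec
          (vecCast ℚ (Pi.single i 1 : ι → ℤ)) j := by
      have h2 : vecCast ℚ v j = (v j : ℚ) := rfl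
      rw [← h2, ← hj, ← hρ]
      field_simp
    have h3 : ∀ j, ((orthProj e).map (Int.cast : ℤ → ℚ)).mulVec
        (vecCast ℚ (Pi.single i 1 : ι → ℤ)) j = (orthProj e j i : ℚ) := by
      intro j
      simp [Matrix.mulVec, dotProduct, vecCast, Pi.single_apply]
    have h4 : ((ρ * v j : ℤ) : ℚ) = (((((g' : Matrix κ κ ℤ) - 1) * orthProj e : Matrix κ ι ℤ) j i : ℤ) : ℚ) := by
      have h5 := h1
      rw [h3, Matrix.mulVec, dotProduct] at h5
      simp only [h3, Matrix.map_apply] at h5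
      rw [Matrix.sub_mul, Matrix.one_mul, Matrix.sub_apply, Matrix.mul_apply]
      push_cast
      exact h5
    exact_mod_cast h4
  choose v hv using hT
  let T : Matrix κ ι ℤ := Matrix.of fun j i => v i j
  have hTmul : ρ • T = (((g' : Matrix κ κ ℤ) - 1) * orthProj e : Matrix κ ι ℤ) := by
    ext j i
    simpa [T] using hv i j
  have hTE : (T * orthMatrix e : Matrix κ κ ℤ) = (g' : Matrix κ κ ℤ) - 1 := by
    have h : ρ • (T * orthMatrix e : Matrix κ κ ℤ) = ρ • ((g' : Matrix κ κ ℤ) - 1) := by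
      rw [← Matrix.smul_mul, hTmul, Matrix.mul_assoc, orthProj_mul_orthMatrix, Matrix.mul_smul,
        Matrix.mul_one]
    exact smul_right_injective _ hr h
  have hdet : (1 + orthMatrix e * T).det = 1 := by
    rw [Matrix.det_one_add_mul_comm, hTE, add_sub_cancel]
    exact g'.2
  let g : Matrix.SpecialLinearGroup ι ℤ := ⟨1 + orthMatrix e * T, hdet⟩
  have hact : ∀ (R : Type) [CommRing R] (x : ι → R),
      act g x = x + orthMap e ((T.map (Int.cast : ℤ → R)).mulVec x) := by
    intro R _ x
    change ((1 + orthMatrix e * T).map (Int.cast : ℤ → R)).mulVec x = _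
    have h1 : (1 + orthMatrix e * T).map (Int.cast : ℤ → R) =
        1 + ((orthMatrix e).map (Int.cast : ℤ → R) * T.map (Int.cast : ℤ → R) : Matrix ι ι R) := by
      rw [← map_cast_mul]
      ext i j
      simp [Matrix.one_apply]
    rw [h1, Matrix.add_mulVec, Matrix.one_mulVec, ← Matrix.mulVec_mulVec]
    rfl
  have hTmap : ∀ (R : Type) [CommRing R] (x : ι → R),
      (ρ : R) • (T.map (Int.cast : ℤ → R)).mulVec x =
        act g' (((orthProj e).map (Int.cast : ℤ → R)).mulVec x)
          - ((orthProj e).map (Int.cast : ℤ → R)).mulVec x := by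
    intro R _ x
    have h1 := congrArg (fun M : Matrix κ ι ℤ => (M.map (Int.cast : ℤ → R)).mulVec x) hTmul
    simp only [Matrix.sub_mul, Matrix.one_mul] at h1
    have h2 : (ρ • T).map (Int.cast : ℤ → R) = (ρ : R) • T.map (Int.cast : ℤ → R) := by
      ext i j; simp
    have h3 : ((g' : Matrix κ κ ℤ) * orthProj e - orthProj e : Matrix κ ι ℤ).map (Int.cast : ℤ → R) =
        ((g' : Matrix κ κ ℤ).map (Int.cast : ℤ → R) * (orthProj e).map (Int.cast : ℤ → R) :
          Matrix κ ι R) - (orthProj e).map (Int.cast : ℤ → R) := by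
      rw [← map_cast_mul]
      ext i j; simp
    rw [h2, h3, Matrix.smul_mulVec, Matrix.sub_mulVec, ← Matrix.mulVec_mulVec] at h1
    exact h1
  have hemb : ∀ (R : Type) [CommRing R] (w : κ → R),
      act g (orthMap e w) = orthMap e (act g' w) := by
    intro R _ w
    have h1 := congrArg (fun M : Matrix κ κ ℤ => (M.map (Int.cast : ℤ → R)).mulVec w) hTE
    simp only [map_cast_mul] at h1
    have h3 : ((g' : Matrix κ κ ℤ) - 1).map (Int.cast : ℤ → R) =
        (g' : Matrix κ κ ℤ).map (Int.cast : ℤ → R) - (1 : Matrix κ κ R) := by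
      ext i j; simp [Matrix.one_apply]
    rw [h3, ← Matrix.mulVec_mulVec, Matrix.sub_mulVec, Matrix.one_mulVec] at h1
    change (T.map (Int.cast : ℤ → R)).mulVec (orthMap e w) = act g' w - w at h1
    rw [hact, h1, orthMap_sub, add_sub_cancel]
  have hprojr : (orthProj e).mulVec r = 0 := by
    refine orthMap_int_injective e ?_
    have h := orthMap_orthProj e r
    have h1 : (orthProj e).map (Int.cast : ℤ → ℤ) = orthProj e := by ext; simp
    have h2 : (vecCast ℤ r : ι → ℤ) = r := by funext i; simp [vecCast]
    rw [h1, h2] at h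
    rw [h, orthMap, Matrix.mulVec_zero]
    simp
  have hTr : T.mulVec r = 0 := by
    have h : ρ • T.mulVec r = 0 := by
      rw [← Matrix.smul_mulVec, hTmul, ← Matrix.mulVec_mulVec, hprojr, Matrix.mulVec_zero]
    exact (smul_eq_zero.1 h).resolve_left hr
  have hfix : ∀ (R : Type) [CommRing R], act g (vecCast R r) = (vecCast R r : ι → R) := by
    intro R _
    have h1 : (T.map (Int.cast : ℤ → R)).mulVec (vecCast R r) = 0 := by
      funext j
      have := congrArg (Int.cast : ℤ → R) (congrFun hTr j)
      simpa [Matrix.mulVec, dotProduct, vecCast] using this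
    rw [hact, h1, orthMap, Matrix.mulVec_zero, add_zero]
  have hadd : ∀ x y : ι → ℤ, act g (x + y) = act g x + act g y := fun x y =>
    Matrix.mulVec_add _ _ _
  have hsmul : ∀ (t : ℤ) (x : ι → ℤ), act g (t • x) = t • act g x := fun t x =>
    Matrix.mulVec_smul _ _ _
  have hgiso : ∀ x y : ι → ℤ, form S (act g x) (act g y) = form S x y := by
    intro x y
    have hr' : act g r = r := by
      have h2 : (vecCast ℤ r : ι → ℤ) = r := by funext i; simp [vecCast]
      have := hfix ℤ
      rwa [h2] at this
    have hdec : ∀ x : ι → ℤ, ∃ (a : κ → ℤ) (s : ℤ), ρ • x = orthMap e a + s • r := by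
      intro x
      refine ⟨((orthProj e).map (Int.cast : ℤ → ℤ)).mulVec x, form S x r, ?_⟩
      have h := orthMap_orthProj e x
      have h2 : (vecCast ℤ r : ι → ℤ) = r := by funext i; simp [vecCast]
      rw [h2, ← hρ] at h
      exact (sub_eq_iff_eq_add.1 h.symm)
    have horth : ∀ a : κ → ℤ, form S (orthMap e a) r = 0 := by
      intro a
      have h2 : (vecCast ℤ r : ι → ℤ) = r := by funext i; simp [vecCast]
      have := form_orthMap_self e a
      rwa [h2] at this
    obtain ⟨a, s, hx⟩ := hdec x
    obtain ⟨a', s', hy⟩ := hdec y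
    have h1 : form S (act g (ρ • x)) (act g (ρ • y)) = form S (ρ • x) (ρ • y) := by
      rw [hx, hy, hadd, hadd, hsmul, hsmul, hr', hemb ℤ, hemb ℤ]
      simp only [form_add_left, form_add_right, form_smul_left, form_smul_right, form_orthMap,
        hiso, horth, form_comm hS r]
    rw [hsmul, hsmul, form_smul_left, form_smul_right, form_smul_left, form_smul_right] at h1
    exact mul_left_cancel₀ hr (mul_left_cancel₀ hr h1)
  obtain ⟨W, hW⟩ := hD'.nonempty
  refine ⟨g, ⟨hgiso, fun x hx => ?_, act_image_eq hD hgiso (hsub W hW) ?_⟩, hfix ℂ, hemb ℂ⟩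
  · obtain ⟨u, hu⟩ := hdual _ (orthProj_mem_dualLattice e hS hr hx)
    refine ⟨orthMap e u, ?_⟩
    rw [hact, add_sub_cancel_left, ← orthMap_vecCast, ← hu]
    congr 1
    rw [act_eq_mulVec, Matrix.mulVec_smul, ← smul_sub, ← hρ]
    have h := hTmap ℚ x
    rw [act_eq_mulVec] at h
    rw [← h, smul_smul, inv_mul_cancel₀ hρQ, one_smul]
  · rw [hemb ℂ]
    refine hsub _ ?_
    rw [← himg]
    exact ⟨W, hW, rfl⟩

end OrthComplement

/-! ### The quasi pull-back as a limit -/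

section Limits

variable {S : Matrix ι ι ℤ} {D : Set (ι → ℂ)} {F : (ι → ℂ) → ℂ} {r : ι → ℤ} {m : ℕ}

lemma tendsto_div_offDivisor {U : Set (ι → ℂ)} (hU : IsOpen U) {Z : ι → ℂ} (hZ : Z ∈ U)
    {G : (ι → ℂ) → ℂ} (hG : DifferentiableOn ℂ G U)
    (hFG : ∀ W ∈ U ∩ D, F W = form S W (vecCast ℂ r) ^ m * G W) :
    Tendsto (fun W => F W / form S W (vecCast ℂ r) ^ m) (offDivisor S D r Z) (𝓝 (G Z)) := by
  have hc : Tendsto G (offDivisor S D r Z) (𝓝 (G Z)) :=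
    (hG.continuousOn.continuousAt (hU.mem_nhds hZ)).tendsto.mono_left nhdsWithin_le_nhds
  refine hc.congr' ?_
  filter_upwards [mem_nhdsWithin_of_mem_nhds (hU.mem_nhds hZ), self_mem_nhdsWithin]
    with W hW hW'
  rw [hFG W ⟨hW, hW'.1⟩, mul_div_cancel_left₀ _ (pow_ne_zero _ hW'.2)]

/-- A curve of isotropic vectors through the point `Z` of the divisor `(Z, r) = 0`, transversal to
the divisor. The auxiliary isotropic vector `v` is orthogonal to `r` and satisfies `(Z, v) = 1`. -/
def normalCurve (S : Matrix ι ι ℤ) (r : ι → ℤ) (v Z : ι → ℂ) (ζ : ℂ) : ι → ℂ :=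
  Z + ζ • vecCast ℂ r - (ζ ^ 2 * form S (vecCast ℂ r) (vecCast ℂ r) / 2) • v

lemma normalCurve_zero (v Z : ι → ℂ) : normalCurve S r v Z 0 = Z := by
  simp [normalCurve]

lemma continuous_normalCurve (v Z : ι → ℂ) : Continuous (normalCurve S r v Z) := by
  unfold normalCurve; fun_prop

variable (hS : S.IsSymm)

lemma form_normalCurve_right {v Z : ι → ℂ} (hZr : form S Z (vecCast ℂ r) = 0)
    (hvr : form S v (vecCast ℂ r) = 0) (ζ : ℂ) :
    form S (normalCurve S r v Z ζ) (vecCast ℂ r) =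
      ζ * form S (vecCast ℂ r) (vecCast ℂ r) := by
  simp only [normalCurve, form_sub_left, form_add_left, form_smul_left, hZr, hvr]
  ring

include hS

lemma form_normalCurve_self {v Z : ι → ℂ} (hZ : form S Z Z = 0)
    (hZr : form S Z (vecCast ℂ r) = 0) (hv : form S v v = 0) (hZv : form S Z v = 1)
    (hvr : form S v (vecCast ℂ r) = 0) (ζ : ℂ) :
    form S (normalCurve S r v Z ζ) (normalCurve S r v Z ζ) = 0 := by
  simp only [normalCurve, form_sub_left, form_add_left, form_smul_left, form_sub_right,
    form_add_right, form_smul_right, form_comm hS (vecCast ℂ r) Z, form_comm hS v Z, hZ, hZr, hv,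
    hZv, form_comm hS (vecCast ℂ r) v, hvr]
  ring

lemma tendsto_normalCurve (hD : IsAffineCone S D) (hr : form S r r ≠ 0) {v Z : ι → ℂ}
    (hZ : Z ∈ D) (hZr : form S Z (vecCast ℂ r) = 0) (hv : form S v v = 0) (hZv : form S Z v = 1)
    (hvr : form S v (vecCast ℂ r) = 0) :
    Tendsto (normalCurve S r v Z) (𝓝[≠] 0) (offDivisor S D r Z) := by
  have hc := continuous_normalCurve (S := S) (r := r) v Z
  refine tendsto_nhdsWithin_of_tendsto_nhds_of_eventually_within _ ?_ ?_
  · have := hc.tendsto 0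
    rw [normalCurve_zero] at this
    exact this.mono_left nhdsWithin_le_nhds
  · have h1 := hD.eventually_mem_of_curve hc (by rwa [normalCurve_zero])
      (form_normalCurve_self hS (hD.subset_periodCone hZ).1 hZr hv hZv hvr)
    filter_upwards [h1.filter_mono nhdsWithin_le_nhds, self_mem_nhdsWithin] with ζ hζ hζ0
    refine ⟨hζ, ?_⟩
    rw [form_normalCurve_right hZr hvr, form_vecCast]
    exact mul_ne_zero hζ0 (Int.cast_ne_zero.2 hr)

/-- Points of `D` off the divisor accumulate at every point of the divisor, so that limits along
`offDivisor` are unique. -/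
lemma neBot_offDivisor (hD : IsAffineCone S D) (hr : form S r r ≠ 0) {Z : ι → ℂ}
    (hZ : Z ∈ D) (hZr : form S Z (vecCast ℂ r) = 0) : (offDivisor S D r Z).NeBot := by
  have hP := hD.subset_periodCone hZ
  have hne : form S Z (star Z) ≠ 0 := fun h => by
    have := hP.2
    rw [h] at this
    exact lt_irrefl _ this
  have hstar : ∀ x y : ι → ℂ, form S (star x) (star y) = star (form S x y) := by
    intro x y
    simp [form_eq_sum]
  have hr' : star (vecCast ℂ r : ι → ℂ) = vecCast ℂ r := by
    funext i; simp [vecCast]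
  -- a multiple of the conjugate of `Z` is isotropic, orthogonal to `r` and has product `1` with `Z`
  refine (tendsto_normalCurve hS hD hr (v := (form S Z (star Z))⁻¹ • star Z) hZ hZr ?_ ?_ ?_).neBot
  · rw [form_smul_left, form_smul_right, hstar, hP.1]; simp
  · rw [form_smul_right, inv_mul_cancel₀ hne]
  · have h := hstar Z (vecCast ℂ r)
    rw [hr', hZr] at h
    rw [form_smul_left, h]; simp

/-- The quasi pull-back is the holomorphic quotient `G` of `F` by `(Z, r)^m`. -/
lemma quasiPullback_eq (hD : IsAffineCone S D) (hr : form S r r ≠ 0) {Z : ι → ℂ}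
    (hZ : Z ∈ D) (hZr : form S Z (vecCast ℂ r) = 0) {U : Set (ι → ℂ)} (hU : IsOpen U)
    (hZU : Z ∈ U) {G : (ι → ℂ) → ℂ} (hG : DifferentiableOn ℂ G U)
    (hFG : ∀ W ∈ U ∩ D, F W = form S W (vecCast ℂ r) ^ m * G W) :
    quasiPullback S D F r m Z = G Z :=
  haveI := neBot_offDivisor hS hD hr hZ hZr
  (tendsto_div_offDivisor hU hZU hG hFG).limUnder_eq

omit hS in
lemma tendsto_quasiPullback (hv : VanishesToOrder S D F r m) {Z : ι → ℂ} (hZ : Z ∈ D)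
    (hZr : form S Z (vecCast ℂ r) = 0) :
    Tendsto (fun W => F W / form S W (vecCast ℂ r) ^ m) (offDivisor S D r Z)
      (𝓝 (quasiPullback S D F r m Z)) := by
  obtain ⟨U, hU, hZU, G, hG, hFG⟩ := hv Z hZ hZr
  exact tendsto_nhds_limUnder ⟨_, tendsto_div_offDivisor hU hZU hG hFG⟩

/-- The quasi pull-back transforms like `F(Z) / (Z, r)^m` under maps of `D` that multiply `(Z, r)`
by a constant. -/
lemma quasiPullback_comp (hD : IsAffineCone S D) (hr : form S r r ≠ 0)
    (hv : VanishesToOrder S D F r m) {A : (ι → ℂ) → ι → ℂ} (hA : Continuous A)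
    (hAD : ∀ W ∈ D, A W ∈ D) {s a : ℂ} (hs : s ≠ 0)
    (hAr : ∀ W, form S (A W) (vecCast ℂ r) = s * form S W (vecCast ℂ r))
    (hAF : ∀ W ∈ D, F (A W) = a * F W) {Z : ι → ℂ} (hZ : Z ∈ D)
    (hZr : form S Z (vecCast ℂ r) = 0) :
    quasiPullback S D F r m (A Z) = a / s ^ m * quasiPullback S D F r m Z := by
  have := neBot_offDivisor hS hD hr hZ hZr
  have hmap : Tendsto A (offDivisor S D r Z) (offDivisor S D r (A Z)) := by
    refine tendsto_nhdsWithin_of_tendsto_nhds_of_eventually_within _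
      (hA.continuousAt.tendsto.mono_left nhdsWithin_le_nhds) ?_
    filter_upwards [self_mem_nhdsWithin] with W hW
    exact ⟨hAD W hW.1, by rw [hAr]; exact mul_ne_zero hs hW.2⟩
  have h1 := (tendsto_quasiPullback hv (hAD Z hZ) (by rw [hAr, hZr, mul_zero])).comp hmap
  have h2 := (tendsto_quasiPullback hv hZ hZr).const_mul (a / s ^ m)
  refine tendsto_nhds_unique h1 (h2.congr' ?_)
  filter_upwards [self_mem_nhdsWithin] with W hW
  rw [Function.comp_apply, hAF W hW.1, hAr, mul_pow, div_mul_div_comm]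

end Limits

section Modularity

variable [DecidableEq ι] [DecidableEq κ] {S : Matrix ι ι ℤ} {D : Set (ι → ℂ)} {F : (ι → ℂ) → ℂ}
  {r : ι → ℤ} {m : ℕ} (hS : S.IsSymm) (hD : IsAffineCone S D) (hr : form S r r ≠ 0)
  (hv : VanishesToOrder S D F r m) (e : Module.Basis κ ℤ (orthLattice S r)) {D' : Set (κ → ℂ)}
  (hsub : ∀ W ∈ D', orthMap e W ∈ D)

include hS hD hr hv hsub

lemma holomorphicOnCone_quasiPullback :
    HolomorphicOnCone D' fun W => quasiPullback S D F r m (orthMap e W) := by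
  intro W hW
  obtain ⟨U, hU, hZU, G, hG, hFG⟩ := hv _ (hsub W hW) (form_orthMap_self e W)
  have hd : Differentiable ℂ (orthMap e : (κ → ℂ) → ι → ℂ) := by
    unfold orthMap Matrix.mulVec dotProduct; fun_prop
  refine ⟨orthMap e ⁻¹' U, hU.preimage hd.continuous, hZU, fun W => G (orthMap e W),
    hG.comp hd.differentiableOn fun _ h => h, fun W' hW' => ?_⟩
  exact quasiPullback_eq hS hD hr (hsub W' hW'.2) (form_orthMap_self e W') hU hW'.1 hG hFG

lemma quasiPullback_smul {k : ℤ}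
    (hF : ∀ t : ℂ, t ≠ 0 → ∀ Z ∈ D, F (t • Z) = t ^ (-k) * F Z) {t : ℂ} (ht : t ≠ 0)
    {W : κ → ℂ} (hW : W ∈ D') :
    quasiPullback S D F r m (orthMap e (t • W)) =
      t ^ (-(k + m)) * quasiPullback S D F r m (orthMap e W) := by
  have h := quasiPullback_comp hS hD hr hv (A := fun Z => t • Z) (by fun_prop)
    (fun Z hZ => hD.smul_mem ht hZ) ht (fun Z => form_smul_left S t Z (vecCast ℂ r)) (hF t ht)
    (hsub W hW) (form_orthMap_self e W)
  rw [orthMap_smul, h, neg_add, zpow_add₀ ht, zpow_neg t m, zpow_natCast, div_eq_mul_inv]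

lemma quasiPullback_act (hD' : IsAffineCone (orthGram S r e) D')
    (hF : ∀ g ∈ stableSOPlus S D, ∀ Z ∈ D, F (act g Z) = F Z)
    {g' : Matrix.SpecialLinearGroup κ ℤ} (hg' : g' ∈ stableSOPlus (orthGram S r e) D')
    {W : κ → ℂ} (hW : W ∈ D') :
    quasiPullback S D F r m (orthMap e (act g' W)) = quasiPullback S D F r m (orthMap e W) := by
  obtain ⟨g, hg, hgr, hge⟩ := exists_extension e hS hr hD hD' hsub hg'
  rw [← hge, quasiPullback_comp hS hD hr hv (A := act g) (continuous_act g)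
    (fun Z hZ => hg.2.2 ▸ Set.mem_image_of_mem _ hZ) (s := 1) (a := 1) one_ne_zero
    (fun Z => ?_) (fun Z hZ => by rw [hF g hg Z hZ, one_mul]) (hsub W hW)
    (form_orthMap_self e W)]
  · simp
  · conv_lhs => rw [← hgr]
    rw [form_act hg.1, one_mul]

end Modularity

/-! ### Taylor coefficients of exponential sums -/

/-- If the quotient of a convergent power series by `ζ^m` has a limit at `0`, then that limit is the
`m`-th coefficient. -/
lemma coeff_eq_of_tendsto {ε : ℝ} (hε : 0 < ε) (m : ℕ) {q : ℂ} {B : ℕ → ℂ}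
    (hB : Summable fun j => ‖B j‖ * ε ^ j)
    (h : Tendsto (fun ζ : ℂ => (∑' j, B j * ζ ^ j) / ζ ^ m) (𝓝[≠] 0) (𝓝 q)) : B m = q := by
  have hsum : ∀ {B : ℕ → ℂ}, (Summable fun j => ‖B j‖ * ε ^ j) → ∀ ζ ∈ Metric.ball (0 : ℂ) ε,
      ∀ j, ‖B j * ζ ^ j‖ ≤ ‖B j‖ * ε ^ j := by
    intro B _ ζ hζ j
    rw [norm_mul, norm_pow]
    have : ‖ζ‖ ≤ ε := (mem_ball_zero_iff.1 hζ).le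
    gcongr
  have hcont : ∀ {B : ℕ → ℂ}, (Summable fun j => ‖B j‖ * ε ^ j) →
      Tendsto (fun ζ : ℂ => ∑' j, B j * ζ ^ j) (𝓝[≠] 0) (𝓝 (B 0)) := by
    intro B hB
    have h1 : ContinuousOn (fun ζ : ℂ => ∑' j, B j * ζ ^ j) (Metric.ball 0 ε) :=
      continuousOn_tsum (fun j => by fun_prop) hB fun j ζ hζ => hsum hB ζ hζ j
    have h2 := (h1.continuousAt (Metric.ball_mem_nhds 0 hε)).tendsto
    have h3 : ∑' j, B j * (0 : ℂ) ^ j = B 0 := by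
      rw [tsum_eq_single 0 fun j hj => by simp [hj]]
      simp
    rw [h3] at h2
    exact h2.mono_left nhdsWithin_le_nhds
  induction m generalizing B with
  | zero =>
    simp only [pow_zero, div_one] at h
    exact tendsto_nhds_unique (hcont hB) h
  | succ m ih =>
    have hB' : Summable fun j => ‖B (j + 1)‖ * ε ^ j := by
      have h1 := ((summable_nat_add_iff 1).2 hB).mul_right ε⁻¹
      refine h1.congr fun j => ?_
      rw [pow_succ]
      field_simp
    have h0 : B 0 = 0 := by
      have h1 : Tendsto (fun ζ : ℂ => ζ ^ (m + 1)) (𝓝[≠] 0) (𝓝 0) := by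
        have : Tendsto (fun ζ : ℂ => ζ ^ (m + 1)) (𝓝 0) (𝓝 (0 ^ (m + 1))) :=
          (continuous_pow (m + 1)).tendsto 0
        rw [zero_pow m.succ_ne_zero] at this
        exact this.mono_left nhdsWithin_le_nhds
      have h2 := h.mul h1
      rw [mul_zero] at h2
      refine tendsto_nhds_unique (hcont hB) (h2.congr' ?_)
      filter_upwards [self_mem_nhdsWithin] with ζ hζ
      exact div_mul_cancel₀ _ (pow_ne_zero _ hζ)
    refine ih hB' (h.congr' ?_)
    filter_upwards [self_mem_nhdsWithin, mem_nhdsWithin_of_mem_nhds (Metric.ball_mem_nhds 0 hε)]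
      with ζ hζ hζ'
    have h1 : Summable fun j => B j * ζ ^ j := Summable.of_norm_bounded hB (hsum hB ζ hζ')
    have h2 : ∑' j, B j * ζ ^ j = ζ * ∑' j, B (j + 1) * ζ ^ j := by
      rw [h1.tsum_eq_zero_add, h0, ← tsum_mul_left]
      simp only [pow_zero, zero_mul, zero_add]
      exact tsum_congr fun j => by ring
    rw [h2, pow_succ', mul_div_mul_left _ _ hζ]

/-- If an exponential sum with imaginary exponents converges near `0`, then its expansion in powers
of `ζ` is obtained by expanding every term. -/
lemma hasSum_taylor_coeff {α : Type*} {A : α → ℂ} {s : α → ℝ} {ψ : ℂ → ℂ} {m : ℕ} {q : ℂ}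
    (hψ : ∀ᶠ ζ : ℂ in 𝓝 0, HasSum (fun l => A l * Complex.exp (ζ * (s l * Complex.I))) (ψ ζ))
    (hq : Tendsto (fun ζ => ψ ζ / ζ ^ m) (𝓝[≠] 0) (𝓝 q)) :
    HasSum (fun l => A l * ((s l * Complex.I) ^ m / (m.factorial : ℂ))) q := by
  obtain ⟨δ, hδ, hball⟩ := Metric.eventually_nhds_iff_ball.1 hψ
  obtain ⟨ε, hε, hεδ⟩ := exists_between hδ
  -- absolute convergence at `ζ = ± i ε`, where the exponentials are real, dominates both signs of
  -- the exponents
  have hexp : Summable fun l => ‖A l‖ * Real.exp (ε * |s l|) := by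
    have h1 := (hball ((ε : ℂ) * Complex.I) (by simpa [abs_of_pos hε])).summable.norm
    have h2 := (hball (-(ε : ℂ) * Complex.I) (by simpa [abs_of_pos hε])).summable.norm
    refine Summable.of_nonneg_of_le (fun l => by positivity) (fun l => ?_) (h1.add h2)
    have e1 : ((ε : ℂ) * Complex.I * (s l * Complex.I)).re = -(ε * s l) := by simp
    have e2 : (-(ε : ℂ) * Complex.I * (s l * Complex.I)).re = ε * s l := by simp
    rw [norm_mul, norm_mul, Complex.norm_exp, Complex.norm_exp, e1, e2, ← mul_add]
    gcongr
    rcases abs_cases (s l) with ⟨h, -⟩ | ⟨h, -⟩ <;> rw [h]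
    · linarith [Real.exp_pos (-(ε * s l))]
    · rw [mul_neg]
      linarith [Real.exp_pos (ε * s l)]
  have hnorm : Summable fun p : α × ℕ => ‖A p.1‖ * ((ε * |s p.1|) ^ p.2 / (p.2.factorial : ℝ)) := by
    have hin : ∀ l, HasSum (fun j : ℕ => ‖A l‖ * ((ε * |s l|) ^ j / (j.factorial : ℝ)))
        (‖A l‖ * Real.exp (ε * |s l|)) := by
      intro l
      have h := NormedSpace.expSeries_div_hasSum_exp (𝔸 := ℝ) (ε * |s l|)
      rw [← Real.exp_eq_exp_ℝ] at h
      exact h.mul_left _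
    refine (summable_prod_of_nonneg fun p => by positivity).2 ⟨fun l => (hin l).summable, ?_⟩
    exact hexp.congr fun l => (hin l).tsum_eq.symm
  have hterm : ∀ (l : α) (j : ℕ) (ζ : ℂ), ‖ζ‖ ≤ ε →
      ‖A l * ((s l * Complex.I) ^ j / (j.factorial : ℂ)) * ζ ^ j‖ ≤
        ‖A l‖ * ((ε * |s l|) ^ j / (j.factorial : ℝ)) := by
    intro l j ζ hζ
    simp only [norm_mul, norm_div, norm_pow, Complex.norm_real, Complex.norm_I, mul_one,
      Real.norm_eq_abs, Complex.norm_natCast]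
    rw [mul_pow]
    calc ‖A l‖ * (|s l| ^ j / (j.factorial : ℝ)) * ‖ζ‖ ^ j
        ≤ ‖A l‖ * (|s l| ^ j / (j.factorial : ℝ)) * ε ^ j := by gcongr
      _ = _ := by ring
  have hsummable : ∀ ζ : ℂ, ‖ζ‖ ≤ ε → Summable fun p : α × ℕ =>
      A p.1 * ((s p.1 * Complex.I) ^ p.2 / (p.2.factorial : ℂ)) * ζ ^ p.2 := fun ζ hζ =>
    Summable.of_norm_bounded hnorm fun p => hterm p.1 p.2 ζ hζ
  have hB : ∀ j, Summable fun l => A l * ((s l * Complex.I) ^ j / (j.factorial : ℂ)) := by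
    intro j
    have h1 := (hsummable (ε : ℂ) (by simp [abs_of_pos hε])).prod_symm.prod_factor j
    have hne : (ε : ℂ) ^ j ≠ 0 := pow_ne_zero _ (by exact_mod_cast hε.ne')
    refine (h1.mul_right ((ε : ℂ) ^ j)⁻¹).congr fun l => ?_
    exact mul_inv_cancel_right₀ hne _
  have hBsum : Summable fun j : ℕ =>
      ‖∑' l, A l * ((s l * Complex.I) ^ j / (j.factorial : ℂ))‖ * ε ^ j := by
    have h1 := hnorm.prod_symm
    refine Summable.of_nonneg_of_le (fun j => by positivity) (fun j => ?_) h1.prod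
    have h2 : ‖∑' l, A l * ((s l * Complex.I) ^ j / (j.factorial : ℂ))‖ * ε ^ j =
        ‖∑' l, A l * ((s l * Complex.I) ^ j / (j.factorial : ℂ)) * (ε : ℂ) ^ j‖ := by
      rw [tsum_mul_right, norm_mul, norm_pow, Complex.norm_real, Real.norm_eq_abs, abs_of_pos hε]
    rw [h2]
    exact tsum_of_norm_bounded (h1.prod_factor j).hasSum fun l =>
      hterm l j ε (by simp [abs_of_pos hε])
  have hmain : ∀ ζ ∈ Metric.ball (0 : ℂ) ε, ψ ζ =
      ∑' j : ℕ, (∑' l, A l * ((s l * Complex.I) ^ j / (j.factorial : ℂ))) * ζ ^ j := by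
    intro ζ hζ
    have hζ' : ‖ζ‖ ≤ ε := (mem_ball_zero_iff.1 hζ).le
    rw [← (hball ζ (Metric.ball_subset_ball hεδ.le hζ)).tsum_eq]
    simp only [← tsum_mul_right]
    refine Eq.trans ?_ (Summable.tsum_comm (f := fun (l : α) (j : ℕ) =>
      A l * ((s l * Complex.I) ^ j / (j.factorial : ℂ)) * ζ ^ j) (hsummable ζ hζ')).symm
    refine tsum_congr fun l => ?_
    have h := NormedSpace.expSeries_div_hasSum_exp (𝔸 := ℂ) (ζ * (s l * Complex.I))
    rw [← Complex.exp_eq_exp_ℂ] at h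
    rw [← (h.mul_left (A l)).tsum_eq]
    refine tsum_congr fun j => ?_
    rw [mul_pow]
    ring
  have hfin := coeff_eq_of_tendsto hε m hBsum (hq.congr' ?_)
  · rw [← hfin]
    exact (hB m).hasSum
  · filter_upwards [mem_nhdsWithin_of_mem_nhds (Metric.ball_mem_nhds 0 hε)] with ζ hζ
    rw [hmain ζ hζ]

/-! ### The cusps of the orthogonal complement -/

/-- A primitive vector takes the value `1` on some vector of the dual lattice. -/
lemma exists_mem_dualLattice_form_eq_one [DecidableEq ι] {S : Matrix ι ι ℤ} (hS : S.IsSymm)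
    (hdet : S.det ≠ 0) {c : ι → ℤ} (hc : IsPrimitive c) :
    ∃ b ∈ dualLattice S, form S (vecCast ℚ c) b = 1 := by
  obtain ⟨φ, hφ⟩ : ∃ φ : ι → ℤ, ∑ i, φ i * c i = 1 := by
    obtain ⟨d, hd⟩ := IsPrincipalIdealRing.principal (Ideal.span (Set.range c))
    have hdvd : ∀ i, ∃ a, c i = d * a := fun i => Ideal.mem_span_singleton.1
      (show c i ∈ Submodule.span ℤ {d} from hd ▸ Ideal.subset_span ⟨i, rfl⟩)
    choose w hw using hdvd
    have hu : IsUnit d := hc d w (funext hw)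
    have h1 : (1 : ℤ) ∈ Ideal.span (Set.range c) := by
      rw [hd]
      exact Ideal.mem_span_singleton.2 hu.dvd
    exact Ideal.mem_span_range_iff_exists_fun.1 h1
  obtain ⟨ℓ, -, hℓ⟩ := exists_frequency hS hdet (K := 1) one_pos
  have h : ∀ v : ι → ℤ, form S (ℓ φ) (vecCast ℚ v) = ((∑ i, φ i * v i : ℤ) : ℚ) := by
    intro v
    have h1 := hℓ φ ℚ (vecCast ℚ v)
    have h2 : (vecCast ℚ (ℓ φ) : ι → ℚ) = ℓ φ := rfl
    rw [h2, Nat.cast_one, one_mul] at h1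
    rw [h1]
    simp [dotProduct, vecCast]
  refine ⟨ℓ φ, fun v => ⟨_, h v⟩, ?_⟩
  rw [form_comm hS, h, hφ, Int.cast_one]

section OrthCusp

variable [DecidableEq ι] [DecidableEq κ] {S : Matrix ι ι ℤ} {r : ι → ℤ}
  (e : Module.Basis κ ℤ (orthLattice S r))

lemma form_orthMap_int (w : κ → ℤ) : form S (orthMap e w) r = 0 := by
  rw [orthMap_int]
  exact (∑ j, w j • e j : orthLattice S r).2

/-- `r^⊥` is a primitive sublattice of `L`. -/
lemma IsPrimitive.orthMap {c : κ → ℤ} (hc : IsPrimitive c) : IsPrimitive (orthMap e c) := by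
  intro d w hw
  by_cases hd : d = 0
  · refine hc d 0 (orthMap_int_injective e ?_)
    rw [hw, hd, zero_smul, zero_smul, OrthModular.orthMap, Matrix.mulVec_zero]
  · have h1 := form_orthMap_int e c
    rw [hw, form_smul_left] at h1
    have h2 : form S w r = 0 := (mul_eq_zero.1 h1).resolve_left hd
    refine hc d (fun j => e.repr ⟨w, h2⟩ j) (orthMap_int_injective e ?_)
    rw [orthMap_smul, orthMap_repr, hw]

/-- The orthogonal projection of `L ⊗ ℚ` to `r^⊥ ⊗ ℚ`. -/
def orthProjRat (l : ι → ℚ) : κ → ℚ :=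
  ((form S r r : ℤ) : ℚ)⁻¹ • ((orthProj e).map (Int.cast : ℤ → ℚ)).mulVec l

variable (hS : S.IsSymm) (hr : form S r r ≠ 0)

include hS hr

lemma form_orthProjRat {R : Type*} [CommRing R] [Algebra ℚ R] (l : ι → ℚ) (x : κ → R) :
    form (orthGram S r e) (vecCast R (orthProjRat e l)) x =
      form S (vecCast R l) (orthMap e x) := by
  have h1 : vecCast R (((orthProj e).map (Int.cast : ℤ → ℚ)).mulVec l) =
      ((orthProj e).map (Int.cast : ℤ → R)).mulVec (vecCast R l) := by
    funext j
    simp [Matrix.mulVec, dotProduct, vecCast]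
  have h2 : ((form S r r : ℤ) : R) = algebraMap ℚ R ((form S r r : ℤ) : ℚ) := by simp
  rw [orthProjRat, vecCast_smul, h1, form_smul_left, form_orthProj e hS, h2, ← mul_assoc,
    ← map_mul, inv_mul_cancel₀ (Int.cast_ne_zero.2 hr), map_one, one_mul]

lemma orthMap_orthProjRat (l : ι → ℚ) : orthMap e (orthProjRat e l) =
    l - (((form S r r : ℤ) : ℚ)⁻¹ * form S l (vecCast ℚ r)) • vecCast ℚ r := by
  rw [orthProjRat, orthMap_smul, orthMap_orthProj, smul_sub, smul_smul, smul_smul,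
    inv_mul_cancel₀ (Int.cast_ne_zero.2 hr), one_smul]

lemma form_orthProjRat_self (l : ι → ℚ) :
    form (orthGram S r e) (orthProjRat e l) (orthProjRat e l) =
      form S l l - ((form S r r : ℤ) : ℚ)⁻¹ * form S l (vecCast ℚ r) ^ 2 := by
  have h := form_orthProjRat e hS hr (R := ℚ) l (orthProjRat e l)
  rw [show vecCast ℚ (orthProjRat e l) = orthProjRat e l from rfl,
    show vecCast ℚ l = l from rfl] at h
  rw [h, orthMap_orthProjRat e hS hr, form_sub_right, form_smul_right]
  ring

omit hS hr

/-- The index of the Fourier expansion of the quasi pull-back at the cusp `(c, b)` to which the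
Fourier coefficient of index `l` contributes: the projection of `l` to `r^⊥`, translated along `c`
so as to be orthogonal to `b`. -/
def pullbackIndex (c : κ → ℤ) (b : κ → ℚ) (l : ι → ℚ) : κ → ℚ :=
  orthProjRat e l - form (orthGram S r e) (orthProjRat e l) b • vecCast ℚ c

/-- The contribution of the Fourier coefficient `f l` to the Fourier coefficient of the quasi
pull-back of index `pullbackIndex e c b l`. The exponential factor accounts for the change of the
auxiliary vector `b`; the factor `(2 π i (l, r))^m / (m! (r, r)^m)` comes from the coefficient of
`ζ^m` along the curve `normalCurve`. -/
def pullbackCoeff (b : κ → ℚ) (m : ℕ) (f : (ι → ℚ) → ℂ) (l : ι → ℚ) : ℂ :=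
  f l * Complex.exp (2 * Real.pi * Complex.I *
      form (orthGram S r e) (vecCast ℂ (orthProjRat e l)) (vecCast ℂ b)) *
    ((((2 * Real.pi * (form S l (vecCast ℚ r) : ℚ) : ℝ) : ℂ) * Complex.I) ^ m
      / (m.factorial : ℂ)) / ((form S r r : ℤ) : ℂ) ^ m

end OrthCusp

section Expansion

variable {S : Matrix ι ι ℤ} {D : Set (ι → ℂ)} {F : (ι → ℂ) → ℂ} {f : (ι → ℚ) → ℂ}

/-- The Fourier expansion, written in the homogeneous coordinates normalized by `(Z, c) = 1`. -/
lemma HasFourierExpansion.hasSum (hS : S.IsSymm) {c : ι → ℤ} {b : ι → ℚ} (hcc : form S c c = 0)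
    (hcb : form S (vecCast ℚ c) b = 1) (h : HasFourierExpansion S D c b F f) {Z : ι → ℂ}
    (hZ : Z ∈ D) (hZZ : form S Z Z = 0) (hZc : form S Z (vecCast ℂ c) = 1) :
    HasSum (fun l : ι → ℚ => f l * Complex.exp (2 * Real.pi * Complex.I *
      form S (vecCast ℂ l) Z)) (F Z) := by
  obtain ⟨⟨N, -, hsupp⟩, hsum⟩ := h
  have hpt := tubePoint_cuspProj hS hcb hZZ hZc hcc
  have h := hsum (cuspProj S c b Z) ⟨form_cuspProj_left hS hcc hcb Z,
    form_cuspProj_right hS hcc hcb Z, by rwa [hpt]⟩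
  rw [hpt] at h
  convert h using 2 with l
  by_cases hl : f l = 0
  · simp [hl]
  · obtain ⟨⟨h1, h2⟩, -⟩ := hsupp l hl
    rw [form_left_cuspProj]
    · rw [← vecCast_vecCast (B := ℚ) c, form_vecCast, h1, map_zero]
    · rw [form_vecCast, h2, map_zero]

end Expansion

section Pullback

variable [DecidableEq ι] [DecidableEq κ] {S : Matrix ι ι ℤ} {D : Set (ι → ℂ)} {F : (ι → ℂ) → ℂ}
  {r : ι → ℤ} {m : ℕ} (hS : S.IsSymm) (hD : IsAffineCone S D) (hr : form S r r ≠ 0)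
  (e : Module.Basis κ ℤ (orthLattice S r)) {D' : Set (κ → ℂ)} (hD' : IsAffineCone (orthGram S r e) D')
  (hsub : ∀ W ∈ D', orthMap e W ∈ D) {c : κ → ℤ} {b : κ → ℚ}
  (hcc : form (orthGram S r e) c c = 0) (hcb : form (orthGram S r e) (vecCast ℚ c) b = 1)
  {b' : ι → ℚ} (hcb' : form S (vecCast ℚ (orthMap e c)) b' = 1) {f : (ι → ℚ) → ℂ}

include hS hD hr hsub hcc hcb hcb'

/-- The quasi pull-back as a sum over the Fourier coefficients of `F`, obtained by restricting `F` to
the curve `normalCurve` whose auxiliary vector is the cusp `c`. -/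
lemma hasSum_quasiPullback (hv : VanishesToOrder S D F r m)
    (hf : HasFourierExpansion S D (orthMap e c) b' F f) {w : κ → ℂ}
    (hw : w ∈ tubeDomain (orthGram S r e) D' c b) :
    HasSum (fun l : ι → ℚ => pullbackCoeff e b m f l * Complex.exp (2 * Real.pi * Complex.I *
        form (orthGram S r e) (vecCast ℂ (pullbackIndex e c b l)) w))
      (quasiPullback S D F r m (orthMap e (tubePoint (orthGram S r e) c b w))) := by
  obtain ⟨hwc, hwb, hwD⟩ := hw
  have hS' := orthGram_isSymm e hS
  set Z := orthMap e (tubePoint (orthGram S r e) c b w) with hZdef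
  have hZD : Z ∈ D := hsub _ hwD
  have hZZ := (hD.subset_periodCone hZD).1
  have hZr : form S Z (vecCast ℂ r) = 0 := form_orthMap_self e _
  have hvr : form S (vecCast ℂ (orthMap e c)) (vecCast ℂ r) = 0 := by
    rw [← orthMap_vecCast, form_orthMap_self]
  have hvv : form S (vecCast ℂ (orthMap e c) : ι → ℂ) (vecCast ℂ (orthMap e c)) = 0 := by
    rw [← orthMap_vecCast, form_orthMap, form_cusp_self hcc]
  have hcc₁ : form S (orthMap e c) (orthMap e c) = 0 := by rw [form_orthMap, hcc]
  have hZv : form S Z (vecCast ℂ (orthMap e c)) = 1 := by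
    rw [← orthMap_vecCast, hZdef, form_orthMap, form_tubePoint_cusp hS' hcc hcb hwc]
  have hlc : ∀ l, f l ≠ 0 → form S (vecCast ℂ l) (vecCast ℂ (orthMap e c)) = 0 := by
    intro l hl
    obtain ⟨⟨N, -, hsupp⟩, -⟩ := hf
    rw [← vecCast_vecCast (B := ℚ) (orthMap e c), form_vecCast, (hsupp l hl).1.1, map_zero]
  let γ := normalCurve S r (vecCast ℂ (orthMap e c)) Z
  have hγ : Continuous γ := continuous_normalCurve _ _
  have hγself : ∀ ζ, form S (γ ζ) (γ ζ) = 0 := form_normalCurve_self hS hZZ hZr hvv hZv hvr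
  have hγD : ∀ᶠ ζ in 𝓝 0, γ ζ ∈ D :=
    hD.eventually_mem_of_curve hγ (by rwa [show γ 0 = Z from normalCurve_zero _ _]) hγself
  have hρ : ((form S r r : ℤ) : ℂ) ^ m ≠ 0 := pow_ne_zero _ (Int.cast_ne_zero.2 hr)
  have hrr : form S (vecCast ℂ r) (vecCast ℂ r) = ((form S r r : ℤ) : ℂ) := by
    rw [form_vecCast]; simp
  have hexp : ∀ᶠ ζ in 𝓝 0, HasSum (fun l : ι → ℚ =>
      f l * Complex.exp (2 * Real.pi * Complex.I * form S (vecCast ℂ l) Z) *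
        Complex.exp (ζ * (((2 * Real.pi * (form S l (vecCast ℚ r) : ℚ) : ℝ) : ℂ) * Complex.I)))
      (F (γ ζ)) := by
    filter_upwards [hγD] with ζ hζ
    have hγc : form S (γ ζ) (vecCast ℂ (orthMap e c)) = 1 := by
      simp only [γ, normalCurve, form_sub_left, form_add_left, form_smul_left, hZv, hvv,
        form_comm hS (vecCast ℂ r), hvr]
      ring
    convert hf.hasSum hS hcc₁ hcb' hζ (hγself ζ) hγc using 2 with l
    by_cases hl : f l = 0
    · simp [hl]
    · have h1 : form S (vecCast ℂ l) (vecCast ℂ r) = ((form S l (vecCast ℚ r) : ℚ) : ℂ) := by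
        rw [← vecCast_vecCast (B := ℚ) r, form_vecCast]; rfl
      rw [mul_assoc, ← Complex.exp_add]
      simp only [γ, normalCurve, form_sub_right, form_add_right, form_smul_right, hlc l hl, h1]
      congr 2
      push_cast
      ring
  have hlim : Tendsto (fun ζ => F (γ ζ) / ζ ^ m) (𝓝[≠] 0)
      (𝓝 (quasiPullback S D F r m Z * ((form S r r : ℤ) : ℂ) ^ m)) := by
    have h1 := ((tendsto_quasiPullback hv hZD hZr).comp
      (tendsto_normalCurve hS hD hr hZD hZr hvv hZv hvr)).mul_const (((form S r r : ℤ) : ℂ) ^ m)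
    refine h1.congr fun ζ => ?_
    simp only [Function.comp_apply]
    rw [form_normalCurve_right hZr hvr, hrr, mul_pow, ← div_div, div_mul_cancel₀ _ hρ]
  have h := (hasSum_taylor_coeff hexp hlim).div_const (((form S r r : ℤ) : ℂ) ^ m)
  rw [mul_div_cancel_right₀ _ hρ] at h
  refine Eq.mp (congrArg (fun u : (ι → ℚ) → ℂ => HasSum u _) (funext fun l => Eq.symm ?_)) h
  by_cases hl : f l = 0
  · simp [hl, pullbackCoeff]
  · have h1 : form (orthGram S r e) (vecCast ℂ (orthProjRat e l)) (vecCast ℂ c) = 0 := by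
      rw [form_orthProjRat e hS hr, orthMap_vecCast, hlc l hl]
    have h2 : form S (vecCast ℂ l) Z =
        form (orthGram S r e) (vecCast ℂ (orthProjRat e l)) w +
          form (orthGram S r e) (vecCast ℂ (orthProjRat e l)) (vecCast ℂ b) := by
      rw [hZdef, ← form_orthProjRat e hS hr, form_left_tubePoint h1]
    have h3 : form (orthGram S r e) (vecCast ℂ (pullbackIndex e c b l)) w =
        form (orthGram S r e) (vecCast ℂ (orthProjRat e l)) w := by
      rw [pullbackIndex, vecCast_sub, vecCast_smul, form_sub_left, form_smul_left,
        vecCast_vecCast, form_comm hS' (vecCast ℂ c), hwc, mul_zero, sub_zero]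
    rw [h2, h3, mul_add, Complex.exp_add, pullbackCoeff]
    ring

omit hD hr hsub hcc hcb hcb' hS in
lemma ne_zero_of_pullbackCoeff_ne_zero (hm : 0 < m) {l : ι → ℚ}
    (h : pullbackCoeff e b m f l ≠ 0) : f l ≠ 0 ∧ form S l (vecCast ℚ r) ≠ 0 := by
  refine ⟨fun h0 => h (by simp [pullbackCoeff, h0]), fun h0 => h ?_⟩
  simp [pullbackCoeff, h0, hm.ne']

omit hD hsub hcb' in
lemma inOrthRat_pullbackIndex {l : ι → ℚ} (hl : form S l (vecCast ℚ (orthMap e c)) = 0) :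
    form (orthGram S r e) (orthProjRat e l) (vecCast ℚ c) = 0 ∧
      InOrthRat (orthGram S r e) c b (pullbackIndex e c b l) := by
  have h1 : form (orthGram S r e) (orthProjRat e l) (vecCast ℚ c) = 0 := by
    have h := form_orthProjRat e hS hr (R := ℚ) l (vecCast ℚ c)
    rw [orthMap_vecCast] at h
    exact h.trans hl
  refine ⟨h1, ?_, ?_⟩
  · rw [pullbackIndex, form_sub_left, form_smul_left, h1, form_cusp_self hcc, mul_zero, sub_zero]
  · rw [pullbackIndex, form_sub_left, form_smul_left, hcb, mul_one, sub_self]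

omit hD hsub hcb' hcb hcc in
lemma form_pullbackIndex {R : Type*} [CommRing R] [Algebra ℚ R] (l : ι → ℚ) {x : κ → R}
    (hx : form (orthGram S r e) x (vecCast R c) = 0) :
    form (orthGram S r e) (vecCast R (pullbackIndex e c b l)) x =
      form S (vecCast R l) (orthMap e x) := by
  rw [pullbackIndex, vecCast_sub, vecCast_smul, form_sub_left, form_smul_left,
    vecCast_vecCast, form_comm (orthGram_isSymm e hS) (vecCast R c), hx, mul_zero, sub_zero,
    form_orthProjRat e hS hr]

omit hD hsub hcb' hcb in
/-- The projection of a vector of non-negative norm that is not orthogonal to the negative vector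
`r` has positive norm. -/
lemma form_pullbackIndex_self_pos (hneg : form S r r < 0) {l : ι → ℚ}
    (hl : form S l (vecCast ℚ (orthMap e c)) = 0) (hll : 0 ≤ form S l l)
    (hlr : form S l (vecCast ℚ r) ≠ 0) :
    0 < form (orthGram S r e) (pullbackIndex e c b l) (pullbackIndex e c b l) := by
  have h1 : form (orthGram S r e) (orthProjRat e l) (vecCast ℚ c) = 0 := by
    have h := form_orthProjRat e hS hr (R := ℚ) l (vecCast ℚ c)
    rw [orthMap_vecCast] at h
    exact h.trans hl
  have h2 : form (orthGram S r e) (pullbackIndex e c b l) (pullbackIndex e c b l) =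
      form (orthGram S r e) (orthProjRat e l) (orthProjRat e l) := by
    simp only [pullbackIndex, form_sub_left, form_sub_right, form_smul_left, form_smul_right, h1,
      form_comm (orthGram_isSymm e hS) (vecCast ℚ c), form_cusp_self hcc]
    ring
  have h3 : ((form S r r : ℤ) : ℚ)⁻¹ < 0 := inv_lt_zero.2 (by exact_mod_cast hneg)
  have h4 : 0 < form S l (vecCast ℚ r) ^ 2 := by positivity
  rw [h2, form_orthProjRat_self e hS hr]
  nlinarith

/-- The pull-back of indices preserves non-negativity on the positive cone, because the tube domain
of `r^⊥` at `c` embeds into the tube domain of `L` at `c`. -/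
lemma pullbackIndex_nonneg (hT : AtMostTwoPositive S) {l : ι → ℚ}
    (hl : l ∈ closedConeRat S D (orthMap e c) b') {y : κ → ℝ}
    (hy : y ∈ positiveCone (orthGram S r e) D' c b) :
    0 ≤ form (orthGram S r e) (vecCast ℝ (pullbackIndex e c b l)) y := by
  obtain ⟨⟨hlc, hlb⟩, -, hlpos⟩ := hl
  obtain ⟨hyc, hyb, hyD⟩ := hy
  have hS' := orthGram_isSymm e hS
  have hcc₁ : form S (orthMap e c) (orthMap e c) = 0 := by rw [form_orthMap, hcc]
  set Z := orthMap e (tubePoint (orthGram S r e) c b (Complex.I • vecCast ℂ y)) with hZdef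
  have hZD : Z ∈ D := hsub _ hyD
  have hZZ := (hD.subset_periodCone hZD).1
  have hZv : form S Z (vecCast ℂ (orthMap e c)) = 1 := by
    rw [← orthMap_vecCast, hZdef, form_orthMap, form_tubePoint_cusp hS' hcc hcb hyc]
  have hz : cuspProj S (orthMap e c) b' Z ∈ tubeDomain S D (orthMap e c) b' :=
    ⟨form_cuspProj_left hS hcc₁ hcb' Z, form_cuspProj_right hS hcc₁ hcb' Z, by
      rwa [tubePoint_cuspProj hS hcb' hZZ hZv hcc₁]⟩
  obtain ⟨y₀, -, -, -, hy₀⟩ := exists_mem_tubeDomain_iff hS hcc₁ hcb' hT hD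
  have him : imVec (cuspProj S (orthMap e c) b' Z) ∈ positiveCone S D (orthMap e c) b' :=
    (mem_positiveCone_iff hS hcc₁ hcb' hy₀ _).2 ⟨form_im_of_form_int hz.1,
      form_im_of_form_rat hz.2.1, ((hy₀ _).1 hz).2.2.1, ((hy₀ _).1 hz).2.2.2⟩
  have h := hlpos _ him
  have hlc' : form S (vecCast ℝ l) (vecCast ℝ (orthMap e c)) = 0 := by
    rw [← vecCast_vecCast (B := ℚ) (orthMap e c), form_vecCast, hlc, map_zero]
  rw [imVec_cuspProj, form_left_cuspProj hlc' (by rw [form_vecCast, hlb, map_zero])] at h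
  have hyc' : form (orthGram S r e) y (vecCast ℝ c) = 0 := by
    have := form_im_of_form_int hyc
    rwa [imVec_I_smul] at this
  have hZim : imVec Z = orthMap e (imVec (tubePoint (orthGram S r e) c b
      (Complex.I • vecCast ℂ y))) := by
    funext i
    simp [hZdef, imVec, orthMap, Matrix.mulVec, dotProduct]
  have hpc : form (orthGram S r e) (vecCast ℝ (orthProjRat e l)) (vecCast ℝ c) = 0 := by
    rw [form_orthProjRat e hS hr, orthMap_vecCast, hlc']
  rw [hZim, ← form_orthProjRat e hS hr, tubePoint, imVec_sub, imVec_add, imVec_I_smul,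
    imVec_vecCast_rat, imVec_smul_int, add_zero, form_sub_right, form_smul_right, hpc, mul_zero,
    sub_zero] at h
  rwa [form_pullbackIndex hS hr e l hyc', ← form_orthProjRat e hS hr]

/-- The Fourier expansion of the quasi pull-back at the cusp `(c, b)` of `r^⊥`. All the indices
have positive norm, because only Fourier coefficients of `F` whose index is not orthogonal to `r`
contribute. -/
lemma exists_pullback_expansion (hT : AtMostTwoPositive S) (hneg : form S r r < 0) (hm : 0 < m)
    (hv : VanishesToOrder S D F r m) (hb' : b' ∈ dualLattice S)
    (hf : HasFourierExpansion S D (orthMap e c) b' F f)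
    (hsupp : ∀ l, f l ≠ 0 → l ∈ closedConeRat S D (orthMap e c) b') :
    ∃ g, HasFourierExpansion (orthGram S r e) D' c b
        (fun W => quasiPullback S D F r m (orthMap e W)) g ∧
      ∀ l, g l ≠ 0 → l ∈ closedConeRat (orthGram S r e) D' c b ∧ 0 < form (orthGram S r e) l l := by
  have hS' := orthGram_isSymm e hS
  let g : (κ → ℚ) → ℂ := fun μ => ∑' l : pullbackIndex e c b ⁻¹' {μ}, pullbackCoeff e b m f l
  have hg : ∀ μ, g μ ≠ 0 → ∃ l, pullbackIndex e c b l = μ ∧ f l ≠ 0 ∧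
      form S l (vecCast ℚ r) ≠ 0 := by
    intro μ hμ
    by_contra hcon
    refine hμ ?_
    have : ∀ l : pullbackIndex e c b ⁻¹' {μ}, pullbackCoeff e b m f l = 0 := by
      intro l
      by_contra hl
      exact hcon ⟨l, l.2, ne_zero_of_pullbackCoeff_ne_zero e hm hl⟩
    simp only [g, this, tsum_zero]
  have hcone : ∀ μ, g μ ≠ 0 → μ ∈ closedConeRat (orthGram S r e) D' c b ∧
      0 < form (orthGram S r e) μ μ := by
    intro μ hμ
    obtain ⟨l, rfl, hl, hlr⟩ := hg μ hμ
    have hlc := hsupp l hl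
    have hpos := form_pullbackIndex_self_pos (b := b) hS hr e hcc hneg hlc.1.1 hlc.2.1 hlr
    exact ⟨⟨(inOrthRat_pullbackIndex hS hr e hcc hcb hlc.1.1).2, hpos.le, fun y hy =>
      pullbackIndex_nonneg hS hD hr e hsub hcc hcb hcb' hT hlc hy⟩, hpos⟩
  refine ⟨g, ⟨?_, fun w hw => ?_⟩, hcone⟩
  · obtain ⟨⟨N, hN, hint⟩, -⟩ := hf
    refine ⟨N, hN, fun μ hμ => ⟨(hcone μ hμ).1.1, fun v hv => ?_⟩⟩
    obtain ⟨l, rfl, hl, -⟩ := hg μ hμ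
    obtain ⟨t, ht⟩ := hb' (orthMap e v)
    rw [form_comm hS] at ht
    -- the translate of the image of `v` along the cusp that is orthogonal to `b'`
    have hcast : (vecCast ℚ (orthMap e v - t • orthMap e c) : ι → ℚ) =
        vecCast ℚ (orthMap e v) - (t : ℚ) • vecCast ℚ (orthMap e c) := by
      rw [vecCast_sub, vecCast_smul]; rfl
    have hcc₁ : form S (orthMap e c) (orthMap e c) = 0 := by rw [form_orthMap, hcc]
    obtain ⟨j, hj⟩ := (hint l hl).2 (orthMap e v - t • orthMap e c) ⟨by
      rw [hcast, form_sub_left, form_smul_left, form_cusp_self hcc₁, mul_zero, sub_zero,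
        ← orthMap_vecCast, ← orthMap_vecCast, form_orthMap]
      exact hv.1, by rw [hcast, form_sub_left, form_smul_left, hcb', mul_one, ht, sub_self]⟩
    refine ⟨j, ?_⟩
    rw [← hj, hcast, form_sub_right, form_smul_right, (hsupp l hl).1.1, mul_zero, sub_zero,
      ← orthMap_vecCast]
    congr 1
    exact form_pullbackIndex hS hr e (R := ℚ) l hv.1
  · have h := (hasSum_quasiPullback hS hD hr e hsub hcc hcb hcb' hv hf hw).tsum_fiberwise
      (pullbackIndex e c b)
    refine Eq.mp (congrArg (fun u : (κ → ℚ) → ℂ => HasSum u _) (funext fun μ => ?_)) h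
    rw [← tsum_mul_right]
    refine tsum_congr fun l => ?_
    rw [show pullbackIndex e c b l = μ from l.2]

end Pullback

/-! ### Vanishing at the cusps -/

section Vanishing

variable [DecidableEq ι] {S : Matrix ι ι ℤ} {D : Set (ι → ℂ)} {F : (ι → ℂ) → ℂ} {c : ι → ℤ} {b : ι → ℚ}
  (hS : S.IsSymm) (hcc : form S c c = 0) (hcb : form S (vecCast ℚ c) b = 1)
  (hT : AtMostTwoPositive S) (hD : IsAffineCone S D)

include hS hcc hcb hT hD

/-- A vector of positive norm in the closed positive cone is interior, so its product with a
non-zero isotropic boundary vector is positive. -/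
lemma form_pos_of_closedConeRat {l : ι → ℚ} (hl : l ∈ closedConeRat S D c b)
    (hll : 0 < form S l l) {e : ι → ℤ} (he : e ≠ 0) (hee : form S e e = 0)
    (hec : vecCast ℚ e ∈ closedConeRat S D c b) :
    0 < form S (vecCast ℝ l) (vecCast ℝ e) := by
  obtain ⟨y₀, h0c, h0b, h0pos, hy₀⟩ := exists_mem_tubeDomain_iff hS hcc hcb hT hD
  have hy₀mem : y₀ ∈ positiveCone S D c b :=
    (mem_positiveCone_iff hS hcc hcb hy₀ y₀).2 ⟨h0c, h0b, h0pos, h0pos⟩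
  have horth : ∀ x : ι → ℚ, InOrthRat S c b x → form S (vecCast ℝ x) (vecCast ℝ c) = 0 ∧
      form S (vecCast ℝ x) (vecCast ℝ b) = 0 := by
    rintro x ⟨h1, h2⟩
    rw [← vecCast_vecCast (B := ℚ) c, form_vecCast, h1, form_vecCast, h2, map_zero]
    exact ⟨rfl, rfl⟩
  have hpos : ∀ x : ι → ℚ, x ≠ 0 → x ∈ closedConeRat S D c b →
      0 < form S (vecCast ℝ x) y₀ := by
    intro x hx hxc
    refine lt_of_le_of_ne (hxc.2.2 y₀ hy₀mem) fun h => hx ?_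
    have h1 : 0 ≤ form S (vecCast ℝ x) (vecCast ℝ x) := by
      rw [form_vecCast]
      exact Rat.cast_nonneg.2 hxc.2.1
    have h2 := eq_zero_of_orthogonal hS hcc hcb hT h0c h0b (horth x hxc.1).1 (horth x hxc.1).2 h0pos
      (by rw [form_comm hS, ← h]) h1
    exact vecCast_injective (algebraMap ℚ ℝ).injective (h2.trans vecCast_zero.symm)
  have heQ : (vecCast ℚ e : ι → ℚ) ≠ 0 := fun h => he
    (vecCast_injective (algebraMap ℤ ℚ).injective_int (h.trans vecCast_zero.symm))
  have hlne : l ≠ 0 := by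
    rintro rfl
    rw [form_zero_left] at hll
    exact lt_irrefl _ hll
  have hll' : 0 < form S (vecCast ℝ l) (vecCast ℝ l) := by
    rw [form_vecCast]
    exact Rat.cast_pos.2 hll
  have he1 := horth _ hec.1
  have he2 := hpos _ heQ hec
  rw [vecCast_vecCast] at he1 he2
  exact form_pos_of_same_half hS hcc hcb hT h0c h0b (horth l hl.1).1 (horth l hl.1).2 he1.1 he1.2
    h0pos hll' (by rw [form_vecCast, hee, map_zero]) (hpos l hlne hl) he2

lemma add_boundary_mem_tubeDomain {z : ι → ℂ} (hz : z ∈ tubeDomain S D c b) {e : ι → ℤ}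
    (hee : form S e e = 0) (hec : vecCast ℚ e ∈ closedConeRat S D c b) {t : ℝ} (ht : 0 ≤ t) :
    z + ((t : ℂ) * Complex.I) • vecCast ℂ e ∈ tubeDomain S D c b := by
  obtain ⟨y₀, h0c, h0b, h0pos, hy₀⟩ := exists_mem_tubeDomain_iff hS hcc hcb hT hD
  have hpc := mem_positiveCone_iff hS hcc hcb hy₀
  have h := (hy₀ z).1 hz
  have hy : imVec z ∈ positiveCone S D c b :=
    (hpc _).2 ⟨form_im_of_form_int hz.1, form_im_of_form_rat hz.2.1, h.2.2.1, h.2.2.2⟩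
  have h1 := hec.2.2 _ hy
  have h2 := hec.2.2 _ ((hpc y₀).2 ⟨h0c, h0b, h0pos, h0pos⟩)
  rw [vecCast_vecCast] at h1 h2
  have hec' : form S (vecCast ℂ e) (vecCast ℂ c) = 0 := by
    rw [← vecCast_vecCast (B := ℚ) e, ← vecCast_vecCast (B := ℚ) c, form_vecCast, hec.1.1, map_zero]
  have heb' : form S (vecCast ℂ e) (vecCast ℂ b) = 0 := by
    rw [← vecCast_vecCast (B := ℚ) e, form_vecCast, hec.1.2, map_zero]
  have him : imVec (z + ((t : ℂ) * Complex.I) • vecCast ℂ e) = imVec z + t • vecCast ℝ e := by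
    rw [imVec_add, imVec_smul_int]
    simp
  have hee' : form S (vecCast ℝ e) (vecCast ℝ e) = 0 := by rw [form_vecCast, hee, map_zero]
  refine (hy₀ _).2 ⟨?_, ?_, ?_, ?_⟩
  · rw [form_add_left, form_smul_left, h.1, hec', mul_zero, add_zero]
  · rw [form_add_left, form_smul_left, h.2.1, heb', mul_zero, add_zero]
  · simp only [him, form_add_left, form_add_right, form_smul_left, form_smul_right, hee',
      form_comm hS (imVec z) (vecCast ℝ e)]
    nlinarith [h.2.2.1, mul_nonneg ht h1]
  · rw [him, form_add_left, form_smul_left]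
    linarith [h.2.2.2, mul_nonneg ht h2]

/-- A Fourier series all of whose indices have positive norm is annihilated by the Siegel
operators. -/
lemma tendsto_siegel_zero {g : (ι → ℚ) → ℂ} (hg : HasFourierExpansion S D c b F g)
    (hsupp : ∀ l, g l ≠ 0 → l ∈ closedConeRat S D c b ∧ 0 < form S l l) {e : ι → ℤ}
    (he : e ≠ 0) (hee : form S e e = 0) (hec : vecCast ℚ e ∈ closedConeRat S D c b) {z : ι → ℂ}
    (hz : z ∈ tubeDomain S D c b) :
    Tendsto (fun t : ℝ => F (tubePoint S c b (z + ((t : ℂ) * Complex.I) • vecCast ℂ e)))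
      atTop (𝓝 0) := by
  have hform : ∀ l : ι → ℚ, form S (vecCast ℂ l) (vecCast ℂ e) =
      ((form S (vecCast ℝ l) (vecCast ℝ e) : ℝ) : ℂ) := by
    intro l
    rw [← vecCast_vecCast (B := ℝ) l, ← vecCast_vecCast (B := ℝ) e, form_vecCast]; rfl
  have hterm : ∀ (l : ι → ℚ) (t : ℝ), ‖g l * Complex.exp (2 * Real.pi * Complex.I *
      form S (vecCast ℂ l) (z + ((t : ℂ) * Complex.I) • vecCast ℂ e))‖ =
      ‖g l * Complex.exp (2 * Real.pi * Complex.I * form S (vecCast ℂ l) z)‖ *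
        Real.exp (-(2 * Real.pi * form S (vecCast ℝ l) (vecCast ℝ e)) * t) := by
    intro l t
    rw [form_add_right, form_smul_right, mul_add, Complex.exp_add, ← mul_assoc, norm_mul]
    congr 1
    rw [Complex.norm_exp, hform]
    congr 1
    have : 2 * (Real.pi : ℂ) * Complex.I * ((t : ℂ) * Complex.I *
        ((form S (vecCast ℝ l) (vecCast ℝ e) : ℝ) : ℂ)) =
        ((-(2 * Real.pi * form S (vecCast ℝ l) (vecCast ℝ e)) * t : ℝ) : ℂ) := by
      push_cast
      linear_combination (2 * (Real.pi : ℂ) * t *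
        ((form S (vecCast ℝ l) (vecCast ℝ e) : ℝ) : ℂ)) * Complex.I_mul_I
    rw [this, Complex.ofReal_re]
  have h := tendsto_tsum_of_dominated_convergence (𝓕 := (atTop : Filter ℝ)) (g := fun _ => 0)
    (f := fun (t : ℝ) (l : ι → ℚ) => g l * Complex.exp (2 * Real.pi * Complex.I *
      form S (vecCast ℂ l) (z + ((t : ℂ) * Complex.I) • vecCast ℂ e)))
    (hg.2 z hz).summable.norm ?_ ?_
  · rw [tsum_zero] at h
    refine h.congr' ?_
    filter_upwards [eventually_ge_atTop 0] with t ht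
    exact (hg.2 _ (add_boundary_mem_tubeDomain hS hcc hcb hT hD hz hee hec ht)).tsum_eq
  · intro l
    rw [tendsto_zero_iff_norm_tendsto_zero]
    simp only [hterm]
    by_cases hl : g l = 0
    · simp [hl]
    · have hpos := form_pos_of_closedConeRat hS hcc hcb hT hD (hsupp l hl).1 (hsupp l hl).2 he hee
        hec
      have h1 : Tendsto (fun t : ℝ => -(2 * Real.pi * form S (vecCast ℝ l) (vecCast ℝ e)) * t)
          atTop atBot := tendsto_id.const_mul_atTop_of_neg (by
        have := Real.pi_pos
        exact neg_lt_zero.2 (by positivity))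
      have h2 := (Real.tendsto_exp_atBot.comp h1).const_mul
        ‖g l * Complex.exp (2 * Real.pi * Complex.I * form S (vecCast ℂ l) z)‖
      rwa [mul_zero] at h2
  · filter_upwards [eventually_ge_atTop 0] with t ht l
    rw [hterm]
    by_cases hl : g l = 0
    · simp [hl]
    · have hpos := form_pos_of_closedConeRat hS hcc hcb hT hD (hsupp l hl).1 (hsupp l hl).2 he hee
        hec
      have := Real.pi_pos
      refine mul_le_of_le_one_right (norm_nonneg _) (Real.exp_le_one_iff.2 ?_)
      rw [neg_mul]
      exact neg_nonpos.2 (by positivity)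

end Vanishing

end OrthModular

end

open OrthModular in
theorem theorem6p6 {ι κ : Type*} [Fintype ι] [DecidableEq ι] [Fintype κ] [DecidableEq κ]
    (S : Matrix ι ι ℤ) (n : ℕ) (hS : HasSignature S 2 n)
    (D : Set (ι → ℂ)) (hD : IsAffineCone S D)
    (k : ℤ) (F : (ι → ℂ) → ℂ) (hF : IsModularForm S D k F)
    (r : ι → ℤ) (hr : IsPrimitive r) (hneg : form S r r < 0)
    (m : ℕ) (hm : 0 < m) (hv : VanishesToOrder S D F r m)
    (e : Module.Basis κ ℤ (orthLattice S r))
    (D' : Set (κ → ℂ)) (hD' : IsAffineCone (orthGram S r e) D')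
    (hsub : ∀ W ∈ D', orthEmbed S r e W ∈ D) :
    (∀ W ∈ D', Filter.Tendsto (fun Z => F Z / form S Z (vecCast ℂ r) ^ m)
      (offDivisor S D r (orthEmbed S r e W))
      (nhds (quasiPullback S D F r m (orthEmbed S r e W)))) ∧
    IsCuspForm (orthGram S r e) D' (k + m)
      (fun W => quasiPullback S D F r m (orthEmbed S r e W)) := by
  simp only [orthEmbed_eq] at hsub ⊢
  have hr0 : form S r r ≠ 0 := hneg.ne
  have hT := hS.atMostTwoPositive
  have hT' := hT.orthGram e hr0
  have hS' := orthGram_isSymm e hS.1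
  have hexp : ∀ c b, IsCuspDatum (orthGram S r e) c b →
      ∃ g, HasFourierExpansion (orthGram S r e) D' c b
        (fun W => quasiPullback S D F r m (orthMap e W)) g ∧
      ∀ l, g l ≠ 0 → l ∈ closedConeRat (orthGram S r e) D' c b ∧
        0 < form (orthGram S r e) l l := by
    rintro c b ⟨hc, hcc, -, hcb⟩
    obtain ⟨b', hb', hcb'⟩ := exists_mem_dualLattice_form_eq_one hS.1 hS.det_ne_zero (hc.orthMap e)
    obtain ⟨f, hf, hsupp⟩ := hF.holomorphicAtBoundary hS hD (orthMap e c) b'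
      ⟨hc.orthMap e, by rw [form_orthMap, hcc], hb', hcb'⟩
    exact exists_pullback_expansion hS.1 hD hr0 e hsub hcc hcb hcb' hT hneg hm hv hb' hf hsupp
  refine ⟨fun W hW => tendsto_quasiPullback hv (hsub W hW) (form_orthMap_self e W), ?_⟩
  refine { holomorphic := holomorphicOnCone_quasiPullback hS.1 hD hr0 hv e hsub
           homogeneous := fun t ht W hW =>
            quasiPullback_smul hS.1 hD hr0 hv e hsub hF.homogeneous ht hW
           invariant := fun g hg W hW =>
            quasiPullback_act hS.1 hD hr0 hv e hsub hD' hF.invariant hg hW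
           boundary := fun _ c b h => ?_
           zero_dim := fun c b h => ?_
           one_dim := fun c b h u hu huu huc z hz => ?_ }
  · obtain ⟨g, hg, hsupp⟩ := hexp c b h
    exact ⟨g, hg, fun l hl => (hsupp l hl).1⟩
  · obtain ⟨g, hg, hsupp⟩ := hexp c b h
    refine ⟨g, hg, ?_⟩
    by_contra h0
    have := (hsupp 0 h0).2
    rw [form_zero_left] at this
    exact lt_irrefl _ this
  · obtain ⟨g, hg, hsupp⟩ := hexp c b h
    exact tendsto_siegel_zero hS' h.2.1 h.2.2.2 hT' hD' hg hsupp hu huu huc hz
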